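/- Let $k$ be a field, let $D\ge 1$ be an integer, and let $p_1,p_2,p_3,q_1,q_2,q_3$ be integers, all congruent to $D$ modulo $2$, with $p_1+p_2+p_3=q_1+q_2+q_3=D$. Put $\tilde p_i=p_i/D$ and $\tilde q_i=q_i/D$. Indices are taken modulo $3$. **The category.** Let $A=A_{(\tilde p,\tilde q)}$ be the $k$-linear category with objects $X_1,X_2,X_3$ and $$A(X_i,X_i)=k[x_i,y_i]/(x_iy_i),\qquad A(X_{i-1},X_i)=k[x_i]\,u_{i-1,i}=u_{i-1,i}\,k[y_{i-1}],\qquad A(X_i,X_{i-1})=k[y_{i-1}]\,v_{i,i-1}=v_{i,i-1}\,k[x_i],$$ whose composition is given by these algebra and bimodule structures (with $x_i^{r}u_{i-1,i}=u_{i-1,i}y_{i-1}^{r}$ and $y_{i-1}^{r}v_{i,i-1}=v_{i,i-1}x_i^{r}$) together with $$(x_i^{r} u_{i-1,i})\circ(v_{i,i-1}x_i^l)=x_i^{r+l+1},\qquad (v_{i,i-1}x_i^l)\circ(x_i^{r}u_{i-1,i})=y_{i-1}^{r+l+1},$$ all other compositions being zero. It is $\frac1D\mathbb Z$-graded: the morphisms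 $u_{i-1,i}$ and $v_{i,i-1}$ are odd, of degrees $\tilde p_i$ and $\tilde q_i$, and parity and degree are additive under composition; thus each morphism space is the sum of an even and an odd part, both graded by $\frac1D\mathbb Z$. In the sign rules below, $|a|$ denotes the parity of $a$. **$A_\infty$-structures.** A $\frac1D\mathbb Z$-graded $A_\infty$-structure $m$ on $A$ is a family of multilinear operations $$m_r: A(Y_{r-1},Y_r)\otimes\cdots\otimes A(Y_0,Y_1)\to A(Y_0,Y_r),\qquad r\ge1,$$ of degree $2-r$ and parity $r$ modulo $2$, with $m_1=0$ and $m_2$ the composition, such that for all $r\ge 1$ $$\sum_{s+l+t=r,\ l\ge 1}(-1)^{s+lt}\,m_{r-l+1}(\mathrm{id}^{\otimes s}\otimes m_l\otimes\mathrm{id}^{\otimes t})=0,$$ with the Koszul sign rule $(f\otimes g)(x\otimes y)=(-1)^{|g||x|}f(x)\otimes g(y)$. **Strict homotopies.** Two such structures $m$ and $m'$ are graded strictly homotopic if there are multilinear operations $f_r:A(Y_{r-1},Y_r)\otimes\cdots\otimes A(Y_0,Y_1)\to A(Y_0,Y_r)$, $r\ge 1$, of degree $1-r$ and parity $r-1$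 modulo $2$, with $f_1=\mathrm{id}$, such that for all $N\ge 1$ $$\sum_{r}\ \sum_{u_1+\cdots+u_r=N,\ u_j\ge1}(-1)^{\varepsilon}m'_r(f_{u_1}\otimes\cdots\otimes f_{u_r})=\sum_{s+l+t=N,\ l\ge 1}(-1)^{s+lt}f_{N-l+1}(\mathrm{id}^{\otimes s}\otimes m_l\otimes\mathrm{id}^{\otimes t}),\qquad \varepsilon=\sum_{j=1}^{r}(r-j)(u_j-1).$$ **Proposition.** Graded strict homotopy is an equivalence relation on the set of $\frac1D\mathbb Z$-graded $A_\infty$-structures on $A_{(\tilde p,\tilde q)}$. The constants $$a=m_3(u_{3,1},u_{2,3},u_{1,2})(0),\qquad b=m_3(v_{2,1},v_{3,2},v_{1,3})(0),$$ where $(0)$ denotes the coefficient of $\mathrm{id}_{X_1}$ of an element of $A(X_1,X_1)$, depend only on the graded strict homotopy class of $m$, and $m\mapsto(a,b)$ induces a bijection from the set of graded strict homotopy classes of $\frac1D\mathbb Z$-graded $A_\infty$-structures on $A_{(\tilde p,\tilde q)}$ to $k^2$. -/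

import Mathlib

open CategoryTheory

universe u v w

/-! ## Chains of composable arrows -/

/-- Composable chains in a family `H X Y` of arrows: `nil.cons a₁ |>.cons a₂ ⋯ |>.cons a_k` with
`a_j ∈ H X_{j-1} X_j`. The arrow `a₁`, the one which is applied first, is the innermost one; in the
usual notation `(a_k, …, a₁)` it stands on the right. -/
inductive Chain {ι : Type u} (H : ι → ι → Type v) : ι → ι → Type (max u v)
  | nil (X : ι) : Chain H X X
  | cons {X Y Z : ι} (c : Chain H X Y) (a : H Y Z) : Chain H X Z

namespace Chain

variable {ι : Type u} {H : ι → ι → Type v} {H' : ι → ι → Type w}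

/-- The number of arrows. -/
def length : {X Y : ι} → Chain H X Y → ℕ
  | _, _, nil _ => 0
  | _, _, cons c _ => c.length + 1

/-- Concatenation; the arrows of `c` come first. -/
def append {X Y : ι} (c : Chain H X Y) : {Z : ι} → Chain H Y Z → Chain H X Z
  | _, nil _ => c
  | _, cons c' a => (c.append c').cons a

/-- Apply a map to each arrow of a chain. -/
def map (F : ∀ {X Y : ι}, H X Y → H' X Y) : {X Y : ι} → Chain H X Y → Chain H' X Y
  | _, _, nil _ => nil _
  | _, _, cons c a => (c.map F).cons (F a)

/-- All ways to write a chain as a concatenation of an initial and a final part, both of them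
possibly empty: a chain of length `k` has `k + 1` of them. -/
def splits : {X Z : ι} → Chain H X Z → List (Σ Y : ι, Chain H X Y × Chain H Y Z)
  | X, _, nil _ => [⟨X, nil X, nil X⟩]
  | _, Z, cons c a =>
      c.splits.map (fun t => ⟨t.1, t.2.1, t.2.2.cons a⟩) ++ [⟨Z, c.cons a, nil Z⟩]

/-- Append an arrow to the last block of a chain of blocks (no result if there is no block). -/
def extendLast : {X Y Z : ι} → Chain (Chain H) X Y → H Y Z → List (Chain (Chain H) X Z)
  | _, _, _, nil _, _ => []
  | _, _, _, cons P B, a => [P.cons (B.cons a)]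

/-- All ways to cut a chain into consecutive non-empty blocks: a chain of length `k ≥ 1` has
`2 ^ (k - 1)` of them. -/
def blocks : {X Z : ι} → Chain H X Z → List (Chain (Chain H) X Z)
  | _, _, nil _ => [nil _]
  | _, _, cons (Y := Y) c a =>
      c.blocks.flatMap (fun P => P.cons ((nil Y).cons a) :: extendLast P a)

end Chain

/-! ## Categories with a `(1/D)ℤ`-grading -/

/-- The sign `(-1)^e` for a parity `e`. -/
def paritySign (K : Type w) [Field K] (e : ZMod 2) : K := if e = 0 then 1 else -1

/-- A `(1/D)ℤ`-grading on a `K`-linear category: each morphism space is the direct sum of an even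
and an odd part, each of these is graded by `(1/D)ℤ ⊆ ℚ`, and composition and identities respect
the parity and the degree. The submodule `part X Y e d` consists of the morphisms of parity `e`
and degree `d`. -/
structure FracGrading (D : ℕ) (K : Type w) [Field K] (C : Type u) [Category.{v} C]
    [Preadditive C] [Linear K C] where
  part : ∀ X Y : C, ZMod 2 → ℚ → Submodule K (X ⟶ Y)
  isInternal : ∀ X Y : C,
    DirectSum.IsInternal (fun e : ZMod 2 × ℚ => part X Y e.1 e.2)
  frac : ∀ (X Y : C) (e : ZMod 2) (d : ℚ), part X Y e d ≠ ⊥ → ∃ z : ℤ, d = z / D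
  id_mem : ∀ X : C, 𝟙 X ∈ part X X 0 0
  comp_mem : ∀ {X Y Z : C} {e e' : ZMod 2} {d d' : ℚ} {a : X ⟶ Y} {b : Y ⟶ Z},
    a ∈ part X Y e d → b ∈ part Y Z e' d' → a ≫ b ∈ part X Z (e + e') (d + d')

section AInfinity

variable {D : ℕ} {K : Type w} [Field K] {C : Type u} [Category.{v} C] [Preadditive C] [Linear K C]

/-- A homogeneous morphism, with its parity and its degree. -/
structure Homog (G : FracGrading D K C) (X Y : C) where
  par : ZMod 2
  deg : ℚ
  val : X ⟶ Y
  mem : val ∈ G.part X Y par deg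

/-- Chains of composable morphisms. -/
abbrev HomChain {C : Type u} [Category.{v} C] (X Y : C) : Type (max u v) :=
  Chain (fun X Y : C => X ⟶ Y) X Y

namespace Chain

variable {G : FracGrading D K C}

/-- The chain of morphisms underlying a chain of homogeneous morphisms. -/
def val {X Y : C} (c : Chain (Homog G) X Y) : HomChain X Y := c.map (fun a => a.val)

/-- The sum of the parities. -/
def par : {X Y : C} → Chain (Homog G) X Y → ZMod 2
  | _, _, nil _ => 0
  | _, _, cons c a => c.par + a.par

/-- The sum of the degrees. -/
def deg : {X Y : C} → Chain (Homog G) X Y → ℚ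
  | _, _, nil _ => 0
  | _, _, cons c a => c.deg + a.deg

/-- The sum of `u - 1` over the blocks, where `u` is the length of the block, modulo 2. -/
def excess : {X Y : C} → Chain (Chain (Homog G)) X Y → ZMod 2
  | _, _, nil _ => 0
  | _, _, cons P B => excess P + ((B.length : ZMod 2) - 1)

/-- The exponent, modulo 2, of the sign of `m'_r (f_{u_1} ⊗ ⋯ ⊗ f_{u_r})` on a chain which is cut
into the blocks `B_1, …, B_r` of lengths `u_1, …, u_r`, where `B_1` is the leftmost block, that is,
the last one of the chain: it is
`∑_j (r - j) (u_j - 1)` plus the Koszul sign `∑_{i < j} (u_j - 1) |B_i|`. -/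
def functorSign : {X Y : C} → Chain (Chain (Homog G)) X Y → ZMod 2
  | _, _, nil _ => 0
  | _, _, cons P B =>
      functorSign P + (P.length : ZMod 2) * ((B.length : ZMod 2) - 1) + excess P * B.par

end Chain

/-- A family of operations `φ_k` on composable chains of morphisms of each length `k ≥ 1`, with
`φ_k` a multilinear map `C(X_{k-1}, X_k) × ⋯ × C(X_0, X_1) → C(X_0, X_k)` that shifts the degree
by `δ k` (and the parity by the class of `δ k`). There is no operation on empty chains, which is
recorded as the value `0`. -/
structure Operations (G : FracGrading D K C) (δ : ℕ → ℤ) where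
  op : ∀ {X Y : C}, HomChain X Y → (X ⟶ Y)
  op_nil : ∀ X : C, op (Chain.nil X) = 0
  op_add : ∀ {W X Y Z : C} (c : HomChain W X) (a b : X ⟶ Y) (c' : HomChain Y Z),
    op ((c.cons (a + b)).append c') = op ((c.cons a).append c') + op ((c.cons b).append c')
  op_smul : ∀ {W X Y Z : C} (c : HomChain W X) (r : K) (a : X ⟶ Y) (c' : HomChain Y Z),
    op ((c.cons (r • a)).append c') = r • op ((c.cons a).append c')
  op_mem : ∀ {X Y : C} (c : Chain (Homog G) X Y), 0 < c.length →
    op c.val ∈ G.part X Y (c.par + (δ c.length : ZMod 2)) (c.deg + δ c.length)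

/-- The value at a chain of homogeneous morphisms `(a_k, …, a_1)` of
`∑_{s + l + t = k} (-1)^{s + l t} g_{k - l + 1} (id^{⊗ s} ⊗ m_l ⊗ id^{⊗ t})`.
The chain is cut into its first `t` arrows (the rightmost ones), the following `l` arrows and the
last `s` arrows. The Koszul sign, from moving `m_l`, of degree `2 - l`, past the leftmost `s`
arrows, is `(-1)^{l (|a_k| + ⋯ + |a_{k-s+1}|)}`. The terms with `l = 0` are zero, because
`m` is zero on the empty chain. -/
def insertionSum {G : FracGrading D K C} {δ δ' : ℕ → ℤ} (g : Operations G δ)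
    (m : Operations G δ') {X Y : C} (c : Chain (Homog G) X Y) : X ⟶ Y :=
  (c.splits.map fun r => (r.2.2.splits.map fun r' =>
    paritySign K ((r'.2.2.length : ZMod 2) + (r'.2.1.length : ZMod 2) * (r.2.1.length : ZMod 2)
        + (r'.2.1.length : ZMod 2) * r'.2.2.par) •
      g.op ((r.2.1.val.cons (m.op r'.2.1.val)).append r'.2.2.val)).sum).sum

/-- A `(1/D)ℤ`-graded `A_∞`-structure on a `(1/D)ℤ`-graded category: operations `m_k` of degree
`2 - k` with `m_1 = 0` and `m_2` the composition, which satisfy the `A_∞`-equations. -/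
structure AInfStructure (G : FracGrading D K C) extends Operations G (fun k => 2 - k) where
  op_one : ∀ {X Y : C} (a : X ⟶ Y), op ((Chain.nil X).cons a) = 0
  op_two : ∀ {X Y Z : C} (a : X ⟶ Y) (b : Y ⟶ Z), op (((Chain.nil X).cons a).cons b) = a ≫ b
  ainf : ∀ {X Y : C} (c : Chain (Homog G) X Y),
    insertionSum toOperations toOperations c = 0

/-- A graded strict homotopy between two `A_∞`-structures `m` and `m'` on the same graded
category: an `A_∞`-functor `f` from `m` to `m'` that is the identity on objects, with `f_k` of
degree `1 - k` and `f_1 = id`. -/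
structure StrictHomotopy {G : FracGrading D K C} (m m' : AInfStructure G)
    extends Operations G (fun k => 1 - k) where
  op_one : ∀ {X Y : C} (a : X ⟶ Y), op ((Chain.nil X).cons a) = a
  functor_eq : ∀ {X Y : C} (c : Chain (Homog G) X Y),
    (c.blocks.map fun P =>
      paritySign K P.functorSign • m'.op (P.map (fun B => op B.val))).sum
      = insertionSum toOperations m.toOperations c

/-- Two `A_∞`-structures are strictly homotopic, in the graded sense. -/
def StrictlyHomotopic {G : FracGrading D K C} (m m' : AInfStructure G) : Prop :=
  Nonempty (StrictHomotopy m m')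

end AInfinity

/-! ## The category `A` -/

/-- The monomials which form the bases of the morphism spaces of `A`: identities, positive powers
of `x_i` and of `y_i` (endomorphisms of `X_i`), and the elements
`x_i^k u_{i-1,i} = u_{i-1,i} y_{i-1}^k` from `X_{i-1}` to `X_i` and
`v_{i,i-1} x_i^k = y_{i-1}^k v_{i,i-1}` from `X_i` to `X_{i-1}`. -/
inductive Word (n : ℕ)
  /-- `id_{X_i}` -/
  | one (i : ZMod n)
  /-- `x_i^{k+1}` -/
  | x (i : ZMod n) (k : ℕ)
  /-- `y_i^{k+1}` -/
  | y (i : ZMod n) (k : ℕ)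
  /-- `x_i^k u_{i-1,i}` -/
  | xu (i : ZMod n) (k : ℕ)
  /-- `v_{i,i-1} x_i^k` -/
  | vx (i : ZMod n) (k : ℕ)

namespace Word

variable {n : ℕ}

/-- The index of the source. -/
def src : Word n → ZMod n
  | one i => i
  | x i _ => i
  | y i _ => i
  | xu i _ => i - 1
  | vx i _ => i

/-- The index of the target. -/
def tgt : Word n → ZMod n
  | one i => i
  | x i _ => i
  | y i _ => i
  | xu i _ => i
  | vx i _ => i - 1

/-- The composition `w₂ ∘ w₁` of two composable monomials, which is a monomial or zero
(`none`). Only used if `w₁.tgt = w₂.src`; then the indices match in each of the cases. -/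
def mul : Word n → Word n → Option (Word n)
  | one _, w => some w
  | w, one _ => some w
  | x i a, x _ b => some (x i (a + b + 1))
  | y i a, y _ b => some (y i (a + b + 1))
  | x i a, xu _ b => some (xu i (a + b + 1))
  | xu i a, y _ b => some (xu i (a + b + 1))
  | y _ a, vx j b => some (vx j (a + b + 1))
  | vx i a, x _ b => some (vx i (a + b + 1))
  | xu i a, vx _ b => some (x i (a + b))
  | vx i a, xu _ b => some (y (i - 1) (a + b))
  | _, _ => none

/-- The parity: the generators `u` and `v` are odd. -/
def par : Word n → ZMod 2
  | one _ => 0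
  | x _ _ => 0
  | y _ _ => 0
  | xu _ _ => 1
  | vx _ _ => 1

/-- The degree, when `u_{i-1,i}` has degree `P i` and `v_{i,i-1}` has degree `Q i`. Then `x_i` and
`y_{i-1}` have degree `P i + Q i`. -/
def deg (P Q : ZMod n → ℚ) : Word n → ℚ
  | one _ => 0
  | x i k => (k + 1) * (P i + Q i)
  | y i k => (k + 1) * (P (i + 1) + Q (i + 1))
  | xu i k => P i + k * (P i + Q i)
  | vx i k => Q i + k * (P i + Q i)

theorem src_mul {w₂ w₁ w : Word n} (h : w₁.tgt = w₂.src) (hw : mul w₂ w₁ = some w) :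
    w.src = w₁.src := by
  cases w₂ <;> cases w₁ <;> simp_all [mul, src, tgt] <;> subst hw <;> simp_all

theorem tgt_mul {w₂ w₁ w : Word n} (h : w₁.tgt = w₂.src) (hw : mul w₂ w₁ = some w) :
    w.tgt = w₂.tgt := by
  cases w₂ <;> cases w₁ <;> simp_all [mul, src, tgt] <;> subst hw <;> simp_all [← h]

theorem par_mul {w₂ w₁ w : Word n} (hw : mul w₂ w₁ = some w) :
    w.par = w₁.par + w₂.par := by
  cases w₂ <;> cases w₁ <;> simp_all [mul] <;> subst hw <;> simp [par] <;> decide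

theorem deg_mul (P Q : ZMod n → ℚ) {w₂ w₁ w : Word n} (h : w₁.tgt = w₂.src)
    (hw : mul w₂ w₁ = some w) : w.deg P Q = w₁.deg P Q + w₂.deg P Q := by
  cases w₂ <;> cases w₁ <;> simp_all [mul, src, tgt] <;> subst hw <;> simp [deg] <;>
    (try subst h) <;> (try simp only [sub_add_cancel]) <;> ring

theorem mul_one' (w : Word n) : mul w (one w.src) = some w := by
  cases w <;> simp [mul, src]

theorem one_mul' (w : Word n) : mul (one w.tgt) w = some w := by
  cases w <;> simp [mul]

theorem mul_assoc' {w₃ w₂ w₁ : Word n} (h : w₁.tgt = w₂.src) (h' : w₂.tgt = w₃.src) :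
    (mul w₃ w₂).bind (fun w => mul w w₁) = (mul w₂ w₁).bind (fun w => mul w₃ w) := by
  cases w₃ <;> cases w₂ <;> cases w₁ <;> simp_all [mul, src, tgt] <;> omega

end Word

/-- The monomials from `X_i` to `X_j`. -/
abbrev Mon {n : ℕ} (i j : ZMod n) : Type := {w : Word n // w.src = i ∧ w.tgt = j}

/-- The objects `X_i` of the `K`-linear category `A`, indexed by `ℤ/n`. -/
structure CatA (n : ℕ) (K : Type w) : Type where
  idx : ZMod n

namespace CatA

variable {n : ℕ} {K : Type w} [Field K]

/-- A monomial as an element of `A(X_i, X_j)`; `none` gives zero. (Only used for monomials from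
`X_i` to `X_j`.) -/
noncomputable def mono (K : Type w) [Field K] (i j : ZMod n) : Option (Word n) → (Mon i j →₀ K)
  | none => 0
  | some w => if h : w.src = i ∧ w.tgt = j then Finsupp.single ⟨w, h⟩ 1 else 0

/-- The bilinear extension of the composition of monomials. -/
noncomputable def compL (K : Type w) [Field K] (i j l : ZMod n) :
    (Mon i j →₀ K) →ₗ[K] (Mon j l →₀ K) →ₗ[K] (Mon i l →₀ K) :=
  Finsupp.linearCombination K fun w₁ : Mon i j =>
    Finsupp.linearCombination K fun w₂ : Mon j l => mono K i l (Word.mul w₂.1 w₁.1)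

theorem compL_single {i j l : ZMod n} (w₁ : Mon i j) (w₂ : Mon j l) (r s : K) :
    compL K i j l (Finsupp.single w₁ r) (Finsupp.single w₂ s)
      = (r * s) • mono K i l (Word.mul w₂.1 w₁.1) := by
  simp [compL, Finsupp.linearCombination_single, smul_smul]

theorem compL_id (i j : ZMod n) (f : Mon i j →₀ K) :
    compL K i i j (Finsupp.single ⟨.one i, rfl, rfl⟩ 1) f = f := by
  induction f using Finsupp.induction_linear with
  | zero => simp
  | add f g hf hg => rw [map_add, hf, hg]
  | single w r =>
    obtain ⟨w, rfl, rfl⟩ := w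
    simp [compL_single, Word.mul_one', mono]

theorem id_compL (i j : ZMod n) (f : Mon i j →₀ K) :
    compL K i j j f (Finsupp.single ⟨.one j, rfl, rfl⟩ 1) = f := by
  induction f using Finsupp.induction_linear with
  | zero => simp
  | add f g hf hg => rw [map_add, LinearMap.add_apply, hf, hg]
  | single w r =>
    obtain ⟨w, rfl, rfl⟩ := w
    simp [compL_single, Word.one_mul', mono]

theorem compL_assoc {i j l m : ZMod n} (f : Mon i j →₀ K) (g : Mon j l →₀ K)
    (h : Mon l m →₀ K) :
    compL K i l m (compL K i j l f g) h = compL K i j m f (compL K j l m g h) := by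
  induction f using Finsupp.induction_linear with
  | zero => simp
  | add f f' hf hf' => simp only [map_add, LinearMap.add_apply, hf, hf']
  | single w₁ r₁ =>
  induction g using Finsupp.induction_linear with
  | zero => simp
  | add f f' hf hf' => simp only [map_add, LinearMap.add_apply, hf, hf']
  | single w₂ r₂ =>
  induction h using Finsupp.induction_linear with
  | zero => simp
  | add f f' hf hf' => simp only [map_add, hf, hf']
  | single w₃ r₃ =>
    obtain ⟨w₁, rfl, rfl⟩ := w₁
    obtain ⟨w₂, h₂, rfl⟩ := w₂
    obtain ⟨w₃, h₃, rfl⟩ := w₃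
    have key := Word.mul_assoc' h₂.symm h₃.symm
    simp only [compL_single, map_smul, LinearMap.smul_apply]
    have e₁ : ∀ o, Word.mul w₂ w₁ = o →
        compL K w₁.src w₂.tgt w₃.tgt (mono K _ _ o) (Finsupp.single ⟨w₃, h₃, rfl⟩ r₃)
        = r₃ • mono K _ _ (o.bind fun w => Word.mul w₃ w) := by
      rintro (_ | w) ho
      · simp [mono]
      · have hs := Word.src_mul h₂.symm ho
        have ht := Word.tgt_mul h₂.symm ho
        simp only [mono, hs, ht, and_self, dite_true, compL_single, Option.bind_some, one_mul]
    have e₂ : ∀ o, Word.mul w₃ w₂ = o →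
        compL K w₁.src w₁.tgt w₃.tgt (Finsupp.single ⟨w₁, rfl, rfl⟩ r₁) (mono K _ _ o)
        = r₁ • mono K _ _ (o.bind fun w => Word.mul w w₁) := by
      rintro (_ | w) ho
      · simp [mono]
      · have hs := (Word.src_mul h₃.symm ho).trans h₂
        have ht := Word.tgt_mul h₃.symm ho
        simp only [mono, hs, ht, and_self, dite_true, compL_single, Option.bind_some, mul_one]
    rw [e₁ _ rfl, e₂ _ rfl, key, smul_smul, smul_smul]
    congr 1
    ring

/-- The category structure: `A(X_i, X_j)` is the vector space on the monomials from `X_i` to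
`X_j`. -/
noncomputable instance : Category.{w} (CatA n K) where
  Hom X Y := Mon X.idx Y.idx →₀ K
  id X := Finsupp.single ⟨.one X.idx, rfl, rfl⟩ 1
  comp {X Y Z} f g := compL K X.idx Y.idx Z.idx f g
  id_comp f := compL_id _ _ f
  comp_id f := id_compL _ _ f
  assoc f g h := compL_assoc f g h

noncomputable instance : Preadditive (CatA n K) where
  homGroup X Y := inferInstanceAs (AddCommGroup (Mon X.idx Y.idx →₀ K))
  add_comp X Y Z f f' g := by
    change compL K X.idx Y.idx Z.idx (_ + _) _ = _
    rw [map_add]; rfl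
  comp_add X Y Z f g g' := by
    change compL K X.idx Y.idx Z.idx _ (_ + _) = _
    rw [map_add]; rfl

noncomputable instance : Linear K (CatA n K) where
  homModule X Y := inferInstanceAs (Module K (Mon X.idx Y.idx →₀ K))
  smul_comp X Y Z r f g := by
    change compL K X.idx Y.idx Z.idx (r • _) _ = _
    rw [map_smul]; rfl
  comp_smul X Y Z f r g := by
    change compL K X.idx Y.idx Z.idx _ (r • _) = _
    rw [map_smul]; rfl

/-- The object `X_i`. -/
def obj (n : ℕ) (K : Type w) (i : ZMod n) : CatA n K := ⟨i⟩

/-- The morphism `u_{i,j} : X_i ⟶ X_j` for `j = i + 1`. -/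
noncomputable def u (K : Type w) [Field K] (i j : ZMod n) (h : j = i + 1 := by decide) :
    obj n K i ⟶ obj n K j :=
  Finsupp.single (⟨.xu j 0, by simp [Word.src, h], rfl⟩ : Mon i j) (1 : K)

/-- The morphism `v_{i,j} : X_i ⟶ X_j` for `i = j + 1`. -/
noncomputable def v (K : Type w) [Field K] (i j : ZMod n) (h : i = j + 1 := by decide) :
    obj n K i ⟶ obj n K j :=
  Finsupp.single (⟨.vx i 0, rfl, by simp [Word.tgt, h]⟩ : Mon i j) (1 : K)

/-- The constant coefficient of an element of `A(X, X)`: the coefficient of the identity. -/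
def constCoeff {X : CatA n K} (f : X ⟶ X) : K :=
  (show Mon X.idx X.idx →₀ K from f) ⟨.one X.idx, rfl, rfl⟩

/-- The part of `A(X_i, X_j)` that is spanned by the monomials of parity `e` and degree `d`. -/
def partA (K : Type w) [Field K] (P Q : ZMod n → ℚ) (i j : ZMod n) (e : ZMod 2) (d : ℚ) :
    Submodule K (Mon i j →₀ K) :=
  Finsupp.supported K K {w : Mon i j | w.1.par = e ∧ w.1.deg P Q = d}

theorem isInternal_partA (P Q : ZMod n → ℚ) (i j : ZMod n) :
    DirectSum.IsInternal (fun e : ZMod 2 × ℚ => partA K P Q i j e.1 e.2) := by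
  rw [DirectSum.isInternal_submodule_iff_iSupIndep_and_iSup_eq_top]
  constructor
  · intro e
    refine Disjoint.mono_right ?_ (Finsupp.disjoint_supported_supported
      (disjoint_compl_right (a := {w : Mon i j | w.1.par = e.1 ∧ w.1.deg P Q = e.2})))
    refine iSup₂_le fun e' he' => Finsupp.supported_mono ?_
    rintro w ⟨h₁', h₂'⟩ ⟨h₁, h₂⟩
    exact he' (Prod.ext (h₁'.symm.trans h₁) (h₂'.symm.trans h₂))
  · unfold partA
    rw [← Finsupp.supported_iUnion, ← Finsupp.supported_univ]
    congr 1
    ext w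
    simp only [Set.mem_iUnion, Set.mem_univ, iff_true]
    exact ⟨(w.1.par, w.1.deg P Q), rfl, rfl⟩

theorem compL_mem (P Q : ZMod n → ℚ) {i j l : ZMod n} {e e' : ZMod 2} {d d' : ℚ}
    {f : Mon i j →₀ K} {g : Mon j l →₀ K} (hf : f ∈ partA K P Q i j e d)
    (hg : g ∈ partA K P Q j l e' d') :
    compL K i j l f g ∈ partA K P Q i l (e + e') (d + d') := by
  rw [compL, Finsupp.linearCombination_apply, Finsupp.sum, LinearMap.sum_apply]
  refine Submodule.sum_mem _ fun w₁ h₁ => ?_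
  rw [LinearMap.smul_apply, Finsupp.linearCombination_apply, Finsupp.sum]
  refine Submodule.smul_mem _ _ (Submodule.sum_mem _ fun w₂ h₂ => Submodule.smul_mem _ _ ?_)
  obtain ⟨p₁, d₁⟩ := hf h₁
  obtain ⟨p₂, d₂⟩ := hg h₂
  have hc : w₁.1.tgt = w₂.1.src := w₁.2.2.trans w₂.2.1.symm
  cases ho : Word.mul w₂.1 w₁.1 with
  | none => exact Submodule.zero_mem _
  | some w =>
    simp only [mono]
    split_ifs with h
    · refine Finsupp.single_mem_supported K 1 ⟨?_, ?_⟩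
      · rw [← p₁, ← p₂]; exact Word.par_mul ho
      · rw [← d₁, ← d₂]; exact Word.deg_mul P Q hc ho
    · exact Submodule.zero_mem _

theorem frac_deg (D : ℕ) (p q : ZMod n → ℤ) (w : Word n) :
    ∃ z : ℤ, w.deg (fun i => (p i : ℚ) / D) (fun i => (q i : ℚ) / D) = z / D := by
  cases w with
  | one i => exact ⟨0, by simp [Word.deg]⟩
  | x i k => exact ⟨(k + 1) * (p i + q i), by simp only [Word.deg]; push_cast; ring⟩
  | y i k => exact ⟨(k + 1) * (p (i + 1) + q (i + 1)), by simp only [Word.deg]; push_cast; ring⟩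
  | xu i k => exact ⟨p i + k * (p i + q i), by simp only [Word.deg]; push_cast; ring⟩
  | vx i k => exact ⟨q i + k * (p i + q i), by simp only [Word.deg]; push_cast; ring⟩

/-- The `(1/D)ℤ`-graded category `A_{(p̃,q̃)}` with `p̃_i = p_i / D` and `q̃_i = q_i / D`: the
generators `u_{i-1,i}` and `v_{i,i-1}` are odd, of degrees `p̃_i` and `q̃_i`. -/
noncomputable def grading (K : Type w) [Field K] (D : ℕ) (p q : ZMod n → ℤ) :
    FracGrading D K (CatA n K) where
  part X Y e d := partA K (fun i => (p i : ℚ) / D) (fun i => (q i : ℚ) / D) X.idx Y.idx e d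
  isInternal X Y := isInternal_partA _ _ X.idx Y.idx
  frac X Y e d h := by
    obtain ⟨f, hf, h0⟩ := (Submodule.ne_bot_iff _).1 h
    obtain ⟨w, hw⟩ := Finsupp.support_nonempty_iff.2 h0
    obtain ⟨z, hz⟩ := frac_deg D p q w.1
    exact ⟨z, (hf hw).2.symm.trans hz⟩
  id_mem X := Finsupp.single_mem_supported K 1 ⟨rfl, rfl⟩
  comp_mem hf hg := compL_mem _ _ hf hg

/-- The coefficient `a = m_3(u_{3,1}, u_{2,3}, u_{1,2})(0)`. -/
noncomputable def coeffA {D : ℕ} {G : FracGrading D K (CatA 3 K)} (m : AInfStructure G) : K :=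
  constCoeff (m.op ((((Chain.nil (obj 3 K 1)).cons (u K 1 2)).cons (u K 2 3)).cons (u K 3 1)))

/-- The coefficient `b = m_3(v_{2,1}, v_{3,2}, v_{1,3})(0)`. -/
noncomputable def coeffB {D : ℕ} {G : FracGrading D K (CatA 3 K)} (m : AInfStructure G) : K :=
  constCoeff (m.op ((((Chain.nil (obj 3 K 1)).cons (v K 1 3)).cons (v K 3 2)).cons (v K 2 1)))

end CatA

/-! ## The bar construction on a basis -/

/-! The category is the path category of the triangle with arrows `u` and `v` in opposite
directions, modulo the relations `uu = 0 = vv`. A basis morphism is an identity or an alternating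
word in `u` and `v`. This is a quadratic monomial category, hence Koszul, and its Koszul dual is
spanned by the chains `u, u, …, u` and `v, v, …, v` of equal letters (`K`).

After a shift of degrees the operations `m_r` become the components of one odd coderivation `D` of
the tensor coalgebra on words. The `A_∞`-equations say `D² = 0`, and a strict homotopy is a
coalgebra map `F` with linear part the identity and `F D = D' F`. Coderivations and coalgebra maps
are determined by their components, so both equations can be solved length by length. The first
failing component is a Hochschild cocycle (`ainf_obstruction`, `functor_obstruction`), and changing
one component alters it by a Hochschild coboundary (`ainf_perturb`, `functor_perturb`).

It remains to know when a cocycle is a coboundary (`exists_hd_eq`). It can be made to vanish on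
lists with identities (`exists_normalized`). If a normalized cocycle vanishes on chains of equal
letters, it is a coboundary, by splitting off first letters as in the contraction of the bar complex
onto the Koszul complex (`koszul_step`, `exists_primitive`). Its values on chains can be removed by
stripping a last letter (`exists_strip`), apart from two kinds of coefficients: that of an identity
on a closed chain, and that of the first letter of the chain.

The grading almost excludes these. The degrees of three consecutive equal letters add up to `1`,
that is, to `-2` after the shift. So an identity occurs only on chains of length `3m`, for operators
of shifted degree `2m - 1`, and the first letter only on chains of length `3m + 1`, in degree `2m`
(`SumOne.rel_one`, `SumOne.rel_gen`).

The obstruction to a homotopy has degree `1`, so the only critical length is `3`. The critical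
coefficients there are the differences of the constants `a` and of the constants `b`, up to sign.
Conversely these differences vanish for homotopic structures, because the correction terms are
products with a generator and have no constant term (`defect_K_three`).

The obstruction to the `A_∞`-equation has degree `2`, so the only critical length is `4`. That
length is settled by an explicit cocycle `triple`, given up to sign by `(w u, u, u w') ↦ κ w w'` and
likewise for `v`, whose values on closed chains of length three are prescribed multiples of
identities. All later obstructions vanish, so every pair `(a, b)` occurs.

Thus two structures are homotopic if and only if they have the same `(a, b)`. That homotopy is an
equivalence relation is read off from this; homotopies are never composed or inverted. -/

namespace Bar

/-! ### Sums over deconcatenations of a list -/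

section Deconcatenation

variable {W : Type*}

/-- All ways to cut a list into an initial and a final part. -/
def splits : List W → List (List W × List W)
  | [] => [([], [])]
  | w :: l => ([], w :: l) :: (splits l).map fun p => (w :: p.1, p.2)

/-- Sum over the ways to cut a list into an initial and a final part. -/
def splitSum {M : Type*} [AddCommMonoid M] (l : List W) (β : List W → List W → M) : M :=
  ((splits l).map fun p => β p.1 p.2).sum

section

variable {M N : Type*} [AddCommMonoid M] [AddCommMonoid N]

@[simp] theorem splitSum_nil (β : List W → List W → M) : splitSum [] β = β [] [] := by
  simp [splitSum, splits]

@[simp] theorem splitSum_cons (w : W) (l : List W) (β : List W → List W → M) :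
    splitSum (w :: l) β = β [] (w :: l) + splitSum l fun x y => β (w :: x) y := by
  simp [splitSum, splits, List.map_map, Function.comp_def]

theorem splitSum_add (l : List W) (β γ : List W → List W → M) :
    splitSum l (fun x y => β x y + γ x y) = splitSum l β + splitSum l γ := by
  simp [splitSum]

theorem splitSum_congr {l : List W} {β γ : List W → List W → M}
    (h : ∀ x y, x ++ y = l → β x y = γ x y) : splitSum l β = splitSum l γ := by
  induction l generalizing β γ with
  | nil => simp [h [] [] rfl]
  | cons w l ih =>
    rw [splitSum_cons, splitSum_cons, h [] _ rfl, ih fun x y hxy => h _ _ (by simp [hxy])]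

theorem splitSum_zero (l : List W) : splitSum l (fun _ _ => (0 : M)) = 0 := by
  simp [splitSum]

theorem map_splitSum (f : M →+ N) (l : List W) (β : List W → List W → M) :
    f (splitSum l β) = splitSum l fun x y => f (β x y) := by
  induction l generalizing β with
  | nil => simp
  | cons w l ih => simp [ih]

/-- Coassociativity of deconcatenation: both sides run over the cuts into three parts. -/
theorem splitSum_assoc (l : List W) (γ : List W → List W → List W → M) :
    (splitSum l fun x y => splitSum y fun y₁ y₂ => γ x y₁ y₂)
      = splitSum l fun z y₂ => splitSum z fun x y₁ => γ x y₁ y₂ := by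
  induction l generalizing γ with
  | nil => simp
  | cons w l ih =>
    simp only [splitSum_cons, splitSum_nil, ih, splitSum_add, add_assoc]

theorem splitSum_mem {K : Type*} [Semiring K] [Module K M] (S : Submodule K M) {l : List W}
    {β : List W → List W → M} (h : ∀ x y, x ++ y = l → β x y ∈ S) : splitSum l β ∈ S := by
  induction l generalizing β with
  | nil => simpa using h [] [] rfl
  | cons w l ih =>
    rw [splitSum_cons]
    exact S.add_mem (h _ _ rfl) (ih fun x y hxy => h _ _ (by simp [hxy]))

theorem linearMap_splitSum {K : Type*} [Semiring K] [Module K M] [Module K N] (f : M →ₗ[K] N)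
    (l : List W) (β : List W → List W → M) :
    f (splitSum l β) = splitSum l fun x y => f (β x y) :=
  map_splitSum f.toAddMonoidHom l β

theorem smul_splitSum {K : Type*} [Monoid K] [DistribMulAction K M] (r : K) (l : List W)
    (β : List W → List W → M) : r • splitSum l β = splitSum l fun x y => r • β x y :=
  map_splitSum (DistribSMul.toAddMonoidHom M r) l β

end

end Deconcatenation

/-! ### The tensor coalgebra on a vector space with a basis -/

variable {k : Type*} [Field k] {W : Type*}

/-- The vector space on a basis. -/
abbrev V (k : Type*) [Field k] (W : Type*) := W →₀ k

/-- The tensor coalgebra on a vector space with a basis. -/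
abbrev T (k : Type*) [Field k] (W : Type*) := List W →₀ k

/-- A basis vector of the tensor coalgebra. -/
noncomputable def tensor (k : Type*) [Field k] (l : List W) : T k W := Finsupp.single l 1

/-- A basis vector. -/
noncomputable def vec (k : Type*) [Field k] (w : W) : V k W := Finsupp.single w 1

theorem T_ext {M : Type*} [AddCommGroup M] [Module k M] {f g : T k W →ₗ[k] M}
    (h : ∀ l, f (tensor k l) = g (tensor k l)) : f = g :=
  Finsupp.lhom_ext' fun l => LinearMap.ext_ring (h l)

theorem V_ext {M : Type*} [AddCommGroup M] [Module k M] {f g : V k W →ₗ[k] M}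
    (h : ∀ w, f (vec k w) = g (vec k w)) : f = g :=
  Finsupp.lhom_ext' fun w => LinearMap.ext_ring (h w)

/-- The linear map with prescribed values on basis vectors. -/
noncomputable def ofList {M : Type*} [AddCommGroup M] [Module k M] (f : List W → M) :
    T k W →ₗ[k] M := Finsupp.linearCombination k f

@[simp] theorem ofList_tensor {M : Type*} [AddCommGroup M] [Module k M] (f : List W → M)
    (l : List W) : ofList f (tensor k l) = f l := by
  simp [ofList, tensor]

/-- Tensor a vector from the left. -/
noncomputable def consL : V k W →ₗ[k] T k W →ₗ[k] T k W :=
  Finsupp.linearCombination k fun w => Finsupp.lmapDomain k k (List.cons w)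

@[simp] theorem consL_vec_tensor (w : W) (l : List W) :
    consL (vec k w) (tensor k l) = tensor k (w :: l) := by
  simp [consL, vec, tensor, Finsupp.lmapDomain_apply, Finsupp.mapDomain_single]

/-- The linear map induced by a bilinear map on the deconcatenation of a tensor. -/
noncomputable def conv {M : Type*} [AddCommGroup M] [Module k M] (B : T k W →ₗ[k] T k W →ₗ[k] M) :
    T k W →ₗ[k] M :=
  ofList fun l => splitSum l fun x y => B (tensor k x) (tensor k y)

section

variable {M : Type*} [AddCommGroup M] [Module k M]

theorem conv_tensor (B : T k W →ₗ[k] T k W →ₗ[k] M) (l : List W) :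
    conv B (tensor k l) = splitSum l fun x y => B (tensor k x) (tensor k y) := by
  simp [conv]

/-- A cut lies either before the first letter or after it. This recursion replaces computations with
the coproduct, so that the tensor square of `T k W` is never needed. -/
theorem conv_consL (B : T k W →ₗ[k] T k W →ₗ[k] M) (a : V k W) (t : T k W) :
    conv B (consL a t) = B (tensor k []) (consL a t) + conv (B ∘ₗ consL a) t := by
  revert t
  refine fun t => LinearMap.congr_fun (g := B (tensor k []) ∘ₗ consL a + conv (B ∘ₗ consL a))
    (f := conv B ∘ₗ consL a) (T_ext fun l => ?_) t
  induction a using Finsupp.induction_linear with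
  | zero => simp [conv_tensor, splitSum_zero]
  | add a b ha hb =>
    simp only [LinearMap.comp_apply, LinearMap.add_apply, map_add, conv_tensor, splitSum_add]
      at ha hb ⊢
    rw [ha, hb]
    abel
  | single w r =>
    have : (Finsupp.single w r : V k W) = r • vec k w := by simp [vec]
    simp only [this, LinearMap.comp_apply, LinearMap.add_apply, map_smul, LinearMap.smul_apply,
      conv_tensor, consL_vec_tensor, splitSum_cons, smul_add]
    congr 1
    exact smul_splitSum r l _

end

/-- The tensor is in the span of the lists which satisfy a condition. -/
abbrev supp (k : Type*) [Field k] {X : Type*} (S : X → Prop) : Submodule k (X →₀ k) :=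
  Finsupp.supported k k {x | S x}

theorem single_mem_supp {X : Type*} {S : X → Prop} {x : X} (h : S x) (r : k) :
    Finsupp.single x r ∈ supp k S :=
  Finsupp.single_mem_supported k r h

theorem tensor_mem {S : List W → Prop} {l : List W} (h : S l) : tensor k l ∈ supp k S :=
  single_mem_supp h 1

theorem vec_mem {S : W → Prop} {w : W} (h : S w) : vec k w ∈ supp k S :=
  single_mem_supp h 1

theorem map_mem_of_supp {X M : Type*} [AddCommGroup M] [Module k M] {S : X → Prop}
    (f : (X →₀ k) →ₗ[k] M) (U : Submodule k M) (h : ∀ x, S x → f (Finsupp.single x 1) ∈ U)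
    {t : X →₀ k} (ht : t ∈ supp k S) : f t ∈ U := by
  rw [← t.sum_single, Finsupp.sum, map_sum]
  refine U.sum_mem fun x hx => ?_
  have : (Finsupp.single x (t x) : X →₀ k) = t x • Finsupp.single x 1 := by simp
  rw [this, map_smul]
  exact U.smul_mem _ (h x (ht hx))

theorem map_eq_of_supp {X M : Type*} [AddCommGroup M] [Module k M] {S : X → Prop}
    (f g : (X →₀ k) →ₗ[k] M) (h : ∀ x, S x → f (Finsupp.single x 1) = g (Finsupp.single x 1))
    {t : X →₀ k} (ht : t ∈ supp k S) : f t = g t := by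
  have := map_mem_of_supp (f - g) ⊥ (fun x hx => by simp [h x hx]) ht
  simpa [sub_eq_zero] using this

theorem map_eq_zero_of_supp {X M : Type*} [AddCommGroup M] [Module k M] {S : X → Prop}
    (f : (X →₀ k) →ₗ[k] M) (h : ∀ x, S x → f (Finsupp.single x 1) = 0)
    {t : X →₀ k} (ht : t ∈ supp k S) : f t = 0 :=
  map_eq_of_supp f 0 h ht

theorem supp_mono {X : Type*} {S S' : X → Prop} (h : ∀ x, S x → S' x) : supp k S ≤ supp k S' :=
  Finsupp.supported_mono h

theorem consL_mem {S : W → Prop} {S' S'' : List W → Prop} {a : V k W} {t : T k W}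
    (ha : a ∈ supp k S) (ht : t ∈ supp k S') (h : ∀ w l, S w → S' l → S'' (w :: l)) :
    consL a t ∈ supp k S'' := by
  refine map_mem_of_supp (consL.flip t) _ (fun w hw => ?_) ha
  refine map_mem_of_supp (consL (vec k w)) _ (fun l hl => ?_) ht
  change consL (vec k w) (tensor k l) ∈ _
  rw [consL_vec_tensor]
  exact tensor_mem (h w l hw hl)

theorem mem_supp_true {X : Type*} (t : X →₀ k) : t ∈ supp k (fun _ : X => True) := by
  intro x _; trivial

/-- The projection to the tensors of length one. -/
noncomputable def pr : T k W →ₗ[k] V k W :=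
  ofList fun l => match l with
    | [w] => vec k w
    | _ => 0

@[simp] theorem pr_nil : pr (tensor k ([] : List W)) = 0 := by simp [pr]
@[simp] theorem pr_single (w : W) : pr (tensor k [w]) = vec k w := by simp [pr]
@[simp] theorem pr_cons_cons (w w' : W) (l : List W) : pr (tensor k (w :: w' :: l)) = 0 := by
  simp [pr]

theorem pr_of_length_ne {l : List W} (h : l.length ≠ 1) : pr (tensor k l) = 0 := by
  match l, h with
  | [], _ => simp
  | [_], h => simp at h
  | _ :: _ :: _, _ => simp

theorem pr_consL_nil (a : V k W) : pr (consL a (tensor k [])) = a :=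
  LinearMap.congr_fun (f := pr ∘ₗ consL.flip (tensor k [])) (g := LinearMap.id)
    (V_ext fun w => by simp) a

theorem pr_consL_of_supp (a : V k W) {t : T k W} (ht : t ∈ supp k (fun l : List W => l ≠ [])) :
    pr (consL a t) = 0 :=
  map_eq_zero_of_supp (pr ∘ₗ consL a) (fun l hl => by
    refine LinearMap.congr_fun (f := pr ∘ₗ consL.flip (tensor k l)) (g := 0)
      (V_ext fun w => ?_) a
    simp only [LinearMap.comp_apply, LinearMap.flip_apply, consL_vec_tensor]
    exact pr_of_length_ne (by simpa using hl)) ht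

/-! ### Twisted coderivations -/

/-- The diagonal operator with eigenvalues `τ`. -/
noncomputable def twV (τ : W → k) : V k W →ₗ[k] V k W :=
  Finsupp.linearCombination k fun w => τ w • vec k w

@[simp] theorem twV_vec (τ : W → k) (w : W) : twV τ (vec k w) = τ w • vec k w := by
  simp [twV, vec]

/-- The product of the values of `τ` over a list. -/
def twL (τ : W → k) (l : List W) : k := (l.map τ).prod

@[simp] theorem twL_nil (τ : W → k) : twL τ [] = 1 := by simp [twL]
@[simp] theorem twL_cons (τ : W → k) (w : W) (l : List W) :
    twL τ (w :: l) = τ w * twL τ l := by simp [twL]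
@[simp] theorem twL_append (τ : W → k) (l l' : List W) :
    twL τ (l ++ l') = twL τ l * twL τ l' := by simp [twL]

/-- The multiplicative extension of the diagonal operator with eigenvalues `τ`. -/
noncomputable def twT (τ : W → k) : T k W →ₗ[k] T k W := ofList fun l => twL τ l • tensor k l

@[simp] theorem twT_tensor (τ : W → k) (l : List W) :
    twT τ (tensor k l) = twL τ l • tensor k l := by simp [twT]

theorem twT_consL (τ : W → k) (a : V k W) (t : T k W) :
    twT τ (consL a t) = consL (twV τ a) (twT τ t) := by
  refine LinearMap.congr_fun (f := twT τ ∘ₗ consL a) (g := consL (twV τ a) ∘ₗ twT τ)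
    (T_ext fun l => ?_) t
  refine LinearMap.congr_fun (f := twT τ ∘ₗ consL.flip (tensor k l))
    (g := consL.flip (twT τ (tensor k l)) ∘ₗ twV τ) (V_ext fun w => ?_) a
  simp only [LinearMap.comp_apply, LinearMap.flip_apply, consL_vec_tensor, twT_tensor, twL_cons,
    twV_vec, map_smul, LinearMap.smul_apply, smul_smul]

/-- Apply `φ` to all nonempty initial parts of a list. -/
noncomputable def applyInit (φ : T k W →ₗ[k] V k W) : T k W →ₗ[k] T k W := conv (consL ∘ₗ φ)

theorem applyInit_tensor (φ : T k W →ₗ[k] V k W) (l : List W) :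
    applyInit φ (tensor k l) = splitSum l fun x y => consL (φ (tensor k x)) (tensor k y) := by
  simp [applyInit, conv_tensor]

/-- The values of the coderivation with components `φ` on basis vectors. -/
noncomputable def coderList (τ : W → k) (φ : T k W →ₗ[k] V k W) : List W → T k W
  | [] => 0
  | w :: l => τ w • consL (vec k w) (coderList τ φ l) + applyInit φ (tensor k (w :: l))

/-- The `τ`-twisted coderivation with components `φ`. -/
noncomputable def coder (τ : W → k) (φ : T k W →ₗ[k] V k W) : T k W →ₗ[k] T k W :=
  ofList (coderList τ φ)

@[simp] theorem coder_nil (τ : W → k) (φ : T k W →ₗ[k] V k W) :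
    coder τ φ (tensor k []) = 0 := by simp [coder, coderList]

theorem coder_cons (τ : W → k) (φ : T k W →ₗ[k] V k W) (w : W) (l : List W) :
    coder τ φ (tensor k (w :: l)) = τ w • consL (vec k w) (coder τ φ (tensor k l))
      + applyInit φ (tensor k (w :: l)) := by
  simp [coder, coderList]

theorem coder_consL (τ : W → k) (φ : T k W →ₗ[k] V k W) (a : V k W) (t : T k W) :
    coder τ φ (consL a t) = consL (twV τ a) (coder τ φ t) + applyInit φ (consL a t) := by
  refine LinearMap.congr_fun (f := coder τ φ ∘ₗ consL a)
    (g := consL (twV τ a) ∘ₗ coder τ φ + applyInit φ ∘ₗ consL a) (T_ext fun l => ?_) t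
  refine LinearMap.congr_fun (f := coder τ φ ∘ₗ consL.flip (tensor k l))
    (g := consL.flip (coder τ φ (tensor k l)) ∘ₗ twV τ + applyInit φ ∘ₗ consL.flip (tensor k l))
    (V_ext fun w => ?_) a
  simp [coder_cons]

theorem applyInit_add (φ ψ : T k W →ₗ[k] V k W) :
    applyInit (φ + ψ) = applyInit φ + applyInit ψ :=
  T_ext fun l => by simp [applyInit_tensor, splitSum_add]

theorem applyInit_smul (r : k) (φ : T k W →ₗ[k] V k W) :
    applyInit (r • φ) = r • applyInit φ :=
  T_ext fun l => by
    simp only [applyInit_tensor, LinearMap.smul_apply, map_smul]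
    exact (smul_splitSum r l _).symm

theorem applyInit_sub (φ ψ : T k W →ₗ[k] V k W) :
    applyInit (φ - ψ) = applyInit φ - applyInit ψ := by
  have h : applyInit (φ - ψ + ψ) = applyInit (φ - ψ) + applyInit ψ := applyInit_add _ _
  have h' : φ - ψ + ψ = φ := by ext; simp
  rw [h'] at h
  rw [h]
  ext
  simp

theorem coder_add (τ : W → k) (φ ψ : T k W →ₗ[k] V k W) :
    coder τ (φ + ψ) = coder τ φ + coder τ ψ :=
  T_ext fun l => by
    induction l with
    | nil => simp
    | cons w l ih =>
      rw [LinearMap.add_apply] at ih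
      simp only [coder_cons, ih, LinearMap.add_apply, applyInit_add, map_add, smul_add]
      abel

theorem coder_smul (τ : W → k) (r : k) (φ : T k W →ₗ[k] V k W) :
    coder τ (r • φ) = r • coder τ φ :=
  T_ext fun l => by
    induction l with
    | nil => simp
    | cons w l ih =>
      rw [LinearMap.smul_apply] at ih
      simp only [coder_cons, ih, LinearMap.smul_apply, applyInit_smul, map_smul, smul_add]
      rw [smul_comm]

theorem coder_sub (τ : W → k) (φ ψ : T k W →ₗ[k] V k W) :
    coder τ (φ - ψ) = coder τ φ - coder τ ψ := by
  have h : coder τ (φ - ψ + ψ) = coder τ (φ - ψ) + coder τ ψ := coder_add _ _ _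
  have h' : φ - ψ + ψ = φ := by ext; simp
  rw [h'] at h
  rw [h]
  ext
  simp

section

variable {M : Type*} [AddCommGroup M] [Module k M]

/-- The result of `φ` on an initial block is a single letter, so a cut of the output falls either in
front of everything or behind that letter. In the second case it is a cut of the original list, by
`splitSum_assoc`. -/
theorem conv_applyInit (φ : T k W →ₗ[k] V k W) (hφ : φ (tensor k []) = 0)
    (B : T k W →ₗ[k] T k W →ₗ[k] M) (w : W) (l : List W) :
    conv B (applyInit φ (tensor k (w :: l)))
      = B (tensor k []) (applyInit φ (tensor k (w :: l)))
        + splitSum l fun x y => B (applyInit φ (tensor k (w :: x))) (tensor k y) := by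
  have key : ∀ l' : List W, conv B (applyInit φ (tensor k l'))
      = B (tensor k []) (applyInit φ (tensor k l'))
        + splitSum l' fun x y => B (applyInit φ (tensor k x)) (tensor k y) := by
    intro l'
    simp only [applyInit_tensor]
    rw [linearMap_splitSum, linearMap_splitSum]
    simp only [conv_consL, splitSum_add, conv_tensor,
      LinearMap.comp_apply]
    rw [splitSum_assoc]
    congr 1
    refine splitSum_congr fun z y _ => ?_
    have := linearMap_splitSum (B.flip (tensor k y)) z
      fun x y₁ => consL (φ (tensor k x)) (tensor k y₁)
    simpa using this.symm
  rw [key, splitSum_cons]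
  simp [applyInit_tensor, hφ]

/-- The coderivation identity `Δ D = (D ⊗ 1 + τ ⊗ D) Δ`, tested against an arbitrary bilinear map.
-/
theorem conv_coder (τ : W → k) (φ : T k W →ₗ[k] V k W) (hφ : φ (tensor k []) = 0)
    (B : T k W →ₗ[k] T k W →ₗ[k] M) (t : T k W) :
    conv B (coder τ φ t)
      = conv (B ∘ₗ coder τ φ) t + conv (B.compl₁₂ (twT τ) (coder τ φ)) t := by
  refine LinearMap.congr_fun (f := conv B ∘ₗ coder τ φ)
    (g := conv (B ∘ₗ coder τ φ) + conv (B.compl₁₂ (twT τ) (coder τ φ))) (T_ext fun l => ?_) t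
  simp only [LinearMap.comp_apply, LinearMap.add_apply]
  induction l generalizing B with
  | nil => simp [conv_tensor]
  | cons w l ih =>
    rw [coder_cons, map_add, map_smul, conv_consL, ih, conv_applyInit φ hφ]
    simp only [conv_tensor, splitSum_cons, LinearMap.comp_apply, LinearMap.compl₁₂_apply, coder_nil,
      map_zero, LinearMap.zero_apply, zero_add, twT_tensor, twL_nil, one_smul, coder_cons, map_add,
      map_smul, LinearMap.add_apply, LinearMap.smul_apply, splitSum_add, twL_cons, mul_smul,
      smul_add, consL_vec_tensor]
    simp only [smul_splitSum]
    abel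

end

/-- The key computation for the composition of two coderivations. -/
theorem coder_coder_cons (τ₁ τ₂ : W → k) (φ₁ φ₂ : T k W →ₗ[k] V k W)
    (h₂ : φ₂ (tensor k []) = 0) (χ : k)
    (hχ : twV τ₁ ∘ₗ φ₂ = χ • φ₂ ∘ₗ twT τ₁) (w : W) (l : List W) :
    coder τ₁ φ₁ (coder τ₂ φ₂ (tensor k (w :: l)))
      = (τ₁ w * τ₂ w) • consL (vec k w) (coder τ₁ φ₁ (coder τ₂ φ₂ (tensor k l)))
        + applyInit (φ₁ ∘ₗ coder τ₂ φ₂) (tensor k (w :: l))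
        + conv ((consL ∘ₗ φ₁).compl₁₂ (twT τ₂) (coder τ₂ φ₂)) (tensor k (w :: l))
        + χ • conv ((consL ∘ₗ φ₂).compl₁₂ (twT τ₁) (coder τ₁ φ₁)) (tensor k (w :: l)) := by
  have e₁ : coder τ₁ φ₁ (applyInit φ₂ (tensor k (w :: l)))
      = χ • conv ((consL ∘ₗ φ₂).compl₁₂ (twT τ₁) (coder τ₁ φ₁)) (tensor k (w :: l))
        + applyInit φ₁ (applyInit φ₂ (tensor k (w :: l))) := by
    rw [applyInit_tensor φ₂, linearMap_splitSum, linearMap_splitSum]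
    simp only [coder_consL, splitSum_add, conv_tensor, smul_splitSum]
    congr 1
    refine splitSum_congr fun x y _ => ?_
    rw [← LinearMap.comp_apply (twV τ₁), hχ]
    simp
  have e₂ : applyInit φ₁ (coder τ₂ φ₂ (tensor k (w :: l)))
      = applyInit (φ₁ ∘ₗ coder τ₂ φ₂) (tensor k (w :: l))
        + conv ((consL ∘ₗ φ₁).compl₁₂ (twT τ₂) (coder τ₂ φ₂)) (tensor k (w :: l)) := by
    rw [applyInit, conv_coder τ₂ φ₂ h₂]
    rfl
  have e₃ := e₂
  rw [coder_cons, map_add, map_smul] at e₃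
  rw [coder_cons, map_add, map_smul, coder_consL, e₁, twV_vec, smul_add, map_smul,
    LinearMap.smul_apply, smul_smul, mul_comm (τ₁ w)]
  rw [add_assoc, add_left_comm (τ₂ w • _), e₃]
  abel

/-- For an odd coderivation the terms of the square with two disjoint blocks occur in both orders
with opposite signs. What survives has one block inside the other, and this is again a coderivation;
its twist is `τ² = 1`. -/
theorem coder_comp_self (τ : W → k) (hτ : ∀ w, τ w * τ w = 1) (φ : T k W →ₗ[k] V k W)
    (h : φ (tensor k []) = 0) (hχ : twV τ ∘ₗ φ = (-1 : k) • φ ∘ₗ twT τ) :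
    coder τ φ ∘ₗ coder τ φ = coder (fun _ => 1) (φ ∘ₗ coder τ φ) :=
  T_ext fun l => by
    induction l with
    | nil => simp
    | cons w l ih =>
      rw [LinearMap.comp_apply] at ih
      rw [LinearMap.comp_apply, coder_coder_cons τ τ φ φ h (-1) hχ, ih, coder_cons, hτ]
      simp

/-- The terms with disjoint blocks cancel between the two compositions, and the nested ones form the
components of the commutator. With `coder_comp_self` this yields that the Hochschild differential
squares to zero. -/
theorem coder_commutator (τ₁ τ₂ : W → k) (φ₁ φ₂ : T k W →ₗ[k] V k W)
    (h₁ : φ₁ (tensor k []) = 0) (h₂ : φ₂ (tensor k []) = 0) (χ : k) (hχχ : χ * χ = 1)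
    (hχ : twV τ₁ ∘ₗ φ₂ = χ • φ₂ ∘ₗ twT τ₁) (hχ' : twV τ₂ ∘ₗ φ₁ = χ • φ₁ ∘ₗ twT τ₂) :
    coder τ₁ φ₁ ∘ₗ coder τ₂ φ₂ - χ • coder τ₂ φ₂ ∘ₗ coder τ₁ φ₁
      = coder (fun w => τ₁ w * τ₂ w) (φ₁ ∘ₗ coder τ₂ φ₂ - χ • φ₂ ∘ₗ coder τ₁ φ₁) :=
  T_ext fun l => by
    induction l with
    | nil => simp
    | cons w l ih =>
      simp only [LinearMap.sub_apply, LinearMap.comp_apply, LinearMap.smul_apply] at ih ⊢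
      rw [coder_coder_cons τ₁ τ₂ φ₁ φ₂ h₂ χ hχ, coder_coder_cons τ₂ τ₁ φ₂ φ₁ h₁ χ hχ',
        coder_cons, ← ih, applyInit_sub, applyInit_smul]
      simp only [map_sub, map_smul, smul_sub, smul_add, LinearMap.sub_apply, LinearMap.smul_apply,
        smul_smul, hχχ, one_smul, mul_comm (τ₂ w), mul_comm _ χ]
      module

theorem applyInit_mem (φ : T k W →ₗ[k] V k W) (S : List W → Prop) (l : List W)
    (h : ∀ x y, x ++ y = l → consL (φ (tensor k x)) (tensor k y) ∈ supp k S) :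
    applyInit φ (tensor k l) ∈ supp k S := by
  rw [applyInit_tensor]
  exact splitSum_mem _ h

/-- A coderivation whose components vanish outside certain lengths. -/
theorem coder_length (τ : W → k) (φ : T k W →ₗ[k] V k W) (S : ℕ → Prop)
    (hφ : ∀ l, ¬ S l.length → φ (tensor k l) = 0) (l : List W) :
    coder τ φ (tensor k l) ∈ supp k fun l' : List W =>
      l' ≠ [] ∧ ∃ s, S s ∧ s ≤ l.length ∧ l'.length + s = l.length + 1 := by
  induction l with
  | nil => simp
  | cons w l ih =>
    rw [coder_cons]
    refine Submodule.add_mem _ (Submodule.smul_mem _ _ (consL_mem (mem_supp_true _) ih ?_)) ?_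
    · rintro w' l' - ⟨-, s, hs, h₁, h₂⟩
      exact ⟨by simp, s, hs, by simp; omega, by simp; omega⟩
    · refine applyInit_mem _ _ _ fun x y hxy => ?_
      by_cases hs : S x.length
      · refine consL_mem (S' := fun l => l = y) (mem_supp_true _) (tensor_mem rfl) ?_
        rintro w' _ - rfl
        have := congrArg List.length hxy
        simp only [List.length_append, List.length_cons] at this
        exact ⟨by simp, x.length, hs, by simp; omega, by simp; omega⟩
      · simp [hφ x hs]

/-- Every term of a coderivation in which some letter is left untouched has length at least two, so
only the full block survives the projection. -/
theorem pr_coder (τ : W → k) (φ : T k W →ₗ[k] V k W) (h : φ (tensor k []) = 0) :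
    pr ∘ₗ coder τ φ = φ :=
  T_ext fun l => by
    have key : ∀ l, pr (applyInit φ (tensor k l)) = φ (tensor k l) := by
      intro l
      suffices H : ∀ g : List W → V k W,
          pr (splitSum l fun x y => consL (g x) (tensor k y)) = g l by
        rw [applyInit_tensor, H (fun x => φ (tensor k x))]
      induction l with
      | nil => intro g; simp [pr_consL_nil]
      | cons w l ih =>
        intro g
        rw [splitSum_cons, map_add, pr_consL_of_supp _ (tensor_mem (by simp)), zero_add]
        exact ih fun x => g (w :: x)
    cases l with
    | nil => simp [h]
    | cons w l =>
      rw [LinearMap.comp_apply, coder_cons, map_add, map_smul, pr_consL_of_supp, smul_zero,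
        zero_add, key]
      refine supp_mono (fun _ h => h.1)
        (coder_length τ φ (fun s => s ≠ 0) (fun l hl => ?_) l)
      simp only [ne_eq, not_not, List.length_eq_zero_iff] at hl
      rw [hl, h]

end Bar

namespace Bar

variable {k : Type*} [Field k] {W : Type*}

/-! ### Coalgebra maps -/

/-- Auxiliary recursion for `cohom`; the component which applies to the first block is `g`. -/
noncomputable def cohomAux (f : T k W →ₗ[k] V k W) : (List W → V k W) → List W → T k W
  | g, [] => consL (g []) (tensor k [])
  | g, w :: l => consL (g []) (cohomAux f (fun x => f (tensor k (w :: x))) l)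
      + cohomAux f (fun x => g (w :: x)) l

/-- The values of the coalgebra map with components `f` on basis vectors. -/
noncomputable def cohomList (f : T k W →ₗ[k] V k W) : List W → T k W
  | [] => tensor k []
  | w :: l => cohomAux f (fun x => f (tensor k (w :: x))) l

/-- The coalgebra map with components `f`. -/
noncomputable def cohom (f : T k W →ₗ[k] V k W) : T k W →ₗ[k] T k W := ofList (cohomList f)

@[simp] theorem cohom_nil (f : T k W →ₗ[k] V k W) : cohom f (tensor k []) = tensor k [] := by
  simp [cohom, cohomList]

/-- The auxiliary recursion lets the first block grow letter by letter, which makes it structural.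
Unwound, it is the sum over all choices of the first block. -/
theorem cohomAux_eq (f : T k W →ₗ[k] V k W) (g : List W → V k W) (l : List W) :
    cohomAux f g l = splitSum l fun x y => consL (g x) (cohom f (tensor k y)) := by
  induction l generalizing g with
  | nil => simp [cohomAux]
  | cons w l ih =>
    rw [cohomAux, ih (fun x => g (w :: x)), splitSum_cons]
    simp [cohom, cohomList]

theorem cohom_cons (f : T k W →ₗ[k] V k W) (w : W) (l : List W) :
    cohom f (tensor k (w :: l))
      = splitSum l fun x y => consL (f (tensor k (w :: x))) (cohom f (tensor k y)) := by
  rw [cohom, ofList_tensor, cohomList, cohomAux_eq]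
  rfl

theorem cohom_of_ne_nil (f : T k W →ₗ[k] V k W) (hf : f (tensor k []) = 0) {l : List W}
    (hl : l ≠ []) :
    cohom f (tensor k l) = splitSum l fun x y => consL (f (tensor k x)) (cohom f (tensor k y)) := by
  cases l with
  | nil => exact absurd rfl hl
  | cons w l => rw [cohom_cons, splitSum_cons, hf]; simp

theorem length_induction {P : List W → Prop} (l : List W)
    (h : ∀ l, (∀ l', l'.length < l.length → P l') → P l) : P l := by
  induction hn : l.length using Nat.strong_induction_on generalizing l with
  | _ n ih => exact h l fun l' hl' => ih _ (hn ▸ hl') l' rfl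

theorem length_lt_of_append {x y l : List W} (h : x ++ y = l) (hx : x ≠ []) :
    y.length < l.length := by
  have := List.length_pos_iff.2 hx
  rw [← h, List.length_append]
  omega

/-- The identity `Δ F = (F ⊗ F) Δ` of a coalgebra map. A cut of the output lies between two blocks,
so it comes from a cut of the input. -/
theorem conv_cohom {M : Type*} [AddCommGroup M] [Module k M] (f : T k W →ₗ[k] V k W)
    (hf : f (tensor k []) = 0) (B : T k W →ₗ[k] T k W →ₗ[k] M) (t : T k W) :
    conv B (cohom f t) = conv (B.compl₁₂ (cohom f) (cohom f)) t := by
  refine LinearMap.congr_fun (f := conv B ∘ₗ cohom f)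
    (g := conv (B.compl₁₂ (cohom f) (cohom f))) (T_ext fun l => ?_) t
  rw [LinearMap.comp_apply]
  induction l using length_induction generalizing B with
  | h l ih =>
  cases l with
  | nil => simp [conv_tensor]
  | cons w l =>
    rw [cohom_of_ne_nil f hf (by simp), linearMap_splitSum]
    have h₁ : splitSum (w :: l) (fun x y => conv B (consL (f (tensor k x)) (cohom f (tensor k y))))
        = splitSum (w :: l) (fun x y => B (tensor k []) (consL (f (tensor k x))
            (cohom f (tensor k y))))
          + splitSum (w :: l) (fun x y => splitSum y fun y₁ y₂ =>
            B (consL (f (tensor k x)) (cohom f (tensor k y₁))) (cohom f (tensor k y₂))) := by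
      rw [← splitSum_add]
      refine splitSum_congr fun x y hxy => ?_
      rw [conv_consL]
      congr 1
      by_cases hx : x = []
      · subst hx
        have : conv (0 : T k W →ₗ[k] T k W →ₗ[k] M) = 0 :=
          T_ext fun l => by simp [conv_tensor, splitSum_zero]
        simp [hf, splitSum_zero, this]
      · rw [ih y (length_lt_of_append hxy hx), conv_tensor]
        rfl
    rw [h₁, splitSum_assoc, ← linearMap_splitSum, ← cohom_of_ne_nil f hf (by simp), conv_tensor,
      splitSum_cons, splitSum_cons]
    simp only [splitSum_nil, hf, map_zero, LinearMap.zero_apply, zero_add, LinearMap.compl₁₂_apply,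
      cohom_nil]
    congr 1
    refine splitSum_congr fun x y _ => ?_
    rw [cohom_of_ne_nil f hf (l := w :: x) (by simp)]
    exact (linearMap_splitSum (B.flip (cohom f (tensor k y))) _ _).symm

theorem cohom_twT (σ : W → k) (f : T k W →ₗ[k] V k W) (hf : f (tensor k []) = 0)
    (h : twV σ ∘ₗ f = f ∘ₗ twT σ) : twT σ ∘ₗ cohom f = cohom f ∘ₗ twT σ :=
  T_ext fun l => by
    simp only [LinearMap.comp_apply, twT_tensor, map_smul]
    induction l using length_induction with
    | h l ih =>
    by_cases hl : l = []
    · subst hl; simp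
    rw [cohom_of_ne_nil f hf hl, linearMap_splitSum, smul_splitSum]
    refine splitSum_congr fun x y hxy => ?_
    by_cases hx : x = []
    · subst hx; simp [hf]
    have hh : twV σ (f (tensor k x)) = twL σ x • f (tensor k x) := by
      rw [← LinearMap.comp_apply, h]; simp
    rw [twT_consL, ih y (length_lt_of_append hxy hx), hh, ← hxy]
    simp [smul_smul, mul_comm]

/-- Any relation between input and output that is compatible with concatenation needs to be checked
on single blocks only. It is used for lengths and for degrees. -/
theorem cohom_mem (f : T k W →ₗ[k] V k W) (hf : f (tensor k []) = 0)
    (r : List W → List W → Prop) (h0 : r [] [])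
    (hr : ∀ x v y y', f (tensor k x) ≠ 0 → r x [v] → r y y' → r (x ++ y) (v :: y'))
    (h : ∀ l, f (tensor k l) ∈ supp k fun w => r l [w]) (l : List W) :
    cohom f (tensor k l) ∈ supp k (r l) := by
  induction l using length_induction with
  | h l ih =>
  by_cases hl : l = []
  · subst hl; rw [cohom_nil]; exact tensor_mem h0
  rw [cohom_of_ne_nil f hf hl]
  refine splitSum_mem _ fun x y hxy => ?_
  by_cases hx : x = []
  · subst hx; simp [hf]
  by_cases h0 : f (tensor k x) = 0
  · simp [h0]
  rw [← hxy]
  exact consL_mem (h x) (ih y (length_lt_of_append hxy hx)) fun v l' h₁ h₂ => hr x v y l' h0 h₁ h₂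

theorem cohom_length (f : T k W →ₗ[k] V k W) (hf : f (tensor k []) = 0) (l : List W) :
    cohom f (tensor k l)
      ∈ supp k fun l' : List W => (l' = [] ↔ l = []) ∧ l'.length ≤ l.length := by
  refine cohom_mem f hf (fun l l' => (l' = [] ↔ l = []) ∧ l'.length ≤ l.length) (by simp) ?_ ?_ l
  · intro x v y y' hx h₁ h₂
    have : x ≠ [] := fun h => hx (h ▸ hf)
    have h3 := List.length_pos_iff.2 this
    refine ⟨by simp [this], ?_⟩
    simp only [List.length_cons, List.length_append]
    have := h₂.2
    omega
  · intro l
    by_cases hl : l = []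
    · subst hl; simp [hf]
    · have := List.length_pos_iff.2 hl
      refine supp_mono (fun _ _ => ?_) (mem_supp_true _)
      simp only [List.length_singleton]
      exact ⟨by simp [hl], this⟩

/-- A nonempty tensor is rebuilt from its first letter and the rest. This lets coproduct identities,
such as `conv_bigDefect`, be turned into recursions. -/
theorem conv_consL_pr {t : T k W} (ht : t ∈ supp k fun l : List W => l ≠ []) :
    conv (consL ∘ₗ pr) t = t := by
  refine map_eq_of_supp _ LinearMap.id (fun l hl => ?_) ht
  change conv _ (tensor k l) = tensor k l
  rw [conv_tensor]
  cases l with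
  | nil => exact absurd rfl hl
  | cons w l =>
    rw [splitSum_cons]
    cases l with
    | nil => simp
    | cons w' l =>
      rw [splitSum_cons]
      simp [splitSum_zero]

theorem pr_cohom (f : T k W →ₗ[k] V k W) (hf : f (tensor k []) = 0) : pr ∘ₗ cohom f = f :=
  T_ext fun l => by
    rw [LinearMap.comp_apply]
    by_cases hl : l = []
    · subst hl; simp [hf]
    rw [cohom_of_ne_nil f hf hl, linearMap_splitSum]
    have key : ∀ (g : List W → V k W) (l : List W),
        splitSum l (fun x y => pr (consL (g x) (cohom f (tensor k y)))) = g l := by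
      intro g l
      induction l generalizing g with
      | nil => simp [pr_consL_nil]
      | cons w l ih =>
        rw [splitSum_cons, ih fun x => g (w :: x), pr_consL_of_supp, zero_add]
        exact supp_mono (fun l h => fun h' => by simpa using h.1.1 h') (cohom_length f hf (w :: l))
    exact key (fun x => f (tensor k x)) l

/-! ### Binary operations and the Hochschild differential -/

/-- The operator is concentrated on tensors of a given length. -/
def Arity (n : ℕ) (φ : T k W →ₗ[k] V k W) : Prop :=
  ∀ l : List W, l.length ≠ n → φ (tensor k l) = 0

/-- The operator vanishes on short tensors. -/
def Kills (n : ℕ) (φ : T k W →ₗ[k] V k W) : Prop :=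
  ∀ l : List W, l.length ≤ n → φ (tensor k l) = 0

/-- The component on tensors of a given length. -/
noncomputable def trunc (n : ℕ) (φ : T k W →ₗ[k] V k W) : T k W →ₗ[k] V k W :=
  ofList fun l => if l.length = n then φ (tensor k l) else 0

theorem trunc_of_eq {n : ℕ} (φ : T k W →ₗ[k] V k W) {l : List W} (h : l.length = n) :
    trunc n φ (tensor k l) = φ (tensor k l) := by simp [trunc, h]

theorem trunc_of_ne {n : ℕ} (φ : T k W →ₗ[k] V k W) {l : List W} (h : l.length ≠ n) :
    trunc n φ (tensor k l) = 0 := by simp [trunc, h]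

theorem arity_trunc (n : ℕ) (φ : T k W →ₗ[k] V k W) : Arity n (trunc n φ) :=
  fun _ h => trunc_of_ne φ h

theorem Arity.nil {n : ℕ} {φ : T k W →ₗ[k] V k W} (h : Arity (n + 1) φ) : φ (tensor k []) = 0 :=
  h [] (by simp)

theorem Kills.nil {n : ℕ} {φ : T k W →ₗ[k] V k W} (h : Kills n φ) : φ (tensor k []) = 0 :=
  h [] (by simp)

theorem Arity.kills {m n : ℕ} {φ : T k W →ₗ[k] V k W} (h : Arity n φ) (hm : m < n) : Kills m φ :=
  fun l hl => h l (by omega)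

theorem Arity.coder_mem {n : ℕ} {φ : T k W →ₗ[k] V k W} (h : Arity n φ) (τ : W → k) (l : List W) :
    coder τ φ (tensor k l) ∈ supp k fun l' : List W => l'.length + n = l.length + 1 :=
  supp_mono (fun _ ⟨_, _, hs, _, h'⟩ => hs ▸ h')
    (coder_length τ φ (fun s => s = n) h l)

theorem Kills.coder_mem {n : ℕ} {φ : T k W →ₗ[k] V k W} (h : Kills n φ) (τ : W → k) (l : List W) :
    coder τ φ (tensor k l) ∈ supp k fun l' : List W => l'.length + n ≤ l.length :=
  supp_mono (fun _ ⟨_, _, hs, _, h'⟩ => by omega)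
    (coder_length τ φ (fun s => n < s) (fun l hl => h l (by omega)) l)

theorem map_eq_of_mem {S : List W → Prop} (φ ψ : T k W →ₗ[k] V k W)
    (h : ∀ l, S l → φ (tensor k l) = ψ (tensor k l)) {t : T k W} (ht : t ∈ supp k S) :
    φ t = ψ t :=
  map_eq_of_supp φ ψ h ht

theorem map_eq_zero_of_mem {S : List W → Prop} (φ : T k W →ₗ[k] V k W)
    (h : ∀ l, S l → φ (tensor k l) = 0) {t : T k W} (ht : t ∈ supp k S) : φ t = 0 :=
  map_eq_zero_of_supp φ h ht

/-- The bilinear map of a binary operation. -/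
noncomputable def bin (μ : T k W →ₗ[k] V k W) : V k W →ₗ[k] V k W →ₗ[k] V k W :=
  (LinearMap.compr₂ consL μ).compl₂ (consL.flip (tensor k []))

theorem bin_vec (μ : T k W →ₗ[k] V k W) (w w' : W) :
    bin μ (vec k w) (vec k w') = μ (tensor k [w, w']) := by
  simp [bin]

theorem conv_bin {μ : T k W →ₗ[k] V k W} (hμ : Arity 2 μ) :
    conv ((bin μ).compl₁₂ pr pr) = μ :=
  T_ext fun l => by
    rw [conv_tensor]
    match l with
    | [] => simp [hμ []]
    | [w] => simp [hμ [w]]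
    | [w, w'] => simp [bin_vec]
    | w :: w' :: w'' :: l =>
      rw [hμ _ (by simp)]
      simp [splitSum_zero]

/-- By `conv_bin`, a binary operation sees a tensor only through its cuts into two single letters,
so the coderivation identity `conv_coder` applies. -/
theorem mu_coder {μ : T k W →ₗ[k] V k W} (hμ : Arity 2 μ) (τ : W → k) (g : T k W →ₗ[k] V k W)
    (hg : g (tensor k []) = 0) (l : List W) :
    μ (coder τ g (tensor k l)) = splitSum l fun x y =>
      bin μ (g (tensor k x)) (pr (tensor k y)) + twL τ x • bin μ (pr (tensor k x)) (g (tensor k y)) := by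
  conv_lhs => rw [← conv_bin hμ]
  rw [conv_coder τ g hg, conv_tensor, conv_tensor, ← splitSum_add]
  refine splitSum_congr fun x y _ => ?_
  have h := LinearMap.congr_fun (pr_coder τ g hg)
  simp only [LinearMap.comp_apply] at h
  simp [h]

theorem splitSum_pr_right {M : Type*} [AddCommGroup M] [Module k M] (β : List W → V k W →ₗ[k] M)
    (x : List W) (w : W) :
    splitSum (x ++ [w]) (fun x y => β x (pr (tensor k y))) = β x (vec k w) := by
  induction x generalizing β with
  | nil => simp
  | cons v x ih =>
    rw [List.cons_append, splitSum_cons, ih fun x => β (v :: x), pr_of_length_ne (by simp)]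
    simp

/-- The outer faces of the Hochschild differential. -/
theorem mu_coder_concat {μ : T k W →ₗ[k] V k W} (hμ : Arity 2 μ) (τ : W → k)
    (g : T k W →ₗ[k] V k W) (hg : g (tensor k []) = 0) {w z : W} {x y : List W}
    (h : w :: y = x ++ [z]) :
    μ (coder τ g (tensor k (w :: y))) =
      bin μ (g (tensor k x)) (vec k z) + τ w • bin μ (vec k w) (g (tensor k y)) := by
  rw [mu_coder hμ τ g hg, splitSum_add]
  congr 1
  · rw [h]
    exact splitSum_pr_right (fun x => bin μ (g (tensor k x))) x z
  · rw [splitSum_cons]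
    simp only [pr_nil, map_zero, LinearMap.zero_apply, smul_zero, zero_add]
    cases y with
    | nil => simp
    | cons w' y => simp [splitSum_zero]

/-- The Hochschild differential with the sign `s` and the twist `τ`. -/
noncomputable def hoch (σ : W → k) (μ : T k W →ₗ[k] V k W) (s : k) (τ : W → k)
    (g : T k W →ₗ[k] V k W) : T k W →ₗ[k] V k W :=
  g ∘ₗ coder σ μ - s • μ ∘ₗ coder τ g

theorem hoch_apply (σ : W → k) (μ : T k W →ₗ[k] V k W) (s : k) (τ : W → k)
    (g : T k W →ₗ[k] V k W) (t : T k W) :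
    hoch σ μ s τ g t = g (coder σ μ t) - s • μ (coder τ g t) := rfl

theorem hoch_sub (σ : W → k) (μ : T k W →ₗ[k] V k W) (s : k) (τ : W → k)
    (g h : T k W →ₗ[k] V k W) : hoch σ μ s τ (g - h) = hoch σ μ s τ g - hoch σ μ s τ h := by
  refine LinearMap.ext fun t => ?_
  simp only [hoch_apply, coder_sub, LinearMap.sub_apply, map_sub, smul_sub]
  abel

theorem hoch_add (σ : W → k) (μ : T k W →ₗ[k] V k W) (s : k) (τ : W → k)
    (g h : T k W →ₗ[k] V k W) : hoch σ μ s τ (g + h) = hoch σ μ s τ g + hoch σ μ s τ h := by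
  refine LinearMap.ext fun t => ?_
  simp only [hoch_apply, coder_add, LinearMap.add_apply, map_add, smul_add]
  abel

theorem hoch_neg (σ : W → k) (μ : T k W →ₗ[k] V k W) (s : k) (τ : W → k)
    (g : T k W →ₗ[k] V k W) : hoch σ μ s τ (-g) = - hoch σ μ s τ g := by
  refine LinearMap.ext fun t => ?_
  have h : coder τ (-g) = - coder τ g := by
    have h₁ := coder_smul τ (-1) g
    have h₂ : (-1 : k) • g = -g := by ext; simp
    have h₃ : (-1 : k) • coder τ g = - coder τ g := by ext; simp
    rwa [h₂, h₃] at h₁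
  simp only [hoch_apply, h, LinearMap.neg_apply, map_neg, smul_neg]
  abel

theorem Arity.hoch {n : ℕ} {g : T k W →ₗ[k] V k W} (hg : Arity n g) {μ : T k W →ₗ[k] V k W}
    (hμ : Arity 2 μ) (σ : W → k) (s : k) (τ : W → k) : Arity (n + 1) (hoch σ μ s τ g) := by
  intro l hl
  rw [hoch_apply, map_eq_zero_of_mem g (fun l' h' => hg l' (by omega)) (hμ.coder_mem σ l),
    map_eq_zero_of_mem μ (fun l' h' => hμ l' (by omega)) (hg.coder_mem τ l)]
  simp

/-- The operator is homogeneous with respect to the twist. -/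
def Tw (σ : W → k) (χ : k) (φ : T k W →ₗ[k] V k W) : Prop :=
  twV σ ∘ₗ φ = χ • φ ∘ₗ twT σ

theorem Tw.one (φ : T k W →ₗ[k] V k W) : Tw (fun _ => 1) 1 φ := by
  have h₁ : twV (k := k) (fun _ : W => 1) = LinearMap.id := V_ext fun w => by simp
  have h₂ : twT (k := k) (fun _ : W => 1) = LinearMap.id := T_ext fun l => by simp [twL]
  simp [Tw, h₁, h₂]

/-- The differential is the graded commutator with the square-zero coderivation of `μ`, so its
square vanishes. The parity flips in between, whence the sign `-s` and the twist `τ σ`. -/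
theorem hoch_hoch {σ : W → k} {μ : T k W →ₗ[k] V k W} (hμ : Arity 2 μ)
    (hass : μ ∘ₗ coder σ μ = 0) {s : k} (hs : s * s = 1) {τ : W → k}
    {g : T k W →ₗ[k] V k W} (hg : g (tensor k []) = 0) (h₁ : Tw σ s g) (h₂ : Tw τ s μ)
    (hDD : coder σ μ ∘ₗ coder σ μ = 0) :
    hoch σ μ (-s) (fun w => τ w * σ w) (hoch σ μ s τ g) = 0 := by
  have hc := coder_commutator τ σ g μ hg hμ.nil s hs h₂ h₁
  have hc' : coder (fun w => τ w * σ w) (hoch σ μ s τ g)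
    = coder τ g ∘ₗ coder σ μ - s • coder σ μ ∘ₗ coder τ g := hc.symm
  refine LinearMap.ext fun t => ?_
  have e₁ : coder σ μ (coder σ μ t) = 0 := LinearMap.congr_fun hDD t
  have e₂ : ∀ t', μ (coder σ μ t') = 0 := LinearMap.congr_fun hass
  rw [hoch_apply, hc', hoch_apply, e₁]
  simp only [LinearMap.sub_apply, LinearMap.comp_apply, LinearMap.smul_apply, map_sub, map_smul,
    e₂, map_zero, LinearMap.zero_apply]
  module

/-! ### Obstruction theory -/

/-- The operator vanishes on short tensors and is the given one on tensors of length two. -/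
def Starts (μ b : T k W →ₗ[k] V k W) : Prop :=
  Kills 1 b ∧ ∀ l : List W, l.length = 2 → b (tensor k l) = μ (tensor k l)

theorem Starts.sub_kills {μ b : T k W →ₗ[k] V k W} (hμ : Arity 2 μ) (h : Starts μ b) :
    Kills 2 (b - μ) := by
  intro l hl
  rw [LinearMap.sub_apply]
  rcases eq_or_ne l.length 2 with h2 | h2
  · rw [h.2 l h2, sub_self]
  · rw [h.1 l (by omega), hμ l h2, sub_self]

theorem Starts.eq_of_le {μ b : T k W →ₗ[k] V k W} (hμ : Arity 2 μ) (h : Starts μ b) {l : List W}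
    (hl : l.length ≤ 2) : b (tensor k l) = μ (tensor k l) := by
  have := h.sub_kills hμ l hl
  rwa [LinearMap.sub_apply, sub_eq_zero] at this

theorem coder_split (τ : W → k) (φ ψ : T k W →ₗ[k] V k W) (t : T k W) :
    coder τ φ t = coder τ ψ t + coder τ (φ - ψ) t := by
  rw [coder_sub]
  simp

theorem coder_zero (τ : W → k) : coder τ (0 : T k W →ₗ[k] V k W) = 0 := by
  have h := coder_smul τ (0 : k) (0 : T k W →ₗ[k] V k W)
  rwa [zero_smul, zero_smul] at h

/-- The obstruction to the `A_∞`-equation is a cocycle. -/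
theorem ainf_obstruction {σ : W → k} (hσ : ∀ w, σ w * σ w = 1) {μ b : T k W →ₗ[k] V k W}
    (hμ : Arity 2 μ) (hb : Starts μ b) (hodd : Tw σ (-1) b) {n : ℕ}
    (hR : Kills n (b ∘ₗ coder σ b)) :
    hoch σ μ 1 (fun _ => 1) (trunc (n + 1) (b ∘ₗ coder σ b)) = 0 := by
  refine T_ext fun l => ?_
  by_cases hl : l.length = n + 2
  swap
  · exact (arity_trunc _ _).hoch hμ σ _ _ l hl
  set R := b ∘ₗ coder σ b with hRdef
  set c := trunc (n + 1) R with hc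
  -- The square of the coderivation of `b` is the coderivation of `R`. Composing with `b` gives `R ∘
  -- D = b ∘ D_R`, whose lowest nontrivial component is the cocycle equation for `c`.
  have h := LinearMap.congr_fun (coder_comp_self σ hσ b hb.1.nil hodd) (tensor k l)
  have key : R (coder σ b (tensor k l)) = b (coder (fun _ => 1) R (tensor k l)) :=
    congrArg b h
  have hRc : Kills (n + 1) (R - c) := by
    intro l hl
    rw [LinearMap.sub_apply]
    rcases eq_or_ne l.length (n + 1) with h2 | h2
    · rw [hc, trunc_of_eq R h2, sub_self]
    · rw [hc, trunc_of_ne R h2, hR l (by omega), sub_zero]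
  -- In length `n + 2` the higher operations of `b` shorten the list to length at most `n`, where
  -- `R` vanishes. Only `μ` contributes.
  have e₁ : R (coder σ b (tensor k l)) = c (coder σ μ (tensor k l)) := by
    rw [coder_split σ b μ, map_add,
      map_eq_zero_of_mem R (fun l' h' => hR l' (by omega)) ((hb.sub_kills hμ).coder_mem σ l),
      add_zero]
    exact map_eq_of_mem R c (fun l' h' => (trunc_of_eq R (by omega)).symm) (hμ.coder_mem σ l)
  have e₂ : b (coder (fun _ => 1) R (tensor k l)) = μ (coder (fun _ => 1) c (tensor k l)) := by
    rw [coder_split _ R c, map_add,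
      map_eq_zero_of_mem b (fun l' h' => hb.1 l' (by omega)) (hRc.coder_mem _ l), add_zero]
    exact map_eq_of_mem b μ (fun l' h' => hb.eq_of_le hμ (by omega))
      ((arity_trunc _ _).coder_mem _ l)
  rw [hoch_apply, ← e₁, ← e₂, key]
  simp

/-- The change of the `A_∞`-equation under a change of one of the operations. -/
theorem ainf_perturb {σ : W → k} {μ b g : T k W →ₗ[k] V k W} (hμ : Arity 2 μ) (hb : Starts μ b)
    {n : ℕ} (hn : 3 ≤ n) (hg : Arity n g) {l : List W} (hl : l.length ≤ n + 1) :
    (b + g) (coder σ (b + g) (tensor k l))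
      = b (coder σ b (tensor k l)) + hoch σ μ (-1) σ g (tensor k l) := by
  have e₁ : g (coder σ b (tensor k l)) = g (coder σ μ (tensor k l)) := by
    rw [coder_split σ b μ, map_add, map_eq_zero_of_mem g (fun l' h' => hg l' (by omega))
      ((hb.sub_kills hμ).coder_mem σ l), add_zero]
  have e₂ : b (coder σ g (tensor k l)) = μ (coder σ g (tensor k l)) :=
    map_eq_of_mem b μ (fun l' h' => hb.eq_of_le hμ (by omega)) (hg.coder_mem σ l)
  have e₃ : g (coder σ g (tensor k l)) = 0 :=
    map_eq_zero_of_mem g (fun l' h' => hg l' (by omega)) (hg.coder_mem σ l)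
  rw [coder_add, hoch_apply]
  simp only [LinearMap.add_apply, map_add, e₁, e₂, e₃]
  module

/-- The defect of the functor equation. -/
noncomputable def defect (σ : W → k) (b b' f : T k W →ₗ[k] V k W) : T k W →ₗ[k] V k W :=
  f ∘ₗ coder σ b - b' ∘ₗ cohom f

/-- The defect of the functor equation, as an operator on tensors. -/
noncomputable def bigDefect (σ : W → k) (b b' f : T k W →ₗ[k] V k W) : T k W →ₗ[k] T k W :=
  cohom f ∘ₗ coder σ b - coder σ b' ∘ₗ cohom f

section Functor

variable {σ : W → k} {μ b b' f : T k W →ₗ[k] V k W}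

theorem defect_apply (t : T k W) :
    defect σ b b' f t = f (coder σ b t) - b' (cohom f t) := rfl

theorem bigDefect_apply (t : T k W) :
    bigDefect σ b b' f t = cohom f (coder σ b t) - coder σ b' (cohom f t) := rfl

theorem pr_bigDefect (hb' : b' (tensor k []) = 0) (hf : f (tensor k []) = 0) (t : T k W) :
    pr (bigDefect σ b b' f t) = defect σ b b' f t := by
  have h₁ := LinearMap.congr_fun (pr_cohom f hf) (coder σ b t)
  have h₂ := LinearMap.congr_fun (pr_coder σ b' hb') (cohom f t)
  simp only [LinearMap.comp_apply] at h₁ h₂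
  rw [bigDefect_apply, map_sub, h₁, h₂, defect_apply]

/-- The operator `E = F D - D' F` is a coderivation along `F`, that is, `Δ E = (E ⊗ F + F σ ⊗ E) Δ`.
This follows from `conv_coder` and `conv_cohom`, because `F` commutes with the twist. -/
theorem conv_bigDefect {M : Type*} [AddCommGroup M] [Module k M]
    (hb : b (tensor k []) = 0) (hb' : b' (tensor k []) = 0) (hf : f (tensor k []) = 0)
    (hev : Tw σ 1 f) (B : T k W →ₗ[k] T k W →ₗ[k] M) (l : List W) :
    conv B (bigDefect σ b b' f (tensor k l)) = splitSum l fun x y =>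
      B (bigDefect σ b b' f (tensor k x)) (cohom f (tensor k y))
        + twL σ x • B (cohom f (tensor k x)) (bigDefect σ b b' f (tensor k y)) := by
  have h := cohom_twT σ f hf (by simpa [Tw] using hev)
  have h' : ∀ x, twT σ (cohom f (tensor k x)) = twL σ x • cohom f (tensor k x) := fun x => by
    rw [← LinearMap.comp_apply, h]; simp
  rw [bigDefect_apply, map_sub, conv_cohom f hf, conv_coder σ b hb, conv_coder σ b' hb',
    conv_cohom f hf, conv_cohom f hf, sub_eq_iff_eq_add]
  simp only [conv_tensor, ← splitSum_add]
  refine splitSum_congr fun x y _ => ?_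
  simp only [LinearMap.comp_apply, LinearMap.compl₁₂_apply, twT_tensor, h', bigDefect_apply,
    map_sub, LinearMap.sub_apply, map_smul, LinearMap.smul_apply]
  module

theorem bigDefect_mem_ne_nil (hf : f (tensor k []) = 0)
    (t : T k W) : bigDefect σ b b' f t ∈ supp k fun l : List W => l ≠ [] := by
  have hD : ∀ (c : T k W →ₗ[k] V k W) (t : T k W),
      coder σ c t ∈ supp k fun l : List W => l ≠ [] := fun c t =>
    map_mem_of_supp (coder σ c) _ (fun l _ => supp_mono (fun _ h => h.1)
      (coder_length σ c (fun _ => True) (by simp) l)) (mem_supp_true t)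
  rw [bigDefect_apply]
  refine Submodule.sub_mem _ ?_ (hD _ _)
  exact map_mem_of_supp (cohom f) _ (fun l hl => supp_mono (fun _ h h' => hl (h.1.1 h'))
    (cohom_length f hf l)) (hD b t)

/-- By the coderivation property along `F`, each term of `E` contains exactly one letter produced by
the defect. Its block has more than `n` entries, so at least `n` letters are lost. -/
theorem bigDefect_length (hb : b (tensor k []) = 0) (hb' : b' (tensor k []) = 0)
    (hf : f (tensor k []) = 0) (hev : Tw σ 1 f) {n : ℕ} (he : Kills n (defect σ b b' f))
    (l : List W) : bigDefect σ b b' f (tensor k l)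
      ∈ supp k fun l' : List W => l'.length + n ≤ l.length := by
  induction l using length_induction with
  | h l ih =>
  rw [← conv_consL_pr (bigDefect_mem_ne_nil hf _), conv_bigDefect hb hb' hf hev]
  refine splitSum_mem _ fun x y hxy => Submodule.add_mem _ ?_ (Submodule.smul_mem _ _ ?_)
  · rw [LinearMap.comp_apply, pr_bigDefect hb' hf]
    by_cases hx : x.length ≤ n
    · simp [he x hx]
    · refine consL_mem (mem_supp_true _) (cohom_length f hf y) fun w l' _ h' => ?_
      have := congrArg List.length hxy
      simp only [List.length_append, List.length_cons] at this ⊢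
      have := h'.2
      omega
  · have h := LinearMap.congr_fun (pr_cohom f hf) (tensor k x)
    simp only [LinearMap.comp_apply] at h ⊢
    rw [h]
    by_cases hx : x = []
    · simp [hx, hf]
    · refine consL_mem (mem_supp_true _) (ih y (length_lt_of_append hxy hx)) fun w l' _ h' => ?_
      have := length_lt_of_append hxy hx
      simp only [List.length_cons]
      omega

/-- The obstruction to the functor equation is a cocycle. -/
theorem functor_obstruction (hσ : ∀ w, σ w * σ w = 1) (hμ : Arity 2 μ) (hb : Starts μ b)
    (hb' : Starts μ b') (hodd : Tw σ (-1) b) (hodd' : Tw σ (-1) b') (hbb : b ∘ₗ coder σ b = 0)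
    (hbb' : b' ∘ₗ coder σ b' = 0) (hf : f (tensor k []) = 0)
    (hf₁ : ∀ w, f (tensor k [w]) = vec k w) (hev : Tw σ 1 f) {n : ℕ}
    (he : Kills n (defect σ b b' f)) :
    hoch σ μ (-1) σ (trunc (n + 1) (defect σ b b' f)) = 0 := by
  refine T_ext fun l => ?_
  by_cases hl : l.length = n + 2
  swap
  · exact (arity_trunc _ _).hoch hμ σ _ _ l hl
  set e := defect σ b b' f with hedef
  set c := trunc (n + 1) e with hc
  have hDD := coder_comp_self σ hσ b hb.1.nil hodd
  have hDD' := coder_comp_self σ hσ b' hb'.1.nil hodd'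
  rw [hbb, coder_zero] at hDD
  rw [hbb', coder_zero] at hDD'
  -- This is the identity `(f D - b' F) D + b' (F D - D' F) = f D² - b' D' F`, whose right hand side
  -- vanishes.
  have key : e (coder σ b (tensor k l)) + b' (bigDefect σ b b' f (tensor k l)) = 0 := by
    have e₁ : coder σ b (coder σ b (tensor k l)) = 0 := LinearMap.congr_fun hDD _
    have e₂ := LinearMap.congr_fun hbb' (cohom f (tensor k l))
    simp only [LinearMap.comp_apply, LinearMap.zero_apply] at e₂
    rw [hedef, defect_apply, bigDefect_apply, map_sub, e₁, e₂]
    simp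
  have e₁ : e (coder σ b (tensor k l)) = c (coder σ μ (tensor k l)) := by
    rw [coder_split σ b μ, map_add,
      map_eq_zero_of_mem e (fun l' h' => he l' (by omega)) ((hb.sub_kills hμ).coder_mem σ l),
      add_zero]
    exact map_eq_of_mem e c (fun l' h' => (trunc_of_eq e (by omega)).symm) (hμ.coder_mem σ l)
  -- The operator `E` sends lists of length `n + 2` to lengths at most two, where `b'` agrees with
  -- `μ`. In the two outer faces that remain, `F` meets at most one letter and acts as the identity.
  have e₂ : b' (bigDefect σ b b' f (tensor k l)) = μ (coder σ c (tensor k l)) := by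
    rw [map_eq_of_mem b' μ (fun l' h' => hb'.eq_of_le hμ (by omega))
      (bigDefect_length hb.1.nil hb'.1.nil hf hev he l)]
    conv_lhs => rw [← conv_bin hμ]
    rw [conv_bigDefect hb.1.nil hb'.1.nil hf hev, mu_coder hμ σ c (arity_trunc _ _).nil]
    have hp := LinearMap.congr_fun (pr_cohom f hf)
    simp only [LinearMap.comp_apply] at hp
    have hec : ∀ x : List W, x.length ≤ n + 1 → e (tensor k x) = c (tensor k x) := by
      intro x hx
      rcases eq_or_ne x.length (n + 1) with h2 | h2
      · rw [hc, trunc_of_eq e h2]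
      · rw [hc, trunc_of_ne e h2, he x (by omega)]
    have hfp : ∀ x : List W, x.length ≤ 1 → f (tensor k x) = pr (tensor k x) := by
      intro x hx
      match x, hx with
      | [], _ => simp [hf]
      | [w], _ => simp [hf₁]
    have hcn : ∀ x : List W, x.length ≤ n → c (tensor k x) = 0 := fun x hx =>
      trunc_of_ne e (by omega)
    refine splitSum_congr fun x y hxy => ?_
    have hlen := congrArg List.length hxy
    rw [List.length_append, hl] at hlen
    simp only [LinearMap.compl₁₂_apply, pr_bigDefect hb'.1.nil hf, hp]
    rw [← hedef]
    congr 1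
    · rcases Nat.lt_or_ge 1 y.length with hy | hy
      · rw [he x (by omega), hcn x (by omega)]; simp
      · rw [hfp y hy]
        rcases Nat.lt_or_ge 0 y.length with hy' | hy'
        · rw [hec x (by omega)]
        · rw [List.length_eq_zero_iff.1 (by omega : y.length = 0)]; simp
    · rcases Nat.lt_or_ge 1 x.length with hx | hx
      · rw [he y (by omega), hcn y (by omega)]; simp
      · rw [hfp x hx]
        rcases Nat.lt_or_ge 0 x.length with hx' | hx'
        · rw [hec y (by omega)]
        · rw [List.length_eq_zero_iff.1 (by omega : x.length = 0)]; simp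
  rw [hoch_apply, neg_smul, one_smul, sub_neg_eq_add, ← e₁, ← e₂, key]
  rfl

theorem cohom_short (hf₁ : ∀ w, f (tensor k [w]) = vec k w)
    {l : List W} (hl : l.length ≤ 1) : cohom f (tensor k l) = tensor k l := by
  match l, hl with
  | [], _ => simp
  | [w], _ => simp [cohom_cons, hf₁]

/-- A block of length `n` in a list of length at most `n + 1` leaves room for at most one more
letter. Hence `g` is used at most once, as `n ≥ 2`, and then all other blocks are single letters, on
which `f` is the identity. These terms form an untwisted coderivation. -/
theorem cohom_perturb {g : T k W →ₗ[k] V k W} {n : ℕ} (hn : 2 ≤ n) (hg : Arity n g)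
    (hf : f (tensor k []) = 0) (hf₁ : ∀ w, f (tensor k [w]) = vec k w) {l : List W}
    (hl : l.length ≤ n + 1) :
    cohom (f + g) (tensor k l) = cohom f (tensor k l) + coder (fun _ => 1) g (tensor k l) := by
  have hf' : (f + g) (tensor k []) = 0 := by simp [hf, hg [] (by simp; omega)]
  have hf₁' : ∀ w, (f + g) (tensor k [w]) = vec k w := by
    intro w; simp [hf₁, hg [w] (by simp; omega)]
  induction l using length_induction with
  | h l ih =>
  cases l with
  | nil => simp
  | cons w l =>
    rw [cohom_of_ne_nil _ hf' (by simp), cohom_of_ne_nil f hf (by simp), coder_cons,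
      applyInit_tensor, one_smul]
    have h₁ : splitSum (w :: l) (fun x y => consL ((f + g) (tensor k x)) (cohom (f + g) (tensor k y)))
        = splitSum (w :: l) (fun x y => (consL (f (tensor k x)) (cohom f (tensor k y))
          + consL (f (tensor k x)) (coder (fun _ => 1) g (tensor k y)))
          + consL (g (tensor k x)) (tensor k y)) := by
      refine splitSum_congr fun x y hxy => ?_
      by_cases hx : x = []
      · subst hx; simp [hf, hg [] (by simp; omega)]
      have hy := length_lt_of_append hxy hx
      rw [LinearMap.add_apply, map_add, LinearMap.add_apply, ih y hy (by omega), map_add]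
      congr 1
      by_cases hxn : x.length = n
      · have hlen := congrArg List.length hxy
        rw [List.length_append] at hlen
        rw [← ih y hy (by omega), cohom_short hf₁' (by omega)]
      · rw [hg x hxn]; simp
    rw [h₁, splitSum_add, splitSum_add, add_assoc]
    congr 2
    rw [splitSum_cons, hf, map_zero, LinearMap.zero_apply, zero_add]
    have hDg : ∀ y : List W, y.length < n → coder (fun _ => 1) g (tensor k y) = 0 := by
      intro y hy
      have h := coder_length (fun _ => 1) g (fun s => s = n) hg y
      refine map_eq_zero_of_supp (LinearMap.id (M := T k W)) (S := fun l' : List W => False) (by simp)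
        (supp_mono ?_ h)
      rintro l' ⟨_, s, rfl, hs, _⟩
      omega
    have h₂ : splitSum l (fun x y => consL (f (tensor k (w :: x)))
        (coder (fun _ => 1) g (tensor k y))) = splitSum l (fun x y =>
          if x = [] then consL (vec k w) (coder (fun _ => 1) g (tensor k y)) else 0) := by
      refine splitSum_congr fun x y hxy => ?_
      by_cases hx : x = []
      · subst hx; simp [hf₁]
      · have hy := length_lt_of_append hxy hx
        simp only [List.length_cons] at hl
        rw [if_neg hx, hDg y (by omega), map_zero]
    rw [h₂]
    cases l with
    | nil => simp
    | cons w' l => simp [splitSum_zero]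

/-- The change of the functor equation under a change of one of the components. -/
theorem functor_perturb {g : T k W →ₗ[k] V k W} (hμ : Arity 2 μ) (hb : Starts μ b)
    (hb' : Starts μ b') {n : ℕ} (hn : 2 ≤ n) (hg : Arity n g)
    (hf : f (tensor k []) = 0) (hf₁ : ∀ w, f (tensor k [w]) = vec k w) {l : List W}
    (hl : l.length ≤ n + 1) :
    defect σ b b' (f + g) (tensor k l)
      = defect σ b b' f (tensor k l) + hoch σ μ 1 (fun _ => 1) g (tensor k l) := by
  have e₁ : g (coder σ b (tensor k l)) = g (coder σ μ (tensor k l)) := by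
    rw [coder_split σ b μ, map_add, map_eq_zero_of_mem g (fun l' h' => hg l' (by omega))
      ((hb.sub_kills hμ).coder_mem σ l), add_zero]
  have e₂ : b' (coder (fun _ => 1) g (tensor k l)) = μ (coder (fun _ => 1) g (tensor k l)) :=
    map_eq_of_mem b' μ (fun l' h' => hb'.eq_of_le hμ (by omega)) (hg.coder_mem _ l)
  rw [defect_apply, cohom_perturb hn hg hf hf₁ hl, map_add, e₂, LinearMap.add_apply, e₁,
    defect_apply, hoch_apply]
  module

end Functor

/-- Limits of sequences of operators whose components stabilize. -/
theorem exists_limit {P : ℕ → (T k W →ₗ[k] V k W) → Prop} {n₀ : ℕ} {b₀ : T k W →ₗ[k] V k W}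
    (h₀ : P n₀ b₀)
    (step : ∀ n b, n₀ ≤ n → P n b → ∃ b', P (n + 1) b' ∧
      ∀ l : List W, l.length < n → b' (tensor k l) = b (tensor k l)) :
    ∃ b : T k W →ₗ[k] V k W, ∀ n, n₀ ≤ n → ∃ b', P n b' ∧
      ∀ l : List W, l.length < n → b (tensor k l) = b' (tensor k l) := by
  choose! F hF using step
  let B : ℕ → (T k W →ₗ[k] V k W) := fun i => Nat.rec b₀ (fun i b => F (n₀ + i) b) i
  have hB : ∀ i, P (n₀ + i) (B i) := by
    intro i
    induction i with
    | zero => exact h₀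
    | succ i ih => exact (hF _ _ (by omega) ih).1
  have hstep : ∀ i (l : List W), l.length < n₀ + i → B (i + 1) (tensor k l) = B i (tensor k l) :=
    fun i l hl => (hF _ _ (by omega) (hB i)).2 l hl
  have hstab : ∀ i j (l : List W), l.length < n₀ + i →
      B (i + j) (tensor k l) = B i (tensor k l) := by
    intro i j l hl
    induction j with
    | zero => rfl
    | succ j ih => rw [← ih]; exact hstep (i + j) l (by omega)
  -- On lists of length `ℓ` the sequence is constant from an index `i` with `ℓ < n₀ + i` on, and `i
  -- = ℓ + 1` satisfies this for every `n₀`.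
  refine ⟨ofList fun l => B (l.length + 1) (tensor k l), fun n hn => ?_⟩
  obtain ⟨i, rfl⟩ := Nat.exists_eq_add_of_le hn
  refine ⟨B i, hB i, fun l hl => ?_⟩
  rw [ofList_tensor]
  rcases le_total i (l.length + 1) with h | h
  · obtain ⟨j, hj⟩ := Nat.exists_eq_add_of_le h
    rw [hj, hstab i j l hl]
  · obtain ⟨j, hj⟩ := Nat.exists_eq_add_of_le h
    rw [hj, hstab _ j l (by omega)]

end Bar

/-! ## Alternating words -/

/-- The monomials of the category with three objects as alternating words in the generators:
`one i` is an identity and `alt t e n` is the alternating word with `n + 1` letters whose leftmost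
letter ends at `X_t` and is of type `u` if `e = false`, of type `v` if `e = true`. -/
inductive Alt
  | one (i : ZMod 3)
  | alt (t : ZMod 3) (e : Bool) (n : ℕ)
  deriving DecidableEq

namespace Alt

/-- The displacement from the target to the source of a generator. -/
def dir (e : Bool) : ZMod 3 := if e then 1 else -1

/-- The type of a letter which may follow an alternating word with `n + 1` letters. -/
def nxt (e : Bool) (n : ℕ) : Bool := if n % 2 = 0 then !e else e

/-- The index of the source. -/
def src : Alt → ZMod 3
  | one i => i
  | alt t e n => if n % 2 = 0 then t + dir e else t

/-- The index of the target. -/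
def tgt : Alt → ZMod 3
  | one i => i
  | alt t _ _ => t

/-- The shifted parity. -/
def spar : Alt → ZMod 2
  | one _ => 1
  | alt _ _ n => n

/-- The shifted degree. -/
def sdeg (P Q : ZMod 3 → ℚ) : Alt → ℚ
  | one _ => -1
  | alt t e n => (((n + 2) / 2 : ℕ) : ℚ) * (if e then Q (t + 1) else P t)
      + (((n + 1) / 2 : ℕ) : ℚ) * (if e then P (t + 1) else Q t) - 1

/-- The composition of two words; `none` if it is zero or not defined. -/
def mul : Alt → Alt → Option Alt
  | one i, w => if i = w.tgt then some w else none
  | w, one i => if w.src = i then some w else none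
  | alt t e n, alt t' e' n' =>
      if (alt t e n).src = t' ∧ nxt e n = e' then some (alt t e (n + n' + 1)) else none

theorem dir_not (e : Bool) : dir (!e) = - dir e := by cases e <;> decide

theorem mul_one_left {i : ZMod 3} {w : Alt} (h : w.tgt = i) : mul (one i) w = some w := by
  cases w <;> simp_all [mul]

theorem mul_one_right {i : ZMod 3} {w : Alt} (h : w.src = i) : mul w (one i) = some w := by
  cases w <;> simp_all [mul, src, tgt]

theorem mul_props {w₁ w₂ w : Alt} (h : mul w₁ w₂ = some w) :
    w₁.src = w₂.tgt ∧ w.tgt = w₁.tgt ∧ w.src = w₂.src := by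
  cases w₁ with
  | one i =>
    simp only [mul] at h
    split_ifs at h with h'
    cases h
    exact ⟨h', h'.symm, rfl⟩
  | alt t e n =>
    cases w₂ with
    | one i =>
      simp only [mul] at h
      split_ifs at h with h'
      cases h
      exact ⟨h', rfl, h'⟩
    | alt t' e' n' =>
      simp only [mul] at h
      split_ifs at h with h'
      cases h
      obtain ⟨rfl, rfl⟩ := h'
      refine ⟨rfl, rfl, ?_⟩
      simp only [src, nxt]
      rcases Nat.mod_two_eq_zero_or_one n with hn | hn <;>
        rcases Nat.mod_two_eq_zero_or_one n' with hn' | hn'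
      · simp [hn, hn', show (n + n' + 1) % 2 = 1 by omega, dir_not]
      · simp [hn, hn', show (n + n' + 1) % 2 = 0 by omega]
      · simp [hn, hn', show (n + n' + 1) % 2 = 0 by omega]
      · simp [hn, hn', show (n + n' + 1) % 2 = 1 by omega]

theorem spar_mul {w₁ w₂ w : Alt} (h : mul w₁ w₂ = some w) :
    w.spar = w₁.spar + w₂.spar + 1 := by
  have h2 : (1 + 1 : ZMod 2) = 0 := by decide
  cases w₁ with
  | one i =>
    simp only [mul] at h
    split_ifs at h with h'
    cases h
    simp only [spar]
    linear_combination -h2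
  | alt t e n =>
    cases w₂ with
    | one i =>
      simp only [mul] at h
      split_ifs at h with h'
      cases h
      simp only [spar]
      linear_combination -h2
    | alt t' e' n' =>
      simp only [mul] at h
      split_ifs at h with h'
      cases h
      simp only [spar]
      push_cast
      ring

theorem sdeg_mul (P Q : ZMod 3 → ℚ) {w₁ w₂ w : Alt} (h : mul w₁ w₂ = some w) :
    w.sdeg P Q = w₁.sdeg P Q + w₂.sdeg P Q + 1 := by
  cases w₁ with
  | one i =>
    simp only [mul] at h
    split_ifs at h with h'
    cases h
    simp only [sdeg]
    ring
  | alt t e n =>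
    cases w₂ with
    | one i =>
      simp only [mul] at h
      split_ifs at h with h'
      cases h
      simp only [sdeg]
      ring
    | alt t' e' n' =>
      simp only [mul] at h
      split_ifs at h with h'
      cases h
      obtain ⟨rfl, rfl⟩ := h'
      simp only [sdeg]
      obtain ⟨a, rfl | rfl⟩ := Nat.even_or_odd' n <;> obtain ⟨b, rfl | rfl⟩ := Nat.even_or_odd' n'
      · rw [show (2 * a + 2 * b + 1 + 2) / 2 = a + b + 1 by omega,
          show (2 * a + 2 * b + 1 + 1) / 2 = a + b + 1 by omega, show (2 * a + 2) / 2 = a + 1 by omega,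
          show (2 * b + 2) / 2 = b + 1 by omega, show (2 * a + 1) / 2 = a by omega,
          show (2 * b + 1) / 2 = b by omega,
          show (alt t e (2 * a)).src = t + dir e by simp [src],
          show nxt e (2 * a) = !e by simp [nxt]]
        cases e <;> simp [dir] <;> ring
      · rw [show (2 * a + (2 * b + 1) + 1 + 2) / 2 = a + b + 2 by omega,
          show (2 * a + (2 * b + 1) + 1 + 1) / 2 = a + b + 1 by omega,
          show (2 * a + 2) / 2 = a + 1 by omega,
          show (2 * b + 1 + 2) / 2 = b + 1 by omega, show (2 * a + 1) / 2 = a by omega,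
          show (2 * b + 1 + 1) / 2 = b + 1 by omega,
          show (alt t e (2 * a)).src = t + dir e by simp [src],
          show nxt e (2 * a) = !e by simp [nxt]]
        cases e <;> simp [dir] <;> ring
      · rw [show (2 * a + 1 + 2 * b + 1 + 2) / 2 = a + b + 2 by omega,
          show (2 * a + 1 + 2 * b + 1 + 1) / 2 = a + b + 1 by omega,
          show (2 * a + 1 + 2) / 2 = a + 1 by omega,
          show (2 * b + 2) / 2 = b + 1 by omega, show (2 * a + 1 + 1) / 2 = a + 1 by omega,
          show (2 * b + 1) / 2 = b by omega, show (alt t e (2 * a + 1)).src = t by simp [src],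
          show nxt e (2 * a + 1) = e by simp [nxt]]
        cases e <;> simp <;> ring
      · rw [show (2 * a + 1 + (2 * b + 1) + 1 + 2) / 2 = a + b + 2 by omega,
          show (2 * a + 1 + (2 * b + 1) + 1 + 1) / 2 = a + b + 2 by omega,
          show (2 * a + 1 + 2) / 2 = a + 1 by omega,
          show (2 * b + 1 + 2) / 2 = b + 1 by omega, show (2 * a + 1 + 1) / 2 = a + 1 by omega,
          show (2 * b + 1 + 1) / 2 = b + 1 by omega, show (alt t e (2 * a + 1)).src = t by simp [src],
          show nxt e (2 * a + 1) = e by simp [nxt]]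
        cases e <;> simp <;> ring

theorem nxt_nxt (e : Bool) (n n' : ℕ) : nxt (nxt e n) n' = nxt e (n + n' + 1) := by
  simp only [nxt]
  rcases Nat.mod_two_eq_zero_or_one n with hn | hn <;>
    rcases Nat.mod_two_eq_zero_or_one n' with hn' | hn'
  · simp [hn, hn', show (n + n' + 1) % 2 = 1 by omega]
  · simp [hn, hn', show (n + n' + 1) % 2 = 0 by omega]
  · simp [hn, hn', show (n + n' + 1) % 2 = 0 by omega]
  · simp [hn, hn', show (n + n' + 1) % 2 = 1 by omega]

/-- Both sides are nonzero exactly when the two junctions fit and alternate. Since a product ends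
with the last letter of its right factor, the second junction is the same for `w₂` and for `w₁ w₂`.
-/
theorem mul_assoc_alt {t t' t'' : ZMod 3} {e e' e'' : Bool} {n n' n'' : ℕ} :
    (mul (alt t e n) (alt t' e' n')).bind (fun w => mul w (alt t'' e'' n''))
      = (mul (alt t' e' n') (alt t'' e'' n'')).bind fun w => mul (alt t e n) w := by
  have key : ∀ h : mul (alt t e n) (alt t' e' n') = some (alt t e (n + n' + 1)),
      (alt t e (n + n' + 1)).src = (alt t' e' n').src := fun h => (mul_props h).2.2
  by_cases h₁ : (alt t e n).src = t' ∧ nxt e n = e'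
  · have hm : mul (alt t e n) (alt t' e' n') = some (alt t e (n + n' + 1)) := by simp [mul, h₁]
    rw [hm, Option.bind_some]
    have hs := key hm
    have hn : nxt e (n + n' + 1) = nxt e' n' := by rw [← h₁.2, nxt_nxt]
    by_cases h₂ : (alt t' e' n').src = t'' ∧ nxt e' n' = e''
    · have hm' : mul (alt t' e' n') (alt t'' e'' n'') = some (alt t' e' (n' + n'' + 1)) := by
        simp [mul, h₂]
      rw [hm', Option.bind_some]
      simp only [mul]
      rw [if_pos ⟨hs.trans h₂.1, hn.trans h₂.2⟩, if_pos h₁]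
      congr 2
      omega
    · have hm' : mul (alt t' e' n') (alt t'' e'' n'') = none := by
        simp only [mul]; rw [if_neg h₂]
      rw [hm', Option.bind_none]
      simp only [mul]
      rw [if_neg fun h => h₂ ⟨hs ▸ h.1, hn ▸ h.2⟩]
  · have hm : mul (alt t e n) (alt t' e' n') = none := by simp only [mul]; rw [if_neg h₁]
    rw [hm, Option.bind_none]
    by_cases h₂ : (alt t' e' n').src = t'' ∧ nxt e' n' = e''
    · have hm' : mul (alt t' e' n') (alt t'' e'' n'') = some (alt t' e' (n' + n'' + 1)) := by
        simp [mul, h₂]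
      rw [hm', Option.bind_some]
      simp only [mul]
      rw [if_neg h₁]
    · have hm' : mul (alt t' e' n') (alt t'' e'' n'') = none := by
        simp only [mul]; rw [if_neg h₂]
      rw [hm', Option.bind_none]

theorem mul_none {w₁ w₂ : Alt} (h : w₁.src ≠ w₂.tgt) : mul w₁ w₂ = none := by
  cases hm : mul w₁ w₂ with
  | none => rfl
  | some w => exact absurd (mul_props hm).1 h

theorem mul_assoc' (w₁ w₂ w₃ : Alt) :
    (mul w₁ w₂).bind (fun w => mul w w₃) = (mul w₂ w₃).bind fun w => mul w₁ w := by
  by_cases h₁ : w₁.src = w₂.tgt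
  swap
  · rw [mul_none h₁, Option.bind_none]
    cases h : mul w₂ w₃ with
    | none => rfl
    | some w => rw [Option.bind_some, mul_none]; rw [(mul_props h).2.1]; exact h₁
  by_cases h₂ : w₂.src = w₃.tgt
  swap
  · rw [mul_none h₂, Option.bind_none]
    cases h : mul w₁ w₂ with
    | none => rfl
    | some w => rw [Option.bind_some, mul_none]; rw [(mul_props h).2.2]; exact h₂
  cases w₁ with
  | one i =>
    have h₁' : w₂.tgt = i := h₁.symm
    rw [mul_one_left h₁', Option.bind_some]
    cases h : mul w₂ w₃ with
    | none => rfl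
    | some w => rw [Option.bind_some, mul_one_left]; rw [(mul_props h).2.1]; exact h₁.symm
  | alt t e n =>
  cases w₂ with
  | one i =>
    have h₁' : (alt t e n).src = i := h₁
    have h₂' : w₃.tgt = i := h₂.symm
    rw [mul_one_left h₂', mul_one_right h₁', Option.bind_some, Option.bind_some]
  | alt t' e' n' =>
  cases w₃ with
  | one i =>
    have h₂' : (alt t' e' n').src = i := h₂
    rw [mul_one_right h₂', Option.bind_some]
    cases h : mul (alt t e n) (alt t' e' n') with
    | none => rfl
    | some w => rw [Option.bind_some, mul_one_right]; rw [(mul_props h).2.2]; exact h₂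
  | alt t'' e'' n'' => exact mul_assoc_alt

end Alt

/-! ### Signs -/

theorem paritySign_zero (K : Type*) [Field K] : paritySign K 0 = 1 := by simp [paritySign]
theorem paritySign_one (K : Type*) [Field K] : paritySign K 1 = -1 := by simp [paritySign]

theorem paritySign_add (K : Type*) [Field K] (a b : ZMod 2) :
    paritySign K (a + b) = paritySign K a * paritySign K b := by
  have h2 : (1 + 1 : ZMod 2) = 0 := by decide
  have : ∀ c : ZMod 2, c = 0 ∨ c = 1 := by decide
  rcases this a with rfl | rfl <;> rcases this b with rfl | rfl <;> simp [paritySign, h2]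

theorem paritySign_mul_self (K : Type*) [Field K] (a : ZMod 2) :
    paritySign K a * paritySign K a = 1 := by
  rw [← paritySign_add]
  have : ∀ c : ZMod 2, c + c = 0 := by decide
  rw [this, paritySign_zero]

theorem zmod_two_add_self (a : ZMod 2) : a + a = 0 := by revert a; decide

/-! ### The grading on lists of words -/

namespace Bar

open Alt

/-- The list is a path from `X_i` to `X_j`. -/
def IsPath : ZMod 3 → List Alt → ZMod 3 → Prop
  | j, [], i => j = i
  | j, w :: l, i => w.tgt = j ∧ IsPath w.src l i

theorem isPath_append {j i : ZMod 3} {x y : List Alt} :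
    IsPath j (x ++ y) i ↔ ∃ m, IsPath j x m ∧ IsPath m y i := by
  induction x generalizing j with
  | nil => simp [IsPath]
  | cons w x ih => simp [IsPath, ih, and_assoc]

/-- The sum of the shifted parities. -/
def lpar (l : List Alt) : ZMod 2 := (l.map spar).sum

/-- The sum of the shifted degrees. -/
def ldeg (P Q : ZMod 3 → ℚ) (l : List Alt) : ℚ := (l.map (sdeg P Q)).sum

@[simp] theorem lpar_nil : lpar [] = 0 := rfl
@[simp] theorem lpar_cons (w : Alt) (l : List Alt) : lpar (w :: l) = w.spar + lpar l := by
  simp [lpar]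
@[simp] theorem lpar_append (l l' : List Alt) : lpar (l ++ l') = lpar l + lpar l' := by
  simp [lpar]
@[simp] theorem ldeg_nil (P Q : ZMod 3 → ℚ) : ldeg P Q [] = 0 := rfl
@[simp] theorem ldeg_cons (P Q : ZMod 3 → ℚ) (w : Alt) (l : List Alt) :
    ldeg P Q (w :: l) = w.sdeg P Q + ldeg P Q l := by
  simp [ldeg]
@[simp] theorem ldeg_append (P Q : ZMod 3 → ℚ) (l l' : List Alt) :
    ldeg P Q (l ++ l') = ldeg P Q l + ldeg P Q l' := by
  simp [ldeg]

/-- The two lists have the same endpoints, and the degrees differ by the given one. -/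
def Rel (P Q : ZMod 3 → ℚ) (η : ZMod 2 × ℚ) (l l' : List Alt) : Prop :=
  (∀ j i, IsPath j l' i → IsPath j l i) ∧ lpar l' = lpar l + η.1 ∧ ldeg P Q l' = ldeg P Q l + η.2

section Rel

variable {P Q : ZMod 3 → ℚ} {η θ : ZMod 2 × ℚ}

theorem Rel.refl (l : List Alt) : Rel P Q 0 l l := ⟨fun _ _ h => h, by simp, by simp⟩

theorem Rel.trans {l l' l'' : List Alt} (h : Rel P Q η l l') (h' : Rel P Q θ l' l'') :
    Rel P Q (η + θ) l l'' :=
  ⟨fun j i hp => h.1 j i (h'.1 j i hp), by rw [h'.2.1, h.2.1]; simp [add_assoc],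
    by rw [h'.2.2, h.2.2]; simp [add_assoc]⟩

theorem Rel.append {l l' m m' : List Alt} (h : Rel P Q η l l') (h' : Rel P Q θ m m') :
    Rel P Q (η + θ) (l ++ m) (l' ++ m') := by
  refine ⟨fun j i hp => ?_, ?_, ?_⟩
  · obtain ⟨n, h₁, h₂⟩ := isPath_append.1 hp
    exact isPath_append.2 ⟨n, h.1 _ _ h₁, h'.1 _ _ h₂⟩
  · rw [lpar_append, lpar_append, h.2.1, h'.2.1, Prod.fst_add]; abel
  · rw [ldeg_append, ldeg_append, h.2.2, h'.2.2, Prod.snd_add]; abel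

theorem Rel.mul {w₁ w₂ w : Alt} (h : Alt.mul w₁ w₂ = some w) : Rel P Q (1, 1) [w₁, w₂] [w] := by
  refine ⟨fun j i hp => ?_, ?_, ?_⟩
  · obtain ⟨h₁, h₂⟩ := hp
    simp only [IsPath] at h₂ ⊢
    have := mul_props h
    refine ⟨this.2.1 ▸ h₁, this.1.symm, this.2.2 ▸ h₂⟩
  · simp [spar_mul h, add_assoc]
  · simp [sdeg_mul P Q h, add_assoc]

theorem Rel.isPath {l : List Alt} {w : Alt} (h : Rel P Q η l [w]) : IsPath w.tgt l w.src :=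
  h.1 _ _ ⟨rfl, rfl⟩

variable {k : Type*} [Field k]

/-- The operator preserves endpoints and shifts the degrees by the given one. -/
def Graded (P Q : ZMod 3 → ℚ) (η : ZMod 2 × ℚ) (φ : T k Alt →ₗ[k] V k Alt) : Prop :=
  ∀ l, φ (tensor k l) ∈ supp k fun w => Rel P Q η l [w]

theorem Graded.add {φ ψ : T k Alt →ₗ[k] V k Alt} (h : Graded P Q η φ) (h' : Graded P Q η ψ) :
    Graded P Q η (φ + ψ) := fun l => Submodule.add_mem _ (h l) (h' l)

theorem Graded.sub {φ ψ : T k Alt →ₗ[k] V k Alt} (h : Graded P Q η φ) (h' : Graded P Q η ψ) :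
    Graded P Q η (φ - ψ) := fun l => Submodule.sub_mem _ (h l) (h' l)

theorem Graded.neg {φ : T k Alt →ₗ[k] V k Alt} (h : Graded P Q η φ) :
    Graded P Q η (-φ) := fun l => Submodule.neg_mem _ (h l)

theorem Graded.smul {φ : T k Alt →ₗ[k] V k Alt} (r : k) (h : Graded P Q η φ) :
    Graded P Q η (r • φ) := fun l => Submodule.smul_mem _ _ (h l)

theorem Graded.trunc {φ : T k Alt →ₗ[k] V k Alt} (h : Graded P Q η φ) (n : ℕ) :
    Graded P Q η (trunc n φ) := by
  intro l
  by_cases hl : l.length = n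
  · rw [trunc_of_eq φ hl]; exact h l
  · rw [trunc_of_ne φ hl]; exact Submodule.zero_mem _

theorem Graded.coder_mem {φ : T k Alt →ₗ[k] V k Alt} (h : Graded P Q η φ) (τ : Alt → k)
    (l : List Alt) : coder τ φ (tensor k l) ∈ supp k (Rel P Q η l) := by
  induction l with
  | nil => rw [coder_nil]; exact Submodule.zero_mem _
  | cons w l ih =>
    rw [coder_cons]
    refine Submodule.add_mem _ (Submodule.smul_mem _ _ ?_) (applyInit_mem _ _ _ fun x y hxy => ?_)
    · refine consL_mem (S := fun v => v = w) (vec_mem rfl) ih ?_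
      rintro v l' rfl h'
      have := (Rel.refl (P := P) (Q := Q) [v]).append h'
      rwa [zero_add] at this
    · refine consL_mem (S' := fun v => v = y) (h x) (tensor_mem rfl) ?_
      rintro v y' h' rfl
      have := h'.append (Rel.refl (P := P) (Q := Q) y')
      rwa [add_zero, hxy] at this

theorem Graded.comp_coder {φ ψ : T k Alt →ₗ[k] V k Alt} (h : Graded P Q η φ)
    (h' : Graded P Q θ ψ) (τ : Alt → k) : Graded P Q (η + θ) (ψ ∘ₗ coder τ φ) := fun l =>
  map_mem_of_supp ψ _ (fun l' hl' => supp_mono (fun _ h'' => hl'.trans h'') (h' l'))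
    (h.coder_mem τ l)

theorem Graded.cohom_mem {f : T k Alt →ₗ[k] V k Alt} (h : Graded P Q 0 f)
    (hf : f (tensor k []) = 0) (l : List Alt) : cohom f (tensor k l) ∈ supp k (Rel P Q 0 l) :=
  Bar.cohom_mem f hf _ (Rel.refl _) (fun x v y y' _ h₁ h₂ => by
    have := h₁.append h₂
    rwa [add_zero] at this) h l

theorem Graded.defect {σ : Alt → k} {b b' f : T k Alt →ₗ[k] V k Alt} (hb : Graded P Q η b)
    (hb' : Graded P Q η b') (hf : Graded P Q 0 f) (hf0 : f (tensor k []) = 0) :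
    Graded P Q η (defect σ b b' f) := by
  refine Graded.sub ?_ fun l => ?_
  · have := hb.comp_coder hf σ
    rwa [add_zero] at this
  · exact map_mem_of_supp b' _ (fun l' hl' => supp_mono (fun _ h'' => by
      have := hl'.trans h''
      rwa [zero_add] at this) (hb' l')) (hf.cohom_mem hf0 l)

/-- On a list that is not composable no output has matching endpoints. Operators are therefore
defined on all lists but only need to be examined on paths. -/
theorem Graded.eq_zero {φ : T k Alt →ₗ[k] V k Alt} (h : Graded P Q η φ) {l : List Alt}
    (hl : ∀ j i, ¬ IsPath j l i) : φ (tensor k l) = 0 := by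
  refine map_eq_zero_of_supp (LinearMap.id (M := V k Alt)) (S := fun _ => False) (by simp)
    (supp_mono (fun w hw => ?_) (h l))
  exact hl _ _ hw.isPath

theorem Graded.apply_eq_zero {φ : T k Alt →ₗ[k] V k Alt} (h : Graded P Q η φ) {l : List Alt}
    {w : Alt} (hl : ¬ Rel P Q η l [w]) : φ (tensor k l) w = 0 := by
  by_contra h0
  exact hl (h l (Finsupp.mem_support_iff.2 h0))

variable (k) in
/-- The sign of the shifted parity. -/
noncomputable def sg (w : Alt) : k := paritySign k w.spar

theorem sg_mul_self (w : Alt) : sg k w * sg k w = 1 := paritySign_mul_self _ _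

theorem twL_sg (l : List Alt) : twL (sg k) l = paritySign k (lpar l) := by
  induction l with
  | nil => simp [paritySign_zero]
  | cons w l ih => rw [twL_cons, ih, lpar_cons, paritySign_add, sg]

/-- All letters of the output have the parity of the input shifted by that of the operator. This
supplies the sign hypotheses of the abstract bar construction. -/
theorem Graded.tw {φ : T k Alt →ₗ[k] V k Alt} (h : Graded P Q η φ) :
    Tw (sg k) (paritySign k η.1) φ := by
  refine T_ext fun l => ?_
  simp only [LinearMap.comp_apply, LinearMap.smul_apply, twT_tensor, map_smul, twL_sg]
  rw [smul_smul, ← paritySign_add, add_comm]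
  refine map_eq_of_supp (twV (sg k)) (paritySign k (lpar l + η.1) • LinearMap.id)
    (fun w hw => ?_) (h l)
  have h' := hw.2.1
  simp only [lpar_cons, lpar_nil, add_zero] at h'
  change twV (sg k) (vec k w) = paritySign k (lpar l + η.1) • vec k w
  rw [twV_vec, ← h', sg]

/-! ### The shifted composition and its Hochschild differential -/

/-- A word or zero as a vector. -/
noncomputable def ovec (k : Type*) [Field k] (o : Option Alt) : V k Alt := o.elim 0 (vec k)

variable (k) in
/-- The shifted composition. -/
noncomputable def mu : T k Alt →ₗ[k] V k Alt :=
  ofList fun l => match l with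
    | [w₁, w₂] => - sg k w₁ • ovec k (mul w₁ w₂)
    | _ => 0

theorem mu_pair (w₁ w₂ : Alt) : mu k (tensor k [w₁, w₂]) = - sg k w₁ • ovec k (mul w₁ w₂) := by
  simp [mu]

theorem arity_mu : Arity 2 (mu k) := by
  intro l hl
  rw [mu, ofList_tensor]
  match l, hl with
  | [], _ => rfl
  | [_], _ => rfl
  | [_, _], h => simp at h
  | _ :: _ :: _ :: _, _ => rfl

theorem graded_mu : Graded P Q (1, 1) (mu k) := by
  intro l
  by_cases hl : l.length = 2
  · match l, hl with
    | [w₁, w₂], _ =>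
      rw [mu_pair]
      cases h : mul w₁ w₂ with
      | none => simp [ovec]
      | some w => exact Submodule.smul_mem _ _ (vec_mem (Rel.mul h))
  · rw [arity_mu l hl]
    exact Submodule.zero_mem _

theorem applyInit_arity_two {W : Type*} {μ : T k W →ₗ[k] V k W} (hμ : Arity 2 μ) (w w' : W)
    (l : List W) :
    applyInit μ (tensor k (w :: w' :: l)) = consL (μ (tensor k [w, w'])) (tensor k l) := by
  have h : ∀ x y, x ++ y = l → consL (μ (tensor k (w :: w' :: x))) (tensor k y)
      = if x = [] then consL (μ (tensor k [w, w'])) (tensor k l) else 0 := by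
    intro x y hxy
    by_cases hx : x = []
    · subst hx
      rw [List.nil_append] at hxy
      rw [hxy, if_pos rfl]
    · have := List.length_pos_iff.2 hx
      rw [if_neg hx, hμ _ (by simp; omega)]
      simp
  rw [applyInit_tensor, splitSum_cons, splitSum_cons, splitSum_congr h, hμ [] (by simp),
    hμ [w] (by simp)]
  cases l with
  | nil => simp
  | cons v l => simp [splitSum_zero]

theorem coder_single {W : Type*} {μ : T k W →ₗ[k] V k W} (hμ : Arity 2 μ) (σ : W → k) (w : W) :
    coder σ μ (tensor k [w]) = 0 := by
  rw [coder_cons, applyInit_tensor]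
  simp [hμ [] (by simp), hμ [w] (by simp)]

theorem coder_cons_cons {W : Type*} {μ : T k W →ₗ[k] V k W} (hμ : Arity 2 μ) (σ : W → k)
    (w w' : W) (l : List W) :
    coder σ μ (tensor k (w :: w' :: l)) = σ w • consL (vec k w) (coder σ μ (tensor k (w' :: l)))
      + consL (μ (tensor k [w, w'])) (tensor k l) := by
  rw [coder_cons, applyInit_arity_two hμ]

theorem bin_ovec_left (o : Option Alt) (w : Alt) :
    bin (mu k) (ovec k o) (vec k w)
      = o.elim 0 fun v => - sg k v • ovec k (mul v w) := by
  cases o with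
  | none => simp [ovec]
  | some v => exact (bin_vec _ _ _).trans (mu_pair v w)

theorem bin_ovec_right (o : Option Alt) (w : Alt) :
    bin (mu k) (vec k w) (ovec k o) = - sg k w • ovec k (o.bind fun v => mul w v) := by
  cases o with
  | none => simp [ovec]
  | some v => exact (bin_vec _ _ _).trans (mu_pair w v)

theorem mu_assoc : mu k ∘ₗ coder (sg k) (mu k) = 0 := by
  refine T_ext fun l => ?_
  by_cases hl : l.length = 3
  · match l, hl with
    | [w₁, w₂, w₃], _ =>
      rw [LinearMap.comp_apply, mu_coder_concat arity_mu (sg k) (mu k) (arity_mu [] (by simp))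
        (w := w₁) (y := [w₂, w₃]) (x := [w₁, w₂]) (z := w₃) rfl, mu_pair, mu_pair, map_smul,
        map_smul, LinearMap.smul_apply, bin_ovec_left, bin_ovec_right]
      rw [← mul_assoc']
      cases h : mul w₁ w₂ with
      | none => simp [ovec]
      | some w =>
        simp only [Option.elim_some, Option.bind_some, smul_smul, LinearMap.zero_apply, ← add_smul]
        -- The shifted parity of a product exceeds the sum of the shifted parities by one. This
        -- extra sign makes the two bracketings cancel.
        have : sg k w = - (sg k w₁ * sg k w₂) := by
          rw [sg, spar_mul h, paritySign_add, paritySign_add, paritySign_one, sg, sg]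
          ring
        have h' := sg_mul_self (k := k) w₁
        have e : -sg k w₁ * -sg k w + sg k w₁ * (-sg k w₂ * -sg k w₁) = 0 := by
          rw [this]
          linear_combination (-sg k w₂ + sg k w₂ ) * h'
        rw [e, zero_smul]
  · rw [LinearMap.comp_apply]
    exact map_eq_zero_of_mem (mu k) (fun l' h => arity_mu l' (by omega)) (arity_mu.coder_mem _ l)

theorem tw_mu : Tw (sg k) (-1) (mu k) := by
  have := (graded_mu (k := k) (P := 0) (Q := 0)).tw
  rwa [paritySign_one] at this

theorem coder_mu_comp_self : coder (sg k) (mu k) ∘ₗ coder (sg k) (mu k) = 0 := by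
  rw [coder_comp_self (sg k) sg_mul_self (mu k) (arity_mu [] (by simp)) tw_mu, mu_assoc, coder_zero]

variable (k) in
/-- The Hochschild differential on operators of the given parity. -/
noncomputable def hd (e : ZMod 2) (g : T k Alt →ₗ[k] V k Alt) : T k Alt →ₗ[k] V k Alt :=
  hoch (sg k) (mu k) (paritySign k e) (fun w => paritySign k (e * w.spar)) g

theorem hd_one (g : T k Alt →ₗ[k] V k Alt) : hd k 1 g = hoch (sg k) (mu k) (-1) (sg k) g := by
  simp only [hd, paritySign_one, one_mul]
  rfl

theorem hd_zero (g : T k Alt →ₗ[k] V k Alt) :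
    hd k 0 g = hoch (sg k) (mu k) 1 (fun _ => 1) g := by
  simp only [hd, paritySign_zero, zero_mul]

theorem hd_hd {g : T k Alt →ₗ[k] V k Alt} (h : Graded P Q η g) (hg : g (tensor k []) = 0) :
    hd k (η.1 + 1) (hd k η.1 g) = 0 := by
  have h01 : ∀ c : ZMod 2, c = 0 ∨ c = 1 := by decide
  have ht := h.tw
  rcases h01 η.1 with h' | h'
  · rw [h', zero_add, hd_one, hd_zero]
    rw [h', paritySign_zero] at ht
    have := hoch_hoch arity_mu mu_assoc (one_mul (1 : k)) hg ht (Tw.one _) coder_mu_comp_self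
    simpa using this
  · rw [h', show (1 + 1 : ZMod 2) = 0 by decide, hd_zero, hd_one]
    rw [h', paritySign_one] at ht
    have := hoch_hoch arity_mu mu_assoc (show (-1 : k) * -1 = 1 by ring) hg ht tw_mu
      coder_mu_comp_self
    simpa [sg_mul_self] using this

theorem Graded.hd {g : T k Alt →ₗ[k] V k Alt} (h : Graded P Q η g) (e : ZMod 2) :
    Graded P Q (η + (1, 1)) (hd k e g) := by
  refine Graded.sub ?_ (Graded.smul _ ?_)
  · rw [add_comm]; exact graded_mu.comp_coder h _
  · exact h.comp_coder graded_mu _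

theorem Arity.hd {n : ℕ} {g : T k Alt →ₗ[k] V k Alt} (h : Arity n g) (e : ZMod 2) :
    Arity (n + 1) (hd k e g) := h.hoch arity_mu _ _ _

theorem hd_apply (e : ZMod 2) (g : T k Alt →ₗ[k] V k Alt) (hg : g (tensor k []) = 0)
    {w z : Alt} {x y : List Alt} (h : w :: y = x ++ [z]) :
    hd k e g (tensor k (w :: y)) = g (coder (sg k) (mu k) (tensor k (w :: y)))
      - paritySign k e • (bin (mu k) (g (tensor k x)) (vec k z)
        + paritySign k (e * w.spar) • bin (mu k) (vec k w) (g (tensor k y))) := by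
  rw [hd, hoch_apply, mu_coder_concat arity_mu _ g hg h]

end Rel

end Bar

namespace Bar

open Alt

/-! ### Concatenation with a fixed list -/

section Concatenation

variable {k : Type*} [Field k] {W : Type*}

/-- Concatenate with a list on the left. -/
noncomputable def appL (p : List W) : T k W →ₗ[k] T k W := ofList fun l => tensor k (p ++ l)

/-- Concatenate with a list on the right. -/
noncomputable def appR (q : List W) : T k W →ₗ[k] T k W := ofList fun l => tensor k (l ++ q)

@[simp] theorem appL_tensor (p l : List W) : appL p (tensor k l) = tensor k (p ++ l) := by
  simp [appL]

@[simp] theorem appR_tensor (q l : List W) : appR q (tensor k l) = tensor k (l ++ q) := by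
  simp [appR]

@[simp] theorem appL_nil (t : T k W) : appL [] t = t :=
  LinearMap.congr_fun (f := appL []) (g := LinearMap.id) (T_ext fun l => by simp) t

theorem appL_cons (w : W) (p : List W) (t : T k W) :
    appL (w :: p) t = consL (vec k w) (appL p t) :=
  LinearMap.congr_fun (f := appL (w :: p)) (g := consL (vec k w) ∘ₗ appL p)
    (T_ext fun l => by simp) t

theorem appR_consL (q : List W) (a : V k W) (t : T k W) :
    appR q (consL a t) = consL a (appR q t) := by
  refine LinearMap.congr_fun (f := appR q ∘ₗ consL a) (g := consL a ∘ₗ appR q)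
    (T_ext fun l => ?_) t
  refine LinearMap.congr_fun (f := appR q ∘ₗ consL.flip (tensor k l))
    (g := consL.flip (appR q (tensor k l))) (V_ext fun w => ?_) a
  simp

theorem map_appL_eq_zero (φ : T k W →ₗ[k] V k W) (p : List W)
    (h : ∀ l : List W, φ (tensor k (p ++ l)) = 0) (t : T k W) : φ (appL p t) = 0 :=
  LinearMap.congr_fun (f := φ ∘ₗ appL p) (g := 0) (T_ext fun l => by simp [h]) t

theorem map_appR_eq_zero {S : List W → Prop} (φ : T k W →ₗ[k] V k W) (q : List W)
    (h : ∀ l : List W, S l → φ (tensor k (l ++ q)) = 0) {t : T k W} (ht : t ∈ supp k S) :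
    φ (appR q t) = 0 :=
  map_eq_zero_of_mem (φ ∘ₗ appR q) (fun l hl => by simp [h l hl]) ht

/-- A face merges two neighbours; both lie to the left of the junction, or both to the right, or
they are the two letters at the junction. -/
theorem coder_append {μ : T k W →ₗ[k] V k W} (hμ : Arity 2 μ) (σ : W → k) (p : List W) (w a : W)
    (r : List W) :
    coder σ μ (tensor k (p ++ w :: a :: r)) = appR (a :: r) (coder σ μ (tensor k (p ++ [w])))
      + twL σ (p ++ [w]) • appL (p ++ [w]) (coder σ μ (tensor k (a :: r)))
      + twL σ p • appL p (consL (μ (tensor k [w, a])) (tensor k r)) := by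
  induction p with
  | nil =>
    simp only [List.nil_append]
    rw [coder_cons_cons hμ, coder_single hμ]
    simp [appL_cons]
  | cons v p ih =>
    cases p with
    | nil =>
      simp only [List.nil_append, List.cons_append] at ih ⊢
      rw [coder_cons_cons hμ, ih, coder_cons_cons hμ, coder_single hμ]
      simp only [map_zero, smul_zero, zero_add, twL_cons, twL_nil, mul_one, one_smul, appL_nil,
        appR_consL, appL_cons, appR_tensor, map_add, map_smul, smul_add, smul_smul, List.nil_append]
      abel
    | cons v' p =>
      simp only [List.cons_append] at ih ⊢
      rw [coder_cons_cons hμ, ih, coder_cons_cons hμ σ v v' (p ++ [w])]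
      simp only [twL_cons, appR_consL, appL_cons, appR_tensor, map_add, map_smul, smul_add,
        mul_smul, List.append_assoc, List.cons_append, List.nil_append]
      abel

end Concatenation

/-! ### Reduction to normalized cochains -/

section Normalization

variable {k : Type*} [Field k] {P Q : ZMod 3 → ℚ} {η : ZMod 2 × ℚ}

theorem mu_one_left {i : ZMod 3} {w : Alt} (h : w.tgt = i) :
    mu k (tensor k [one i, w]) = vec k w := by
  rw [mu_pair, mul_one_left h, sg, spar, paritySign_one]
  simp [ovec]

theorem mu_one_right {i : ZMod 3} {w : Alt} (h : w.src = i) :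
    mu k (tensor k [w, one i]) = - sg k w • vec k w := by
  rw [mu_pair, mul_one_right h]
  simp [ovec]

/-- Faces of a list with an identity. -/
theorem coder_mu_one (p r : List Alt) (i j : ZMod 3) (hp : IsPath j p i)
    (hr : ∀ a r', r = a :: r' → a.tgt = i) :
    coder (sg k) (mu k) (tensor k (p ++ one i :: r))
      = appR (one i :: r) (coder (sg k) (mu k) (tensor k p))
        - twL (sg k) p • appL (p ++ [one i]) (coder (sg k) (mu k) (tensor k r))
        + ((if r = [] then 0 else twL (sg k) p • tensor k (p ++ r))
          - (if p = [] then 0 else twL (sg k) p • tensor k (p ++ r))) := by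
  have h1 : sg k (one i) = -1 := paritySign_one k
  have h0 : coder (sg k) (mu k) (tensor k (one i :: r))
      = - consL (vec k (one i)) (coder (sg k) (mu k) (tensor k r))
        + (if r = [] then 0 else tensor k r) := by
    cases r with
    | nil => rw [coder_single arity_mu]; simp
    | cons a r =>
      rw [coder_cons_cons arity_mu, mu_one_left (hr a r rfl), h1]
      simp
  rcases List.eq_nil_or_concat p with rfl | ⟨p, w, rfl⟩
  · simp only [List.nil_append]
    rw [h0]
    simp only [coder_nil, map_zero, twL_nil, one_smul, appL_cons, appL_nil]
    simp only [if_true]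
    abel
  · rw [List.concat_eq_append, List.append_assoc, List.singleton_append, coder_append arity_mu, h0]
    rw [List.concat_eq_append] at hp
    obtain ⟨m, -, hm⟩ := isPath_append.1 hp
    rw [mu_one_right hm.2, if_neg (c := p ++ [w] = []) (by simp)]
    have e : ∀ t : T k Alt, appL (p ++ [w] ++ [one i]) t
        = appL (p ++ [w]) (consL (vec k (one i)) t) := by
      intro t
      refine LinearMap.congr_fun (f := appL (p ++ [w] ++ [one i]))
        (g := appL (p ++ [w]) ∘ₗ consL (vec k (one i))) (T_ext fun l => by simp) t
    rw [e]
    have e2 : appL (p ++ [w]) (if r = [] then 0 else tensor k r)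
        = if r = [] then 0 else tensor k (p ++ [w] ++ r) := by
      split_ifs <;> simp
    simp only [map_add, map_neg, e2, map_smul, LinearMap.smul_apply, consL_vec_tensor, appL_tensor,
      twL_append, twL_cons, twL_nil, mul_one, smul_add, List.append_assoc, List.singleton_append,
      smul_ite, smul_zero]
    split_ifs <;> module

theorem paritySign_sq_smul {M : Type*} [AddCommGroup M] [Module k M] (a : ZMod 2) (x : M) :
    paritySign k a • paritySign k a • x = x := by
  rw [smul_smul, paritySign_mul_self, one_smul]

theorem IsPath.src_unique {l : List Alt} {j j' i i' : ZMod 3} (h : IsPath j l i)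
    (h' : IsPath j' l i') (hne : l ≠ []) : i = i' := by
  induction l generalizing j j' with
  | nil => exact absurd rfl hne
  | cons v l ih =>
    cases l with
    | nil => exact h.2.symm.trans h'.2
    | cons v' l => exact ih h.2 h'.2 (by simp)

theorem bin_one_right {g : T k Alt →ₗ[k] V k Alt} (hg : Graded P Q η g) {l : List Alt}
    {j i : ZMod 3} (hl : IsPath j l i) (hne : l ≠ []) :
    bin (mu k) (g (tensor k l)) (vec k (one i))
      = - (twL (sg k) l * paritySign k η.1) • g (tensor k l) := by
  have key : ∀ (M : V k Alt →ₗ[k] V k Alt),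
      M = -(twL (sg k) l * paritySign k η.1) • LinearMap.id →
      (∀ w, Rel P Q η l [w] → (bin (mu k)).flip (vec k (one i)) (vec k w) = M (vec k w)) →
      (bin (mu k)).flip (vec k (one i)) (g (tensor k l)) = M (g (tensor k l)) :=
    fun M _ h => map_eq_of_supp _ M h (hg l)
  refine (key _ rfl ?_).trans rfl
  intro w hw
  have hsrc : w.src = i := hw.isPath.src_unique hl hne
  have hpar := hw.2.1
  simp only [lpar_cons, lpar_nil, add_zero] at hpar
  change bin (mu k) (vec k w) (vec k (one i)) = -(twL (sg k) l * paritySign k η.1) • vec k w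
  rw [bin_vec, mu_one_right hsrc, sg, hpar, twL_sg, paritySign_add]

theorem bin_one_left {g : T k Alt →ₗ[k] V k Alt} (hg : Graded P Q η g) {l : List Alt}
    {a : Alt} (hl : a.tgt = i) :
    bin (mu k) (vec k (one i)) (g (tensor k (a :: l))) = g (tensor k (a :: l)) := by
  refine map_eq_of_supp (S := fun w => Rel P Q η (a :: l) [w]) (bin (mu k) (vec k (one i)))
    LinearMap.id (fun w hw => ?_) (hg (a :: l))
  change bin (mu k) (vec k (one i)) (vec k w) = vec k w
  have := hw.isPath
  rw [bin_vec, mu_one_left (this.1.symm.trans hl)]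

variable (k) in
/-- The left outer face of a list with an identity. -/
noncomputable def leftFace (e : ZMod 2) (g : T k Alt →ₗ[k] V k Alt) : List Alt → List Alt → V k Alt
  | [], _ => 0
  | w :: p, q => paritySign k (e * w.spar) • bin (mu k) (vec k w) (g (tensor k (p ++ q)))

variable (k) in
/-- The right outer face of a list with an identity. -/
noncomputable def rightFace (g : T k Alt →ₗ[k] V k Alt) (p r : List Alt) : V k Alt :=
  r.getLast?.elim 0 fun z => bin (mu k) (g (tensor k (p ++ r.dropLast))) (vec k z)

/-- The Hochschild differential on a list with an identity. -/
theorem hd_one_apply {g : T k Alt →ₗ[k] V k Alt} (hg : Graded P Q η g)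
    (hg0 : g (tensor k []) = 0) {p r : List Alt} {i j j' : ZMod 3}
    (hpath : IsPath j (p ++ one i :: r) j') (hne : p ++ r ≠ []) :
    hd k η.1 g (tensor k (p ++ one i :: r))
      = g (appR (one i :: r) (coder (sg k) (mu k) (tensor k p)))
        - twL (sg k) p • g (appL (p ++ [one i]) (coder (sg k) (mu k) (tensor k r)))
        - paritySign k η.1 • leftFace k η.1 g p (one i :: r)
        - paritySign k η.1 • rightFace k g (p ++ [one i]) r := by
  obtain ⟨m, hp, hm⟩ := isPath_append.1 hpath
  obtain ⟨rfl, hr⟩ := hm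
  have hr' : ∀ a r', r = a :: r' → a.tgt = i := by
    rintro a r' rfl
    exact hr.1
  change IsPath j p i at hp
  change IsPath i r j' at hr
  have hspar : (one i).spar = 1 := rfl
  have hD := coder_mu_one (k := k) p r i j hp hr'
  -- The two faces that absorb the identity cancel. If the identity stands at one end of the list,
  -- an outer face replaces the missing inner one, with the sign that again makes them cancel. The
  -- remaining faces all still contain the identity.
  rcases p with _ | ⟨w, p⟩
  · rcases List.eq_nil_or_concat r with rfl | ⟨r', z, rfl⟩
    · simp at hne
    · rw [List.concat_eq_append] at *
      rw [List.nil_append] at hD ⊢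
      rw [hd_apply η.1 g hg0 (x := one i :: r') (z := z) (by simp), hD]
      obtain ⟨a, q, hq⟩ : ∃ a q, r' ++ [z] = a :: q := by
        cases r' with
        | nil => exact ⟨z, [], rfl⟩
        | cons a r' => exact ⟨a, r' ++ [z], rfl⟩
      have e : bin (mu k) (vec k (one i)) (g (tensor k (r' ++ [z]))) = g (tensor k (r' ++ [z])) := by
        rw [hq]; exact bin_one_left hg (hr' a q hq)
      rw [e, hspar, mul_one, smul_add, paritySign_sq_smul]
      simp only [leftFace, rightFace, List.getLast?_append, List.getLast?_singleton,
        List.dropLast_concat, map_sub, map_add, List.nil_append, List.singleton_append,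
        twL_nil, one_smul, Option.some_or, Option.elim_some, smul_zero]
      simp only [if_true, List.append_eq_nil_iff, List.cons_ne_nil, and_false, if_false, map_zero]
      abel
  · rcases List.eq_nil_or_concat r with rfl | ⟨r', z, rfl⟩
    · rw [List.cons_append] at hD ⊢
      rw [hd_apply η.1 g hg0 (x := w :: p) (z := one i) (by simp), hD, bin_one_right hg hp (by simp),
        smul_add, smul_smul]
      have e : paritySign k η.1 * -(twL (sg k) (w :: p) * paritySign k η.1)
          = - twL (sg k) (w :: p) := by
        linear_combination (- twL (sg k) (w :: p)) * paritySign_mul_self k η.1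
      rw [e]
      simp only [leftFace, rightFace, List.getLast?_nil, Option.elim_none, smul_zero, map_sub,
        map_add, List.append_nil, coder_nil, map_zero]
      simp only [if_true, List.cons_ne_nil, if_false, map_smul, map_zero]
      module
    · rw [List.concat_eq_append] at *
      rw [List.cons_append] at hD ⊢
      rw [hd_apply η.1 g hg0 (x := w :: p ++ one i :: r') (z := z) (by simp), hD]
      simp only [leftFace, rightFace, List.getLast?_append, List.getLast?_singleton,
        List.dropLast_concat, map_sub, map_add, map_smul, List.append_assoc, List.cons_append,
        List.nil_append, Option.some_or, Option.elim_some]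
      simp only [List.append_eq_nil_iff, List.cons_ne_nil, and_false, if_false, map_smul]
      module

/-- The operator vanishes on lists with an identity in one of the first `j` places. -/
def VanishOne (j : ℕ) (c : T k Alt →ₗ[k] V k Alt) : Prop :=
  ∀ p i r, p.length < j → c (tensor k (p ++ one i :: r)) = 0

variable (k) in
/-- Insert an identity after the first `j` entries. -/
noncomputable def insertOne (j N : ℕ) (c : T k Alt →ₗ[k] V k Alt) : T k Alt →ₗ[k] V k Alt :=
  ofList fun l => if l.length = N then
    - twL (sg k) (l.take j) • ∑ i, c (tensor k (l.take j ++ one i :: l.drop j)) else 0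

theorem arity_insertOne (j N : ℕ) (c : T k Alt →ₗ[k] V k Alt) : Arity N (insertOne k j N c) := by
  intro l hl
  simp [insertOne, hl]

theorem Graded.insertOne {c : T k Alt →ₗ[k] V k Alt} (hc : Graded P Q (η + (1, 1)) c) (j N : ℕ) :
    Graded P Q η (insertOne k j N c) := by
  intro l
  rw [Bar.insertOne, ofList_tensor]
  split_ifs with hl
  swap
  · exact Submodule.zero_mem _
  refine Submodule.smul_mem _ _ (Submodule.sum_mem _ fun i _ => supp_mono (fun w hw => ?_) (hc _))
  refine ⟨fun a b hab => ?_, ?_, ?_⟩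
  · obtain ⟨m, h₁, h₂⟩ := isPath_append.1 (hw.1 a b hab)
    obtain ⟨rfl, h₂⟩ := h₂
    rw [← List.take_append_drop j l]
    exact isPath_append.2 ⟨_, h₁, h₂⟩
  · rw [hw.2.1]
    conv_rhs => rw [← List.take_append_drop j l]
    simp only [lpar_append, lpar_cons, spar, Prod.fst_add]
    have h2 : (1 + 1 : ZMod 2) = 0 := by decide
    linear_combination h2
  · rw [hw.2.2]
    conv_rhs => rw [← List.take_append_drop j l]
    simp only [ldeg_append, ldeg_cons, sdeg, Prod.snd_add]
    ring

theorem insertOne_of_lt {c : T k Alt →ₗ[k] V k Alt} {j : ℕ} (hc : VanishOne j c) (N : ℕ)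
    {p r : List Alt} {i : ZMod 3} (hp : p.length < j) :
    insertOne k j N c (tensor k (p ++ one i :: r)) = 0 := by
  rw [insertOne, ofList_tensor]
  split_ifs with hl
  swap
  · rfl
  obtain ⟨m, hm⟩ : ∃ m, j = p.length + (m + 1) := ⟨j - p.length - 1, by omega⟩
  have e : (p ++ one i :: r).take j = p ++ one i :: r.take m := by
    rw [hm, List.take_length_add_append, List.take_succ_cons]
  rw [e, Finset.sum_eq_zero, smul_zero]
  intro i' _
  rw [List.append_assoc, List.cons_append]
  exact hc _ _ _ hp

/-- Of all identities in the sum only the one at the right object gives a composable list, so the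
insertion doubles the identity that is already there. -/
theorem insertOne_of_eq {c : T k Alt →ₗ[k] V k Alt} {j N : ℕ} (hc : Graded P Q η c)
    (hN : Arity (N + 1) c) {p r : List Alt} {i : ZMod 3} (hp : p.length = j) :
    insertOne k j N c (tensor k (p ++ one i :: r))
      = - twL (sg k) p • c (tensor k (p ++ one i :: one i :: r)) := by
  rw [insertOne, ofList_tensor]
  split_ifs with hl
  swap
  · rw [hN _ (by simp at hl ⊢; omega), smul_zero]
  rw [← hp, List.take_left, List.drop_left, Finset.sum_eq_single i]
  · intro i' _ hi
    refine hc.eq_zero fun a b h => hi ?_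
    obtain ⟨m, h₁, h₂⟩ := isPath_append.1 h
    exact h₂.2.1.symm
  · simp

/-- One step of the normalization. -/
theorem normalize_step {c : T k Alt →ₗ[k] V k Alt} (hc : Graded P Q (η + (1, 1)) c) {N j : ℕ}
    (hN : Arity (N + 1) c) (hN1 : 1 ≤ N) (hcoc : hd k (η + (1, 1)).1 c = 0)
    (hv : VanishOne j c) :
    VanishOne (j + 1) (c - hd k η.1 (insertOne k j N c)) := by
  intro p i r hp
  set h := insertOne k j N c with hh
  have hgr : Graded P Q η h := hc.insertOne j N
  have har : Arity N h := arity_insertOne j N c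
  have hh0 : h (tensor k []) = 0 := har [] (by simp; omega)
  have hc0 : c (tensor k []) = 0 := hN [] (by simp)
  by_cases hlen : (p ++ one i :: r).length = N + 1
  swap
  · rw [LinearMap.sub_apply, hN _ hlen, har.hd η.1 _ hlen, sub_zero]
  by_cases hpath : ∃ a b, IsPath a (p ++ one i :: r) b
  swap
  · push Not at hpath
    exact (hc.sub (hgr.hd _)).eq_zero hpath
  obtain ⟨a, b, hpath⟩ := hpath
  have hne : p ++ r ≠ [] := by
    intro h0
    rw [List.append_eq_nil_iff] at h0
    rw [h0.1, h0.2] at hlen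
    simp at hlen
    omega
  have hface : ∀ q : List Alt, q.length + 2 = p.length + 1 →
      h (tensor k (q ++ one i :: r)) = 0 := fun q hq => insertOne_of_lt hv N (by omega)
  have e₁ : h (appR (one i :: r) (coder (sg k) (mu k) (tensor k p))) = 0 :=
    map_appR_eq_zero h _ hface (arity_mu.coder_mem _ p)
  have e₂ : leftFace k η.1 h p (one i :: r) = 0 := by
    cases p with
    | nil => rfl
    | cons w p =>
      rw [leftFace, hface p (by simp)]
      simp
  rw [LinearMap.sub_apply, hd_one_apply hgr hh0 hpath hne, e₁, e₂]
  -- For an identity in one of the first `j` places both `c` and all faces of `h` vanish already.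
  -- The new case is an identity exactly in place `j`.
  rcases Nat.lt_or_ge p.length j with hpj | hpj
  · have e₃ : h (appL (p ++ [one i]) (coder (sg k) (mu k) (tensor k r))) = 0 :=
      map_appL_eq_zero h _ (fun l => by
        rw [List.append_assoc]; exact insertOne_of_lt hv N hpj) _
    have e₄ : rightFace k h (p ++ [one i]) r = 0 := by
      rw [rightFace]
      cases r.getLast? with
      | none => rfl
      | some z =>
        rw [Option.elim_some, List.append_assoc]
        rw [show h (tensor k (p ++ ([one i] ++ r.dropLast))) = 0 from insertOne_of_lt hv N hpj]
        simp
    rw [hv p i r hpj, e₃, e₄]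
    simp
  · have hpj' : p.length = j := by omega
    have hB : ∀ r', h (tensor k (p ++ [one i] ++ r'))
        = - twL (sg k) p • c (tensor k (p ++ one i :: one i :: r')) := by
      intro r'
      rw [List.append_assoc]
      exact insertOne_of_eq hc hN hpj'
    have hpath' : IsPath a (p ++ one i :: (one i :: r)) b := by
      obtain ⟨m, h₁, h₂⟩ := isPath_append.1 hpath
      exact isPath_append.2 ⟨m, h₁, h₂.1, rfl, h₂.2⟩
    -- The cocycle equation at the list with the identity doubled expresses `c` at the original list
    -- through faces to the right of the identities. These are the faces of `h` up to the sign of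
    -- `p`.
    have hco := hd_one_apply hc hc0 hpath' (by simp)
    have hcface : ∀ q : List Alt, q.length + 2 = p.length + 1 → ∀ r',
        c (tensor k (q ++ one i :: r')) = 0 := fun q hq r' => hv _ _ _ (by omega)
    have f₁ : c (appR (one i :: one i :: r) (coder (sg k) (mu k) (tensor k p))) = 0 :=
      map_appR_eq_zero c _ (fun q hq => hcface q hq _) (arity_mu.coder_mem _ p)
    have f₂ : leftFace k (η + (1, 1)).1 c p (one i :: one i :: r) = 0 := by
      cases p with
      | nil => rfl
      | cons w p =>
        rw [leftFace, hcface p (by simp)]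
        simp
    have hs : paritySign k (η + (1, 1)).1 = - paritySign k η.1 := by
      rw [Prod.fst_add, paritySign_add, paritySign_one]; ring
    rw [f₁, f₂, hcoc, hs] at hco
    have hp2 : twL (sg k) p * twL (sg k) p = 1 := by rw [twL_sg, paritySign_mul_self]
    have hr' : ∀ a r', r = a :: r' → a.tgt = i := by
      rintro a r' rfl
      obtain ⟨m, h₁, h₂⟩ := isPath_append.1 hpath
      exact h₂.2.1
    -- If nothing follows the identity, the cocycle equation at `p, 1, 1` reduces to the right outer
    -- face, which is `c (p, 1)` up to sign. So `c` vanishes there without any correction.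
    rcases List.eq_nil_or_concat r with rfl | ⟨r', z, rfl⟩
    · rw [coder_single arity_mu] at hco
      simp only [rightFace, List.getLast?_singleton, Option.elim_some, List.dropLast_singleton,
        List.append_nil, map_zero, smul_zero, LinearMap.zero_apply, sub_zero, zero_sub] at hco
      have hpath₁ : IsPath a (p ++ [one i]) i := by
        obtain ⟨m, h₁, h₂⟩ := isPath_append.1 hpath
        exact isPath_append.2 ⟨m, h₁, h₂.1, rfl⟩
      rw [bin_one_right hc hpath₁ (by simp), hs] at hco
      have hz : c (tensor k (p ++ [one i])) = 0 := by
        have t₁ : ∀ x : ZMod 2, paritySign k x ≠ 0 := fun x hx => by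
          have := paritySign_mul_self k x
          rw [hx] at this
          simp at this
        rw [twL_sg] at hco
        simpa [t₁] using hco.symm
      rw [hz]
      simp [rightFace]
    · rw [List.concat_eq_append] at *
      have hD := coder_mu_one (k := k) [] (r' ++ [z]) i i rfl hr'
      simp only [List.nil_append] at hD
      rw [hD] at hco
      have g₁ : h (appL (p ++ [one i]) (coder (sg k) (mu k) (tensor k (r' ++ [z]))))
          = - twL (sg k) p • c (appL (p ++ [one i]) (appL [one i]
            (coder (sg k) (mu k) (tensor k (r' ++ [z]))))) := by
        refine LinearMap.congr_fun (f := h ∘ₗ appL (p ++ [one i]))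
          (g := - twL (sg k) p • (c ∘ₗ appL (p ++ [one i]) ∘ₗ appL [one i]))
          (T_ext fun l => ?_) _
        simp only [LinearMap.comp_apply, LinearMap.smul_apply, appL_tensor, hB]
        simp
      have g₂ : rightFace k h (p ++ [one i]) (r' ++ [z])
          = - twL (sg k) p • rightFace k c (p ++ [one i]) (one i :: (r' ++ [z])) := by
        simp only [rightFace, List.getLast?_append, List.getLast?_cons,
          List.dropLast_concat, Option.some_or, Option.elim_some, Option.getD_some]
        rw [hB, ← List.cons_append, List.dropLast_concat]
        simp
      rw [g₁, g₂]
      simp only [coder_nil, map_zero, twL_nil, one_smul, map_add, appL_tensor,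
        LinearMap.zero_apply, if_true, List.append_eq_nil_iff, List.cons_ne_nil, and_false, if_false,
        sub_zero, zero_sub, smul_zero, smul_add, map_neg] at hco ⊢
      set X := c (appL (p ++ [one i]) (appL [one i] (coder (sg k) (mu k) (tensor k (r' ++ [z])))))
      set Y := rightFace k c (p ++ [one i]) (one i :: (r' ++ [z]))
      have e5 : p ++ [one i] ++ (r' ++ [z]) = p ++ one i :: (r' ++ [z]) := by simp
      rw [e5] at hco
      set Z := c (tensor k (p ++ one i :: (r' ++ [z])))
      linear_combination (norm := module) twL (sg k) p • hco - hp2 • Z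

end Normalization

end Bar

namespace Bar

open Alt

/-! ### Reduction to chains of equal letters -/

section Koszul

variable {k : Type*} [Field k] {P Q : ZMod 3 → ℚ} {η : ZMod 2 × ℚ} {N : ℕ}

/-- Homogeneous Hochschild cocycles. -/
structure IsCoc (P Q : ZMod 3 → ℚ) (η : ZMod 2 × ℚ) (N : ℕ) (c : T k Alt →ₗ[k] V k Alt) : Prop where
  graded : Graded P Q (η + (1, 1)) c
  arity : Arity (N + 1) c
  closed : hd k (η + (1, 1)).1 c = 0

theorem IsCoc.sub_hd {c h : T k Alt →ₗ[k] V k Alt} (hc : IsCoc P Q η N c) (hN : 1 ≤ N)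
    (hh : Graded P Q η h) (hN' : Arity N h) : IsCoc P Q η N (c - hd k η.1 h) where
  graded := hc.graded.sub (hh.hd _)
  arity l hl := by rw [LinearMap.sub_apply, hc.arity l hl, hN'.hd _ l hl, sub_zero]
  closed := by
    have h1 := hd_hd hh (hN' [] (by simp; omega))
    have h2 := hc.closed
    rw [hd, hoch_sub]
    change hd k (η.1 + 1) c - hd k (η.1 + 1) (hd k η.1 h) = 0
    rw [h1, show hd k (η.1 + 1) c = 0 from h2]
    ext
    simp

theorem hd_add (e : ZMod 2) (g h : T k Alt →ₗ[k] V k Alt) : hd k e (g + h) = hd k e g + hd k e h :=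
  hoch_add _ _ _ _ _ _

theorem hd_zero_apply (e : ZMod 2) : hd k e (0 : T k Alt →ₗ[k] V k Alt) = 0 := by
  refine LinearMap.ext fun t => ?_
  rw [hd, hoch_apply, coder_zero]
  simp

/-- The operator vanishes on lists with an identity. -/
def Normalized (c : T k Alt →ₗ[k] V k Alt) : Prop :=
  ∀ l i, one i ∈ l → c (tensor k l) = 0

/-- The identities are removed place by place from the left with `normalize_step`, and the
corrections are added up. -/
theorem exists_normalized {c : T k Alt →ₗ[k] V k Alt} (hc : IsCoc P Q η N c) (hN : 1 ≤ N) :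
    ∃ h, Graded P Q η h ∧ Arity N h ∧ Normalized (c - hd k η.1 h) := by
  have key : ∀ j, ∃ h, Graded P Q η h ∧ Arity N h ∧ VanishOne j (c - hd k η.1 h) := by
    intro j
    induction j with
    | zero => exact ⟨0, fun l => Submodule.zero_mem _, fun _ _ => rfl, fun p i r hp => by simp at hp⟩
    | succ j ih =>
      obtain ⟨h, h₁, h₂, h₃⟩ := ih
      have hc' := hc.sub_hd hN h₁ h₂
      refine ⟨h + insertOne k j N (c - hd k η.1 h), h₁.add (hc'.graded.insertOne j N),
        fun l hl => by rw [LinearMap.add_apply, h₂ l hl, arity_insertOne j N _ l hl, add_zero], ?_⟩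
      have := normalize_step hc'.graded hc'.arity hN hc'.closed h₃
      intro p i r hp
      have h4 := this p i r hp
      rw [hd_add]
      simp only [LinearMap.sub_apply, LinearMap.add_apply] at h4 ⊢
      rw [← h4]
      abel
  -- A cochain of arity `N + 1` has `N + 1` places, so all of them are covered.
  obtain ⟨h, h₁, h₂, h₃⟩ := key (N + 1)
  refine ⟨h, h₁, h₂, fun l i hi => ?_⟩
  by_cases hl : l.length = N + 1
  · obtain ⟨p, r, rfl⟩ := List.append_of_mem hi
    exact h₃ p i r (by simp at hl; omega)
  · exact (hc.sub_hd hN h₁ h₂).arity l hl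

/-- By `hd_one_apply` the faces which absorb the identity cancel, and every other face still
contains it. -/
theorem Normalized.hd {h : T k Alt →ₗ[k] V k Alt} (hh : Normalized h) (hgr : Graded P Q η h)
    (hN : 1 ≤ N) (har : Arity N h) : Normalized (hd k η.1 h) := by
  intro l i hi
  by_cases hl : l.length = N + 1
  swap
  · exact har.hd _ l hl
  by_cases hpath : ∃ a b, IsPath a l b
  swap
  · push Not at hpath
    exact (hgr.hd η.1).eq_zero hpath
  obtain ⟨a, b, hpath⟩ := hpath
  obtain ⟨p, r, rfl⟩ := List.append_of_mem hi
  have hne : p ++ r ≠ [] := by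
    intro h0
    rw [List.append_eq_nil_iff] at h0
    rw [h0.1, h0.2] at hl
    simp at hl
    omega
  have hh0 : h (tensor k []) = 0 := har [] (by simp; omega)
  have e₁ : h (appR (one i :: r) (coder (sg k) (mu k) (tensor k p))) = 0 :=
    map_appR_eq_zero (S := fun _ => True) h _ (fun l _ => hh _ i (by simp)) (mem_supp_true _)
  have e₂ : h (appL (p ++ [one i]) (coder (sg k) (mu k) (tensor k r))) = 0 :=
    map_appL_eq_zero h _ (fun l => hh _ i (by simp)) _
  have e₃ : leftFace k η.1 h p (one i :: r) = 0 := by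
    cases p with
    | nil => rfl
    | cons w p =>
      rw [leftFace, hh _ i (by simp)]
      simp
  have e₄ : rightFace k h (p ++ [one i]) r = 0 := by
    rw [rightFace]
    cases r.getLast? with
    | none => rfl
    | some z =>
      rw [Option.elim_some, hh _ i (by simp)]
      simp
  rw [hd_one_apply hgr hh0 hpath hne, e₁, e₂, e₃, e₄]
  simp

/-- Chains of generators of the same type. -/
def K (e : Bool) : ZMod 3 → ℕ → List Alt
  | _, 0 => []
  | t, n + 1 => alt t e 0 :: K e (t + dir e) n

@[simp] theorem K_zero (e : Bool) (t : ZMod 3) : K e t 0 = [] := rfl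
theorem K_succ (e : Bool) (t : ZMod 3) (n : ℕ) :
    K e t (n + 1) = alt t e 0 :: K e (t + dir e) n := rfl

theorem K_succ' (e : Bool) (t : ZMod 3) (n : ℕ) :
    K e t (n + 1) = K e t n ++ [alt (t + n * dir e) e 0] := by
  induction n generalizing t with
  | zero => simp [K_succ]
  | succ n ih =>
    rw [K_succ, ih, K_succ e t n, List.cons_append]
    push_cast
    rw [show t + dir e + n * dir e = t + (n + 1) * dir e by ring]

@[simp] theorem length_K (e : Bool) (t : ZMod 3) (n : ℕ) : (K e t n).length = n := by
  induction n generalizing t with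
  | zero => rfl
  | succ n ih => simp [K_succ, ih]

theorem one_notMem_K (e : Bool) (t : ZMod 3) (n : ℕ) (i : ZMod 3) : one i ∉ K e t n := by
  induction n generalizing t with
  | zero => simp
  | succ n ih => simp [K_succ, ih]

theorem isPath_K {e : Bool} {t : ZMod 3} {n : ℕ} {j i : ZMod 3} :
    IsPath j (K e t (n + 1)) i ↔ j = t ∧ i = t + (n + 1) * dir e := by
  induction n generalizing t j with
  | zero =>
    simp only [K_succ, K_zero, IsPath, src, tgt]
    simp only [if_true, Nat.cast_zero, zero_add, one_mul]
    exact ⟨fun h => ⟨h.1.symm, h.2.symm⟩, fun h => ⟨h.1.symm, h.2.symm⟩⟩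
  | succ n ih =>
    rw [K_succ]
    simp only [IsPath, ih]
    simp only [src, tgt, Nat.zero_mod, if_true, true_and]
    push_cast
    rw [show t + dir e + (n + 1) * dir e = t + (n + 1 + 1) * dir e by ring]
    exact ⟨fun h => ⟨h.1.symm, h.2⟩, fun h => ⟨h.1.symm, h.2⟩⟩

theorem sg_gen (t : ZMod 3) (e : Bool) : sg k (alt t e 0) = 1 := by
  simp [sg, spar, paritySign]

theorem twL_K (e : Bool) (t : ZMod 3) (n : ℕ) : twL (sg k) (K e t n) = 1 := by
  induction n generalizing t with
  | zero => rfl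
  | succ n ih => rw [K_succ, twL_cons, ih, sg_gen, one_mul]

theorem mu_gen_gen (t t' : ZMod 3) (e : Bool) :
    mu k (tensor k [alt t e 0, alt t' e 0]) = 0 := by
  rw [mu_pair]
  simp [mul, nxt, ovec]

theorem mul_gen (t : ZMod 3) (e : Bool) (n : ℕ) :
    mul (alt t e 0) (alt (t + dir e) (!e) n) = some (alt t e (n + 1)) := by
  simp [mul, src, nxt]

theorem mu_gen (t : ZMod 3) (e : Bool) (n : ℕ) :
    mu k (tensor k [alt t e 0, alt (t + dir e) (!e) n]) = - vec k (alt t e (n + 1)) := by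
  rw [mu_pair, mul_gen, sg_gen]
  simp [ovec]

/-- Neighbours in such a chain are of the same type and compose to zero. So these chains have no
inner faces, and they represent the Koszul dual inside the bar complex. -/
theorem coder_K (e : Bool) (t : ZMod 3) (n : ℕ) :
    coder (sg k) (mu k) (tensor k (K e t n)) = 0 := by
  induction n generalizing t with
  | zero => exact coder_nil _ _
  | succ n ih =>
    cases n with
    | zero => exact coder_single arity_mu _ _
    | succ n =>
      have := ih (t + dir e)
      rw [K_succ] at this
      rw [K_succ, K_succ, coder_cons_cons arity_mu, this, mu_gen_gen]
      simp

theorem coder_K_append (e : Bool) (t : ZMod 3) (n : ℕ) (a : Alt) (r : List Alt) :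
    coder (sg k) (mu k) (tensor k (K e t (n + 1) ++ a :: r))
      = appL (K e t (n + 1)) (coder (sg k) (mu k) (tensor k (a :: r)))
        + appL (K e t n) (consL (mu k (tensor k [alt (t + n * dir e) e 0, a])) (tensor k r)) := by
  have h : K e t (n + 1) ++ a :: r = K e t n ++ alt (t + n * dir e) e 0 :: a :: r := by
    rw [K_succ']; simp
  rw [h, coder_append arity_mu, ← K_succ', coder_K, twL_K, twL_K]
  simp

/-- The inner faces within the chain vanish. What remains are the faces within `a :: r`, the one
that merges the end of the chain with `a`, and the two outer faces. -/
theorem hd_K_append (e : ZMod 2) (g : T k Alt →ₗ[k] V k Alt) (hg : g (tensor k []) = 0)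
    (e' : Bool) (t : ZMod 3) (n : ℕ) (a : Alt) (r : List Alt) :
    hd k e g (tensor k (K e' t (n + 1) ++ a :: r))
      = g (appL (K e' t (n + 1)) (coder (sg k) (mu k) (tensor k (a :: r))))
        + g (appL (K e' t n) (consL (mu k (tensor k [alt (t + n * dir e') e' 0, a])) (tensor k r)))
        - paritySign k e • (rightFace k g (K e' t (n + 1)) (a :: r)
          + bin (mu k) (vec k (alt t e' 0)) (g (tensor k (K e' (t + dir e') n ++ a :: r)))) := by
  have hD := coder_K_append (k := k) e' t n a r
  obtain ⟨x, z, hxz⟩ : ∃ x z, a :: r = x ++ [z] := by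
    rcases List.eq_nil_or_concat (a :: r) with h | ⟨x, z, h⟩
    · simp at h
    · exact ⟨x, z, by rw [h, List.concat_eq_append]⟩
  have hrf : rightFace k g (K e' t (n + 1)) (a :: r)
      = bin (mu k) (g (tensor k (K e' t (n + 1) ++ x))) (vec k z) := by
    rw [hxz, rightFace]
    simp
  rw [hrf, ← map_add, ← hD]
  have hs : paritySign k (e * (alt t e' 0).spar) = 1 := by simp [spar, paritySign]
  have := hd_apply e g hg (w := alt t e' 0) (y := K e' (t + dir e') n ++ a :: r)
    (x := K e' t (n + 1) ++ x) (z := z) (by rw [hxz, ← List.append_assoc]; rfl)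
  rw [hs, one_smul] at this
  exact this

theorem hd_K (e : ZMod 2) (g : T k Alt →ₗ[k] V k Alt) (hg : g (tensor k []) = 0)
    (e' : Bool) (t : ZMod 3) (n : ℕ) :
    hd k e g (tensor k (K e' t (n + 1)))
      = - paritySign k e • (bin (mu k) (g (tensor k (K e' t n))) (vec k (alt (t + n * dir e') e' 0))
          + bin (mu k) (vec k (alt t e' 0)) (g (tensor k (K e' (t + dir e') n)))) := by
  have hs : paritySign k (e * (alt t e' 0).spar) = 1 := by simp [spar, paritySign]
  have := hd_apply e g hg (w := alt t e' 0) (y := K e' (t + dir e') n)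
    (x := K e' t n) (z := alt (t + n * dir e') e' 0) (by rw [← K_succ, K_succ'])
  rw [← K_succ, coder_K, hs, one_smul, map_zero, zero_sub, ← neg_smul] at this
  exact this

/-- The operator vanishes on lists which start with a chain of `j` generators. -/
def VanishK (j : ℕ) (c : T k Alt →ₗ[k] V k Alt) : Prop :=
  ∀ e t r, c (tensor k (K e t j ++ r)) = 0

theorem VanishK.rightFace {j : ℕ} {g : T k Alt →ₗ[k] V k Alt} (hg : VanishK j g) (e : Bool)
    (t : ZMod 3) (r : List Alt) : rightFace k g (K e t j) r = 0 := by
  rw [Bar.rightFace]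
  cases r.getLast? with
  | none => rfl
  | some z => rw [Option.elim_some, hg]; simp

theorem K_append_cons (e : Bool) (t : ZMod 3) (n : ℕ) (r : List Alt) :
    K e t n ++ alt (t + n * dir e) e 0 :: r = K e t (n + 1) ++ r := by
  rw [K_succ']; simp

/-- One step in the reduction to chains of generators. -/
theorem koszul_step {c h : T k Alt →ₗ[k] V k Alt} (hc : IsCoc P Q η N c) {j : ℕ} (hN : j + 1 ≤ N)
    (hcn : Normalized c) (hcv : VanishK (j + 2) c) (hgr : Graded P Q η h) (har : Arity N h)
    (hhn : Normalized h) (hhv : VanishK (j + 1) h)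
    (hh : ∀ e t n r, h (tensor k (K e t j ++ alt (t + j * dir e) e (n + 1) :: r))
      = - c (tensor k (K e t (j + 1) ++ alt (t + (j + 1) * dir e) (!e) n :: r))
        - paritySign k η.1 • bin (mu k) (vec k (alt t e 0))
          (h (tensor k (K e (t + dir e) j ++ alt (t + (j + 1) * dir e) (!e) n :: r)))) :
    VanishK (j + 1) (c - hd k η.1 h) := by
  have hh0 : h (tensor k []) = 0 := har [] (by simp; omega)
  have hc' := hc.sub_hd (by omega) hgr har
  have hn' : Normalized (c - hd k η.1 h) := fun l i hi => by
    rw [LinearMap.sub_apply, hcn l i hi, hhn.hd hgr (by omega) har l i hi, sub_zero]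
  have hc0' : (c - hd k η.1 h) (tensor k []) = 0 := hc'.arity [] (by simp)
  -- Next entry of the opposite type: it merges with the end of the chain into a longer word. The
  -- recursion `hh` is this equation solved for the value of `h` at the merged list; the other faces
  -- of `h` start with a chain of `j + 1` letters.
  have caseD : ∀ e t n r, (c - hd k η.1 h)
      (tensor k (K e t (j + 1) ++ alt (t + (j + 1) * dir e) (!e) n :: r)) = 0 := by
    intro e t n r
    have e1 := hh e t n r
    have hm := mu_gen (k := k) (t + j * dir e) e n
    rw [show t + (j : ZMod 3) * dir e + dir e = t + (j + 1) * dir e by ring] at hm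
    rw [LinearMap.sub_apply, hd_K_append _ h hh0, hm, hhv.rightFace,
      map_appL_eq_zero h _ (hhv e t)]
    simp only [map_neg, LinearMap.neg_apply, consL_vec_tensor, appL_tensor]
    rw [e1]
    module
  -- Next entry a generator of the same type: the correction does not spoil what has been achieved
  -- for longer chains.
  have caseB : VanishK (j + 2) (c - hd k η.1 h) := by
    intro e t r
    have e1 : K e t (j + 2) ++ r = K e t (j + 1) ++ alt (t + (j + 1) * dir e) e 0 :: r := by
      rw [← Nat.cast_add_one, K_append_cons]
    have e2 : K e (t + dir e) j ++ alt (t + (j + 1) * dir e) e 0 :: r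
        = K e (t + dir e) (j + 1) ++ r := by
      rw [← K_append_cons, show t + dir e + (j : ZMod 3) * dir e = t + (j + 1) * dir e by ring]
    rw [LinearMap.sub_apply, hcv, e1, hd_K_append _ h hh0, hhv.rightFace,
      map_appL_eq_zero h _ (hhv e t), mu_gen_gen, e2, hhv]
    simp
  intro e t r
  cases r with
  | nil => exact hc'.arity _ (by simp; omega)
  | cons a r =>
  cases a with
  | one i => exact hn' _ i (by simp)
  | alt t' e' n =>
  by_cases hpath : ∃ a b, IsPath a (K e t (j + 1) ++ alt t' e' n :: r) b
  swap
  · push Not at hpath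
    exact hc'.graded.eq_zero hpath
  obtain ⟨a, b, hpath⟩ := hpath
  obtain ⟨m, h₁, h₂⟩ := isPath_append.1 hpath
  obtain ⟨-, rfl⟩ := isPath_K.1 h₁
  have ht' : t' = t + (j + 1) * dir e := h₂.1
  subst ht'
  rcases Bool.eq_or_eq_not e' e with rfl | rfl
  · cases n with
    | zero =>
      rw [← Nat.cast_add_one, K_append_cons]
      exact caseB _ _ _
    | succ n =>
      -- Next entry of the same type with more than one letter: its first letter is split off and
      -- joins the chain. In the cocycle equation at this list `caseB` and `caseD` kill everything
      -- except the face which merges the letter back.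
      have e1 := hd_K_append (η + (1, 1)).1 _ hc0' e' t (j + 1)
        (alt (t + (j + 1) * dir e' + dir e') (!e') n) r
      rw [hc'.closed, caseB.rightFace, map_appL_eq_zero _ _ (caseB e' t), Nat.cast_add_one,
        mu_gen, LinearMap.zero_apply] at e1
      have e2 := caseD e' (t + dir e') n r
      rw [show t + dir e' + ((j : ZMod 3) + 1) * dir e' = t + (j + 1) * dir e' + dir e' by ring] at e2
      rw [e2] at e1
      simp only [map_neg, LinearMap.neg_apply, consL_vec_tensor, appL_tensor, map_zero, add_zero,
        smul_zero, sub_zero, zero_add] at e1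
      exact neg_eq_zero.1 e1.symm
  · exact caseD _ _ _ _

/-- Merging two letters raises the shifted degree by one. Hence an operator that first splits a
letter off and then applies a cochain has degree one less than ... the cochain shifted back, which
is what a homotopy needs. -/
theorem Rel.unmul {p r l' : List Alt} {g a b : Alt} (h : Alt.mul g a = some b)
    (hr : Rel P Q (η + (1, 1)) (p ++ g :: a :: r) l') : Rel P Q η (p ++ b :: r) l' := by
  have hm := mul_props h
  refine ⟨fun x y hxy => ?_, ?_, ?_⟩
  · obtain ⟨m, h₁, h₂, h₃, h₄⟩ := isPath_append.1 (hr.1 x y hxy)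
    exact isPath_append.2 ⟨m, h₁, hm.2.1.trans h₂, hm.2.2 ▸ h₄⟩
  · rw [hr.2.1]
    have h2 : (1 + 1 : ZMod 2) = 0 := by decide
    simp only [lpar_append, lpar_cons, spar_mul h, Prod.fst_add]
    ring
  · rw [hr.2.2]
    simp only [ldeg_append, ldeg_cons, sdeg_mul P Q h, Prod.snd_add]
    ring

/-- The homotopy for lists which start with a nonempty chain of generators. -/
noncomputable def koszulHtpy (j : ℕ) (c : T k Alt →ₗ[k] V k Alt) : T k Alt →ₗ[k] V k Alt :=
  ofList fun l => match l.drop j with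
    | alt t e (n + 1) :: r => if l.take j = K e (t - j * dir e) j then
        - c (tensor k (l.take j ++ alt t e 0 :: alt (t + dir e) (!e) n :: r)) else 0
    | _ => 0

theorem koszulHtpy_cases (j : ℕ) (c : T k Alt →ₗ[k] V k Alt) (l : List Alt) :
    koszulHtpy j c (tensor k l) = 0 ∨ ∃ p t e n r, l = p ++ alt t e (n + 1) :: r ∧
      koszulHtpy j c (tensor k l)
        = - c (tensor k (p ++ alt t e 0 :: alt (t + dir e) (!e) n :: r)) := by
  rw [koszulHtpy, ofList_tensor]
  split
  · rename_i t e n r heq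
    split_ifs with h
    · exact Or.inr ⟨l.take j, t, e, n, r, by rw [← heq, List.take_append_drop], rfl⟩
    · exact Or.inl rfl
  · exact Or.inl rfl

theorem koszulHtpy_apply {j : ℕ} (c : T k Alt →ₗ[k] V k Alt) (p : List Alt) (hp : p.length = j)
    (t : ZMod 3) (e : Bool) (n : ℕ) (r : List Alt) :
    koszulHtpy j c (tensor k (p ++ alt t e (n + 1) :: r)) = if p = K e (t - j * dir e) j then
        - c (tensor k (p ++ alt t e 0 :: alt (t + dir e) (!e) n :: r)) else 0 := by
  rw [koszulHtpy, ofList_tensor, ← hp, List.drop_left, List.take_left]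

theorem koszulHtpy_gen {j : ℕ} (c : T k Alt →ₗ[k] V k Alt) (p : List Alt) (hp : p.length = j)
    (t : ZMod 3) (e : Bool) (r : List Alt) :
    koszulHtpy j c (tensor k (p ++ alt t e 0 :: r)) = 0 := by
  rw [koszulHtpy, ofList_tensor, ← hp, List.drop_left]

/-- The homotopy for arbitrary lists, on the first entry. -/
noncomputable def firstHtpyAux (s : k) (c : T k Alt →ₗ[k] V k Alt) (r : List Alt) :
    ZMod 3 → Bool → ℕ → V k Alt
  | _, _, 0 => 0
  | t, e, n + 1 => - c (tensor k (alt t e 0 :: alt (t + dir e) (!e) n :: r))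
      - s • bin (mu k) (vec k (alt t e 0)) (firstHtpyAux s c r (t + dir e) (!e) n)

/-- The homotopy for arbitrary lists. -/
noncomputable def firstHtpy (s : k) (c : T k Alt →ₗ[k] V k Alt) : T k Alt →ₗ[k] V k Alt :=
  ofList fun l => match l with
    | alt t e n :: r => firstHtpyAux s c r t e n
    | _ => 0

theorem firstHtpyAux_mem {s : k} {c : T k Alt →ₗ[k] V k Alt}
    (hc : Graded P Q (η + (1, 1)) c) (r : List Alt) (t : ZMod 3) (e : Bool) (n : ℕ) :
    firstHtpyAux s c r t e n ∈ supp k fun w => Rel P Q η (alt t e n :: r) [w] := by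
  induction n generalizing t e with
  | zero => exact Submodule.zero_mem _
  | succ n ih =>
    have key : ∀ w, Rel P Q (η + (1, 1)) (alt t e 0 :: alt (t + dir e) (!e) n :: r) [w] →
        Rel P Q η (alt t e (n + 1) :: r) [w] := fun w hw =>
      Rel.unmul (p := []) (mul_gen t e n) hw
    refine Submodule.sub_mem _ (Submodule.neg_mem _ (supp_mono key (hc _)))
      (Submodule.smul_mem _ _ (map_mem_of_supp (bin (mu k) (vec k (alt t e 0))) _ (fun w hw => ?_)
        (ih _ _)))
    change bin (mu k) (vec k (alt t e 0)) (vec k w) ∈ _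
    rw [bin_vec]
    refine supp_mono (fun v hv => key v ?_) (graded_mu (P := P) (Q := Q) _)
    have := ((Rel.refl (P := P) (Q := Q) [alt t e 0]).append hw).trans hv
    rwa [zero_add] at this

theorem firstHtpyAux_eq_zero {s : k} {c : T k Alt →ₗ[k] V k Alt} {r : List Alt}
    (hc : ∀ a b, c (tensor k (a :: b :: r)) = 0) (t : ZMod 3) (e : Bool) (n : ℕ) :
    firstHtpyAux s c r t e n = 0 := by
  induction n generalizing t e with
  | zero => rfl
  | succ n ih => rw [firstHtpyAux, hc, ih]; simp

/-- The homotopy splits the first letter off the word behind the chain. For `j > 0` the left outer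
face in the condition of `koszul_step` vanishes, because it sees a chain followed by a word of the
other type. For `j = 0` there is no chain to carry a type, the face survives, and the homotopy is
defined by recursion on the length of the word. -/
theorem exists_htpy {c : T k Alt →ₗ[k] V k Alt} (hc : IsCoc P Q η N c) {j : ℕ} (hN : j + 1 ≤ N)
    (hcn : Normalized c) (hcv : VanishK (j + 2) c) :
    ∃ h, Graded P Q η h ∧ Arity N h ∧ Normalized h ∧ VanishK (j + 1) (c - hd k η.1 h) := by
  rcases Nat.eq_zero_or_pos j with rfl | hj
  · have h₁ : Graded P Q η (firstHtpy (paritySign k η.1) c) := by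
      intro l
      rw [firstHtpy, ofList_tensor]
      split
      · exact firstHtpyAux_mem hc.graded _ _ _ _
      · exact Submodule.zero_mem _
    have h₂ : Arity N (firstHtpy (paritySign k η.1) c) := by
      intro l hl
      rw [firstHtpy, ofList_tensor]
      split
      · refine firstHtpyAux_eq_zero (fun a b => hc.arity _ ?_) _ _ _
        simp only [List.length_cons] at hl ⊢
        omega
      · rfl
    have h₃ : Normalized (firstHtpy (paritySign k η.1) c) := by
      intro l i hi
      rw [firstHtpy, ofList_tensor]
      split
      · rename_i r
        refine firstHtpyAux_eq_zero (fun a b => hcn _ i ?_) _ _ _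
        simp only [List.mem_cons] at hi ⊢
        rcases hi with hi | hi
        · cases hi
        · exact Or.inr (Or.inr hi)
      · rfl
    refine ⟨_, h₁, h₂, h₃, koszul_step hc hN hcn hcv h₁ h₂ h₃ ?_ ?_⟩
    · intro e t r
      rw [firstHtpy, ofList_tensor]
      rfl
    · intro e t n r
      rw [firstHtpy, ofList_tensor, ofList_tensor]
      simp only [K_zero, List.nil_append, Nat.cast_zero, zero_mul, add_zero, zero_add, one_mul,
        firstHtpyAux]
      rfl
  · have h₁ : Graded P Q η (koszulHtpy j c) := by
      intro l
      rcases koszulHtpy_cases j c l with h | ⟨p, t, e, n, r, rfl, h⟩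
      · rw [h]; exact Submodule.zero_mem _
      · rw [h]
        exact Submodule.neg_mem _ (supp_mono (fun w hw => hw.unmul (mul_gen t e n)) (hc.graded _))
    have h₂ : Arity N (koszulHtpy j c) := by
      intro l hl
      rcases koszulHtpy_cases j c l with h | ⟨p, t, e, n, r, rfl, h⟩
      · exact h
      · rw [h, hc.arity, neg_zero]
        simp only [List.length_append, List.length_cons] at hl ⊢
        omega
    have h₃ : Normalized (koszulHtpy j c) := by
      intro l i hi
      rcases koszulHtpy_cases j c l with h | ⟨p, t, e, n, r, rfl, h⟩
      · exact h
      · rw [h, hcn _ i, neg_zero]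
        simp only [List.mem_append, List.mem_cons] at hi ⊢
        rcases hi with hi | hi | hi
        · exact Or.inl hi
        · cases hi
        · exact Or.inr (Or.inr (Or.inr hi))
    refine ⟨_, h₁, h₂, h₃, koszul_step hc hN hcn hcv h₁ h₂ h₃ ?_ ?_⟩
    · intro e t r
      rw [← K_append_cons]
      exact koszulHtpy_gen c _ (by simp) _ _ _
    · intro e t n r
      have e1 : koszulHtpy j c
          (tensor k (K e (t + dir e) j ++ alt (t + (j + 1) * dir e) (!e) n :: r)) = 0 := by
        cases n with
        | zero => exact koszulHtpy_gen c _ (by simp) _ _ _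
        | succ n =>
          rw [koszulHtpy_apply c _ (by simp), if_neg]
          obtain ⟨m, rfl⟩ : ∃ m, j = m + 1 := ⟨j - 1, by omega⟩
          rw [K_succ, K_succ]
          simp
      rw [e1, koszulHtpy_apply c _ (by simp), if_pos (by simp), K_append_cons,
        show t + (j : ZMod 3) * dir e + dir e = t + (j + 1) * dir e by ring]
      simp

/-- A normalized cocycle which vanishes on lists that start with a generator is zero. -/
theorem eq_zero_of_vanishK_one {c : T k Alt →ₗ[k] V k Alt} (hc : IsCoc P Q η N c)
    (hcn : Normalized c) (hcv : VanishK 1 c) : c = 0 := by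
  have hc0 : c (tensor k []) = 0 := hc.arity [] (by simp)
  have key : ∀ n t e r, c (tensor k (alt t e n :: r)) = 0 := by
    intro n
    induction n with
    | zero => exact fun t e r => hcv e t r
    | succ n ih =>
      intro t e r
      -- The first letter of the leading word is split off. In the cocycle equation at this list
      -- only the merged term and the left outer face remain, and the latter vanishes by induction
      -- on the number of letters.
      have e1 := hd_K_append (η + (1, 1)).1 _ hc0 e t 0 (alt (t + dir e) (!e) n) r
      rw [hc.closed, hcv.rightFace, map_appL_eq_zero _ _ (hcv e t), Nat.cast_zero, zero_mul,
        add_zero, mu_gen, LinearMap.zero_apply] at e1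
      simp only [map_neg, LinearMap.neg_apply, consL_vec_tensor, appL_nil, map_zero, add_zero,
        smul_zero, sub_zero, zero_add, K_zero, List.nil_append, ih] at e1
      exact neg_eq_zero.1 e1.symm
  refine T_ext fun l => ?_
  match l with
  | [] => exact hc0
  | one i :: r => exact hcn _ i (by simp)
  | alt t e n :: r => exact key n t e r

/-- A normalized cocycle which vanishes on chains of generators is a coboundary. -/
theorem exists_primitive {c : T k Alt →ₗ[k] V k Alt} (hc : IsCoc P Q η N c) (hN : 1 ≤ N)
    (hcn : Normalized c) (hcv : VanishK (N + 1) c) :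
    ∃ h, Graded P Q η h ∧ Arity N h ∧ c = hd k η.1 h := by
  -- The required length of the leading chain goes down from `N + 1` to `1`, one letter for each
  -- `i`; at `1` the cocycle is zero by `eq_zero_of_vanishK_one`.
  have key : ∀ i, i ≤ N → ∃ h, Graded P Q η h ∧ Arity N h ∧ Normalized h ∧
      VanishK (N + 1 - i) (c - hd k η.1 h) := by
    intro i
    induction i with
    | zero =>
      intro _
      refine ⟨0, fun l => Submodule.zero_mem _, fun _ _ => rfl, fun _ _ _ => rfl, ?_⟩
      rw [hd_zero_apply]
      intro e t r
      simpa using hcv e t r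
    | succ i ih =>
      intro hi
      obtain ⟨h, h₁, h₂, h₃, h₄⟩ := ih (by omega)
      obtain ⟨j, hj⟩ : ∃ j, N = i + (j + 1) := ⟨N - i - 1, by omega⟩
      rw [show N + 1 - i = j + 2 by omega] at h₄
      have hc' := hc.sub_hd hN h₁ h₂
      have hn' : Normalized (c - hd k η.1 h) := fun l i hi => by
        rw [LinearMap.sub_apply, hcn l i hi, h₃.hd h₁ hN h₂ l i hi, sub_zero]
      obtain ⟨h', h₁', h₂', h₃', h₄'⟩ := exists_htpy hc' (by omega) hn' h₄
      refine ⟨h + h', h₁.add h₁', fun l hl => by rw [LinearMap.add_apply, h₂ l hl, h₂' l hl, add_zero],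
        fun l i hi => by rw [LinearMap.add_apply, h₃ l i hi, h₃' l i hi, add_zero], ?_⟩
      rw [show N + 1 - (i + 1) = j + 1 by omega]
      intro e t r
      rw [hd_add]
      have := h₄' e t r
      simp only [LinearMap.sub_apply, LinearMap.add_apply] at this ⊢
      rw [← this]
      abel
  obtain ⟨h, h₁, h₂, h₃, h₄⟩ := key N le_rfl
  rw [show N + 1 - N = 1 by omega] at h₄
  refine ⟨h, h₁, h₂, ?_⟩
  have hn' : Normalized (c - hd k η.1 h) := fun l i hi => by
    rw [LinearMap.sub_apply, hcn l i hi, h₃.hd h₁ hN h₂ l i hi, sub_zero]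
  exact sub_eq_zero.1 (eq_zero_of_vanishK_one (hc.sub_hd hN h₁ h₂) hn' h₄)

end Koszul

end Bar

namespace Bar

open Alt

/-! ### The complex of values on chains of equal letters -/

section SmallComplex

variable {k : Type*} [Field k] {P Q : ZMod 3 → ℚ} {η : ZMod 2 × ℚ} {N : ℕ}

theorem src_alt_succ (t : ZMod 3) (e : Bool) (n : ℕ) :
    (alt t e (n + 1)).src = (alt t e n).src + dir (nxt e n) := by
  rcases Nat.mod_two_eq_zero_or_one n with hn | hn
  · simp [src, nxt, hn, show (n + 1) % 2 = 1 by omega, dir_not]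
  · simp [src, nxt, hn, show (n + 1) % 2 = 0 by omega]

theorem mul_alt_gen (t : ZMod 3) (e : Bool) (n : ℕ) (t' : ZMod 3) (e' : Bool) :
    mul (alt t e n) (alt t' e' 0)
      = if (alt t e n).src = t' ∧ nxt e n = e' then some (alt t e (n + 1)) else none := rfl

theorem mul_gen_alt (t : ZMod 3) (e : Bool) (n : ℕ) (t' : ZMod 3) (e' : Bool) :
    mul (alt t e 0) (alt t' e' n)
      = if t + dir e = t' ∧ (!e) = e' then some (alt t e (n + 1)) else none := by
  simp [mul, src, nxt]

theorem bin_apply_induction (f : V k Alt →ₗ[k] V k Alt) (w : Alt) (g : V k Alt →ₗ[k] k)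
    (h : ∀ a, f (vec k a) w = g (vec k a)) (x : V k Alt) : f x w = g x := by
  have : Finsupp.lapply w ∘ₗ f = g := V_ext fun a => by simpa using h a
  exact LinearMap.congr_fun this x

/-- A word has a unique first letter, so a coefficient of the product is a single coefficient of
`x`. The following lemmas do the same for one letter, for identities and for multiplication on the
right. -/
theorem bin_gen_apply_succ (t : ZMod 3) (e : Bool) (x : V k Alt) (t' : ZMod 3) (e' : Bool) (n : ℕ) :
    bin (mu k) (vec k (alt t e 0)) x (alt t' e' (n + 1))
      = if t = t' ∧ e = e' then - x (alt (t + dir e) (!e) n) else 0 := by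
  have := bin_apply_induction (bin (mu k) (vec k (alt t e 0))) (alt t' e' (n + 1))
    (if t = t' ∧ e = e' then - Finsupp.lapply (alt (t + dir e) (!e) n) else 0) (fun a => ?_) x
  · rw [this]; split_ifs <;> simp
  · rw [bin_vec, mu_pair, sg_gen]
    cases a with
    | one i =>
      simp only [mul]
      split_ifs <;> simp [ovec, vec]
    | alt s f m =>
      rw [mul_gen_alt]
      by_cases h₁ : t + dir e = s ∧ (!e) = f
      · obtain ⟨rfl, rfl⟩ := h₁
        by_cases h₂ : t = t' ∧ e = e'
        · obtain ⟨rfl, rfl⟩ := h₂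
          simp [ovec, vec, Finsupp.single_apply]
        · have h₃ : ¬ (t = t' ∧ e = e' ∧ m = n) := fun h => h₂ ⟨h.1, h.2.1⟩
          simp [ovec, vec, h₂, h₃]
      · have h₃ : ∀ m, ¬ (s = t + dir e ∧ (f = !e) ∧ m) := fun m h => h₁ ⟨h.1.symm, h.2.1.symm⟩
        rw [if_neg h₁]
        split_ifs <;> simp [ovec, vec, h₃]

theorem bin_gen_apply_zero (t : ZMod 3) (e : Bool) (x : V k Alt) (t' : ZMod 3) (e' : Bool) :
    bin (mu k) (vec k (alt t e 0)) x (alt t' e' 0)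
      = if t = t' ∧ e = e' then - x (one (t + dir e)) else 0 := by
  have := bin_apply_induction (bin (mu k) (vec k (alt t e 0))) (alt t' e' 0)
    (if t = t' ∧ e = e' then - Finsupp.lapply (one (t + dir e)) else 0) (fun a => ?_) x
  · rw [this]; split_ifs <;> simp
  · rw [bin_vec, mu_pair, sg_gen]
    cases a with
    | one i =>
      simp only [mul, src]
      split_ifs <;> simp_all [ovec, vec]
    | alt s f m =>
      rw [mul_gen_alt]
      split_ifs <;> simp_all [ovec, vec]

/-- A product with a generator has no constant term. This and `bin_apply_gen_one` are why the
constants `a` and `b` are invariants. -/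
theorem bin_gen_apply_one (t : ZMod 3) (e : Bool) (x : V k Alt) (i : ZMod 3) :
    bin (mu k) (vec k (alt t e 0)) x (one i) = 0 := by
  refine bin_apply_induction (bin (mu k) (vec k (alt t e 0))) (one i) 0 (fun a => ?_) x
  rw [bin_vec, mu_pair, sg_gen]
  cases a with
  | one i =>
    simp only [mul]
    split_ifs <;> simp [ovec, vec]
  | alt s f m =>
    rw [mul_gen_alt]
    split_ifs <;> simp [ovec, vec]

theorem bin_apply_gen_succ (t : ZMod 3) (e : Bool) (x : V k Alt) (t' : ZMod 3) (e' : Bool) (n : ℕ) :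
    bin (mu k) x (vec k (alt t e 0)) (alt t' e' (n + 1))
      = if (alt t' e' n).src = t ∧ nxt e' n = e then - sg k (alt t' e' n) * x (alt t' e' n)
        else 0 := by
  have := bin_apply_induction ((bin (mu k)).flip (vec k (alt t e 0))) (alt t' e' (n + 1))
    (if (alt t' e' n).src = t ∧ nxt e' n = e then - sg k (alt t' e' n) • Finsupp.lapply (alt t' e' n)
      else 0) (fun a => ?_) x
  · rw [LinearMap.flip_apply] at this
    rw [this]; split_ifs <;> simp
  · rw [LinearMap.flip_apply, bin_vec, mu_pair]
    cases a with
    | one i =>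
      simp only [mul]
      split_ifs <;> simp [ovec, vec]
    | alt s f m =>
      rw [mul_alt_gen]
      by_cases h : alt s f m = alt t' e' n
      · cases h
        split_ifs <;> simp [ovec, vec]
      · have h' : ¬ (s = t' ∧ f = e' ∧ m = n) := fun h' => h (by rw [h'.1, h'.2.1, h'.2.2])
        split_ifs <;> simp [ovec, vec, h']

theorem bin_apply_gen_zero (t : ZMod 3) (e : Bool) (x : V k Alt) (t' : ZMod 3) (e' : Bool) :
    bin (mu k) x (vec k (alt t e 0)) (alt t' e' 0) = if t = t' ∧ e = e' then x (one t) else 0 := by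
  have := bin_apply_induction ((bin (mu k)).flip (vec k (alt t e 0))) (alt t' e' 0)
    (if t = t' ∧ e = e' then Finsupp.lapply (one t) else 0) (fun a => ?_) x
  · rw [LinearMap.flip_apply] at this
    rw [this]; split_ifs <;> simp
  · rw [LinearMap.flip_apply, bin_vec, mu_pair]
    cases a with
    | one i =>
      have hs : sg k (one i) = -1 := by simp [sg, spar, paritySign]
      rw [hs]
      by_cases h₁ : i = t
      · subst h₁
        rw [mul_one_left (i := i) (w := alt i e 0) rfl]
        by_cases h₂ : i = t' ∧ e = e' <;> simp [ovec, vec, h₂]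
      · rw [mul_none (show (one i).src ≠ (alt t e 0).tgt from h₁)]
        have h₃ : i ≠ t' ∨ t ≠ t' := by by_contra! h; exact h₁ (h.1.trans h.2.symm)
        by_cases h₂ : t = t' ∧ e = e'
        · simp [ovec, vec, h₂, h₃.resolve_right (not_not.2 h₂.1)]
        · simp [ovec, h₂]
    | alt s f m =>
      rw [mul_alt_gen]
      split_ifs <;> simp_all [ovec, vec]

theorem bin_apply_gen_one (t : ZMod 3) (e : Bool) (x : V k Alt) (i : ZMod 3) :
    bin (mu k) x (vec k (alt t e 0)) (one i) = 0 := by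
  refine bin_apply_induction ((bin (mu k)).flip (vec k (alt t e 0))) (one i) 0 (fun a => ?_) x
  rw [LinearMap.flip_apply, bin_vec, mu_pair]
  cases a with
  | one i =>
    simp only [mul]
    split_ifs <;> simp [ovec, vec]
  | alt s f m =>
    rw [mul_alt_gen]
    split_ifs <;> simp [ovec, vec]

/-- A word which ends with the given letter without this letter. -/
noncomputable def stripWord (k : Type*) [Field k] (e : Bool) : Alt → V k Alt
  | alt t e' (n + 1) => if nxt e' n = e then sg k (alt t e' n) • vec k (alt t e' n) else 0
  | _ => 0

/-- Remove the last letter, if it is the given one. -/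
noncomputable def strip (k : Type*) [Field k] (e : Bool) : V k Alt →ₗ[k] V k Alt :=
  Finsupp.linearCombination k (stripWord k e)

@[simp] theorem strip_vec (e : Bool) (w : Alt) : strip k e (vec k w) = stripWord k e w := by
  simp [strip, vec]

theorem strip_apply_one (e : Bool) (x : V k Alt) (i : ZMod 3) : strip k e x (one i) = 0 := by
  refine bin_apply_induction (strip k e) (one i) 0 (fun a => ?_) x
  rw [strip_vec, stripWord.eq_def]
  split
  · split_ifs <;> simp [vec]
  · simp

theorem strip_apply_alt (e : Bool) (x : V k Alt) (t : ZMod 3) (e' : Bool) (n : ℕ) :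
    strip k e x (alt t e' n)
      = if nxt e' n = e then sg k (alt t e' n) * x (alt t e' (n + 1)) else 0 := by
  have := bin_apply_induction (strip k e) (alt t e' n)
    (if nxt e' n = e then sg k (alt t e' n) • Finsupp.lapply (alt t e' (n + 1)) else 0)
    (fun a => ?_) x
  · rw [this]; split_ifs <;> simp
  · rw [strip_vec, stripWord.eq_def]
    split
    · rename_i s f m
      by_cases h : alt s f m = alt t e' n
      · cases h
        split_ifs <;> simp [vec]
      · have h' : ¬ (s = t ∧ f = e' ∧ m = n) := fun h' => h (by rw [h'.1, h'.2.1, h'.2.2])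
        split_ifs <;> simp [vec, h']
    · rename_i h
      have : ∀ n, a ≠ alt t e' (n + 1) := fun n => h t e' n
      split_ifs <;> simp [vec, this]

/-- The letter removed from the value and the last letter of the chain have the same type and the
same endpoints, so both endpoints and degrees stay consistent. -/
theorem strip_mem {e : Bool} {t : ZMod 3} {n : ℕ} {x : V k Alt}
    (hx : x ∈ supp k fun w => Rel P Q (η + (1, 1)) (K e t (n + 1)) [w]) :
    strip k e x ∈ supp k fun w => Rel P Q η (K e t n) [w] := by
  refine map_mem_of_supp _ _ (fun w hw => ?_) hx
  change strip k e (vec k w) ∈ _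
  rw [strip_vec, stripWord.eq_def]
  split
  · rename_i s f m
    split_ifs with h
    · refine Submodule.smul_mem _ _ (vec_mem ?_)
      have hp := hw.isPath
      have hm := mul_props (w₁ := alt s f m) (w₂ := alt (alt s f m).src e 0)
        (w := alt s f (m + 1)) (by rw [mul_alt_gen, if_pos ⟨rfl, h⟩])
      have hsp := spar_mul (w₁ := alt s f m) (w₂ := alt (alt s f m).src e 0)
        (w := alt s f (m + 1)) (by rw [mul_alt_gen, if_pos ⟨rfl, h⟩])
      have hsd := sdeg_mul P Q (w₁ := alt s f m) (w₂ := alt (alt s f m).src e 0)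
        (w := alt s f (m + 1)) (by rw [mul_alt_gen, if_pos ⟨rfl, h⟩])
      have hs : (alt s f m).src = t + n * dir e := by
        have h1 := (isPath_K.1 hp).2
        rw [src_alt_succ, h, add_mul, one_mul, ← add_assoc] at h1
        exact add_right_cancel h1
      rw [hs] at hsp hsd
      rw [K_succ'] at hw hp
      refine ⟨fun j i hji => ?_, ?_, ?_⟩
      · obtain ⟨h₁, h₂⟩ := hji
        cases h₁
        cases h₂
        obtain ⟨r, h₁, h₂⟩ := isPath_append.1 hp
        rw [hs, ← show r = t + n * dir e from h₂.1.symm]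
        exact h₁
      · have := hw.2.1
        simp only [lpar_cons, lpar_append, lpar_nil, add_zero, hsp, Prod.fst_add] at this ⊢
        linear_combination this
      · have := hw.2.2
        simp only [ldeg_cons, ldeg_append, ldeg_nil, add_zero, hsd, Prod.snd_add] at this ⊢
        linear_combination this
    · exact Submodule.zero_mem _
  · exact Submodule.zero_mem _

/-- The homotopy on chains of generators. -/
noncomputable def stripHtpy (N : ℕ) (s : k) (c : T k Alt →ₗ[k] V k Alt) : T k Alt →ₗ[k] V k Alt :=
  ofList fun l => match l with
    | alt t e n :: r => if alt t e n :: r = K e t N then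
        s • strip k e (c (tensor k (K e t (N + 1)))) else 0
    | _ => 0

theorem stripHtpy_cases (s : k) (c : T k Alt →ₗ[k] V k Alt) (l : List Alt) :
    stripHtpy N s c (tensor k l) = 0 ∨ ∃ e t, l = K e t N ∧
      stripHtpy N s c (tensor k l) = s • strip k e (c (tensor k (K e t (N + 1)))) := by
  rw [stripHtpy, ofList_tensor]
  split
  · split_ifs with h
    · exact Or.inr ⟨_, _, h, rfl⟩
    · exact Or.inl rfl
  · exact Or.inl rfl

theorem stripHtpy_K (hN : 1 ≤ N) (s : k) (c : T k Alt →ₗ[k] V k Alt) (e : Bool) (t : ZMod 3) :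
    stripHtpy N s c (tensor k (K e t N)) = s • strip k e (c (tensor k (K e t (N + 1)))) := by
  obtain ⟨n, rfl⟩ : ∃ n, N = n + 1 := ⟨N - 1, by omega⟩
  rw [stripHtpy, ofList_tensor, K_succ]
  exact if_pos rfl

theorem stripHtpy_graded {c : T k Alt →ₗ[k] V k Alt} (hc : Graded P Q (η + (1, 1)) c) (s : k) :
    Graded P Q η (stripHtpy N s c) := by
  intro l
  rcases stripHtpy_cases (N := N) s c l with h | ⟨e, t, rfl, h⟩
  · rw [h]; exact Submodule.zero_mem _
  · rw [h]; exact Submodule.smul_mem _ _ (strip_mem (hc _))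

theorem stripHtpy_normalized (s : k) (c : T k Alt →ₗ[k] V k Alt) : Normalized (stripHtpy N s c) := by
  intro l i hi
  rcases stripHtpy_cases (N := N) s c l with h | ⟨e, t, rfl, h⟩
  · exact h
  · exact absurd hi (one_notMem_K _ _ _ _)

theorem stripHtpy_arity (s : k) (c : T k Alt →ₗ[k] V k Alt) : Arity N (stripHtpy N s c) := by
  intro l hl
  rcases stripHtpy_cases (N := N) s c l with h | ⟨e, t, rfl, h⟩
  · exact h
  · exact absurd (length_K _ _ _) hl

/-- A cocycle vanishes on chains of generators up to a coboundary, if the coefficients which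
may obstruct this do not occur. -/
theorem exists_strip {c : T k Alt →ₗ[k] V k Alt} (hc : IsCoc P Q η N c) (hN : 1 ≤ N)
    (h_one : ∀ e t i, c (tensor k (K e t (N + 1))) (one i) = 0)
    (h_gen : ∀ e t, ¬ Rel P Q (η + (1, 1)) (K e t (N + 1)) [alt t e 0]) :
    ∃ h, Graded P Q η h ∧ Arity N h ∧ Normalized h ∧
      ∀ e t, (c - hd k η.1 h) (tensor k (K e t (N + 1))) = 0 := by
  set s := paritySign k η.1 with hs
  have hgr := stripHtpy_graded (N := N) hc.graded s
  have har := stripHtpy_arity (N := N) s c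
  refine ⟨stripHtpy N s c, hgr, har, stripHtpy_normalized s c, fun e t => ?_⟩
  have hss : s * s = 1 := paritySign_mul_self _ _
  have e1 : hd k η.1 (stripHtpy N s c) (tensor k (K e t (N + 1)))
      = - (bin (mu k) (strip k e (c (tensor k (K e t (N + 1))))) (vec k (alt (t + N * dir e) e 0))
        + bin (mu k) (vec k (alt t e 0)) (strip k e (c (tensor k (K e (t + dir e) (N + 1)))))) := by
    rw [hd_K _ _ (har [] (by simp; omega)), stripHtpy_K hN, stripHtpy_K hN, ← hs]
    simp only [map_smul, LinearMap.smul_apply, ← smul_add, smul_smul, neg_mul, hss]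
    rw [neg_smul, one_smul]
  -- The cocycle equation on the chain of length `N + 2`, read off at a word that starts with the
  -- type of the chain. The sign in front of the differential has been cancelled.
  have e2 : ∀ (e : Bool) (t : ZMod 3) m,
      (if (alt t e m).src = t + (N + 1) * dir e ∧ nxt e m = e then
        - sg k (alt t e m) * c (tensor k (K e t (N + 1))) (alt t e m) else 0)
      - c (tensor k (K e (t + dir e) (N + 1))) (alt (t + dir e) (!e) m) = 0 := by
    intro e t m
    have h := LinearMap.congr_fun hc.closed (tensor k (K e t (N + 1 + 1)))
    rw [hd_K _ _ (hc.arity [] (by simp)), LinearMap.zero_apply, neg_smul, neg_eq_zero] at h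
    have h' := congrArg (paritySign k (η + (1, 1)).1 • ·) h
    simp only [smul_smul, paritySign_mul_self, one_smul, smul_zero] at h'
    have h2 := DFunLike.congr_fun h' (alt t e (m + 1))
    rw [Finsupp.add_apply, bin_apply_gen_succ, bin_gen_apply_succ,
      if_pos (show t = t ∧ e = e from ⟨rfl, rfl⟩)] at h2
    push_cast at h2
    rw [sub_eq_add_neg]
    exact h2
  -- Words which start and end with the opposite type do not occur in a cocycle: multiplied by a
  -- generator on the left they give words that no multiplication on the right can produce.
  have even : ∀ (t : ZMod 3) m, m % 2 = 0 → c (tensor k (K e t (N + 1))) (alt t (!e) m) = 0 := by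
    intro t m hm
    have := e2 e (t - dir e) m
    rw [if_neg (by simp [nxt, hm]), sub_add_cancel, zero_sub, neg_eq_zero] at this
    exact this
  rw [LinearMap.sub_apply, sub_eq_zero, e1]
  refine Finsupp.ext fun w => ?_
  by_cases hw : Rel P Q (η + (1, 1)) (K e t (N + 1)) [w]
  swap
  · rw [← e1, hc.graded.apply_eq_zero hw, (hgr.hd _).apply_eq_zero hw]
  obtain ⟨h₁, h₂⟩ := isPath_K.1 hw.isPath
  rw [Finsupp.neg_apply, Finsupp.add_apply]
  match w with
  | one i => rw [h_one, bin_gen_apply_one, bin_apply_gen_one]; simp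
  | alt t' e' 0 =>
    obtain rfl : t = t' := h₁.symm
    rw [bin_gen_apply_zero, bin_apply_gen_zero, strip_apply_one, strip_apply_one]
    rcases Bool.eq_or_eq_not e' e with rfl | rfl
    -- A single letter of the type of the chain could be produced only from an identity, but `strip`
    -- never yields identities. This is the second kind of obstruction.
    · exact absurd hw (h_gen _ _)
    · rw [even _ 0 rfl]; simp
  | alt t' e' (n + 1) =>
    obtain rfl : t = t' := h₁.symm
    rw [bin_gen_apply_succ, bin_apply_gen_succ, strip_apply_alt, strip_apply_alt]
    have h₃ := h₂
    rw [src_alt_succ, add_mul, one_mul, ← add_assoc] at h₃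
    have hsg := sg_mul_self (k := k) (alt t e' n)
    -- Words that end with the type of the chain are restored by multiplying the stripped word on
    -- the right. Words that start with this type and end with the other one come from the left
    -- face, via `e2`; the remaining ones vanish by `even`.
    rcases Bool.eq_or_eq_not e' e with rfl | rfl
    · rcases Nat.mod_two_eq_zero_or_one n with hn | hn
      · have hx : nxt e' n = !e' := by simp [nxt, hn]
        have hx' : nxt (!e') n = e' := by simp [nxt, hn]
        have h4 := e2 e' t (n + 1)
        rw [if_pos ⟨h₂, show nxt e' (n + 1) = e' by simp [nxt, show (n + 1) % 2 = 1 by omega]⟩] at h4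
        rw [hx, hx', if_neg (by simp), if_pos (show t = t ∧ e' = e' from ⟨rfl, rfl⟩), if_pos rfl]
        have s1 : sg k (alt (t + dir e') (!e') n) = 1 := by
          simp [sg, spar, paritySign, (ZMod.natCast_eq_zero_iff_even).2 (Nat.even_iff.2 hn)]
        have s2 : sg k (alt t e' (n + 1)) = -1 := by
          simp [sg, spar, paritySign, (ZMod.natCast_eq_zero_iff_even).2 (Nat.even_iff.2 hn)]
        rw [s2] at h4
        rw [s1]
        linear_combination h4
      · have hx : nxt e' n = e' := by simp [nxt, hn]
        have hx' : nxt (!e') n = !e' := by simp [nxt, hn]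
        rw [hx] at h₃
        rw [hx, hx', if_pos ⟨add_right_cancel h₃, rfl⟩, if_pos rfl]
        simp only [Bool.not_eq_self, if_false, neg_zero, ite_self, add_zero]
        linear_combination - c (tensor k (K e' t (N + 1))) (alt t e' (n + 1)) * hsg
    · rcases Nat.mod_two_eq_zero_or_one n with hn | hn
      · have hx : nxt (!e) n = e := by simp [nxt, hn]
        rw [hx] at h₃
        rw [hx, if_pos ⟨add_right_cancel h₃, rfl⟩, if_pos rfl, if_neg (by simp)]
        linear_combination - c (tensor k (K e t (N + 1))) (alt t (!e) (n + 1)) * hsg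
      · have hx : nxt (!e) n = !e := by simp [nxt, hn]
        rw [even _ _ (by omega), hx, if_neg (by simp), if_neg (by simp)]
        simp

/-- Vanishing of Hochschild cohomology in the degrees in which it has no obstruction. -/
theorem exists_hd_eq {c : T k Alt →ₗ[k] V k Alt} (hc : IsCoc P Q η N c) (hN : 1 ≤ N)
    (h_one : ∀ e t, c (tensor k (K e t (N + 1))) (one t) = 0)
    (h_gen : ∀ e t, ¬ Rel P Q (η + (1, 1)) (K e t (N + 1)) [alt t e 0]) :
    ∃ h, Graded P Q η h ∧ Arity N h ∧ c = hd k η.1 h := by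
  obtain ⟨h₁, hg₁, ha₁, hn₁⟩ := exists_normalized hc hN
  have hc₁ := hc.sub_hd hN hg₁ ha₁
  -- Normalizing does not change the identity coefficients on chains, because there a coboundary
  -- consists of products with generators.
  have h_one' : ∀ e t i, (c - hd k η.1 h₁) (tensor k (K e t (N + 1))) (one i) = 0 := by
    intro e t i
    by_cases hw : Rel P Q (η + (1, 1)) (K e t (N + 1)) [one i]
    swap
    · exact hc₁.graded.apply_eq_zero hw
    cases (isPath_K.1 hw.isPath).1
    rw [LinearMap.sub_apply, Finsupp.sub_apply, hd_K _ _ (ha₁ [] (by simp; omega))]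
    erw [h_one]
    simp [bin_gen_apply_one, bin_apply_gen_one]
  obtain ⟨h₂, hg₂, ha₂, hn₂, hz₂⟩ := exists_strip hc₁ hN h_one' h_gen
  have hc₂ := hc₁.sub_hd hN hg₂ ha₂
  obtain ⟨h₃, hg₃, ha₃, hz₃⟩ := exists_primitive hc₂ hN
    (fun l i hi => by rw [LinearMap.sub_apply, hn₁ l i hi, hn₂.hd hg₂ hN ha₂ l i hi, sub_zero])
    (fun e t r => by
      cases r with
      | nil => rw [List.append_nil]; exact hz₂ e t
      | cons a r => exact hc₂.arity _ (by simp))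
  refine ⟨h₁ + h₂ + h₃, (hg₁.add hg₂).add hg₃, fun l hl => ?_, ?_⟩
  · simp [ha₁ l hl, ha₂ l hl, ha₃ l hl]
  · rw [hd_add, hd_add, ← hz₃]
    refine LinearMap.ext fun x => ?_
    simp only [LinearMap.add_apply, LinearMap.sub_apply]
    abel

end SmallComplex

end Bar

namespace Bar

open Alt

/-! ### The degrees in which obstructions can occur -/

section Degrees

variable {P Q : ZMod 3 → ℚ} {η : ZMod 2 × ℚ}

theorem three_mul_dir (t : ZMod 3) (e : Bool) : t + dir e + dir e + dir e = t := by
  revert t e; decide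

theorem K_add_three (e : Bool) (t : ZMod 3) (n : ℕ) : K e t (n + 3) = K e t 3 ++ K e t n := by
  rw [show n + 3 = n + 1 + 1 + 1 from rfl, K_succ, K_succ, K_succ, three_mul_dir]
  rfl

/-- The degrees of the generators of each type add up to one. -/
def SumOne (P Q : ZMod 3 → ℚ) : Prop := P 1 + P 2 + P 3 = 1 ∧ Q 1 + Q 2 + Q 3 = 1

/-- Three consecutive equal letters run once around the triangle: their degrees add up to `1`, and
each of the three shifts subtracts `1`. -/
theorem SumOne.ldeg_K_three (h : SumOne P Q) (e : Bool) (t : ZMod 3) : ldeg P Q (K e t 3) = -2 := by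
  obtain ⟨hP, hQ⟩ := h
  rw [show (3 : ZMod 3) = 0 from rfl] at hP hQ
  have key : ∀ t : ZMod 3, t = 0 ∨ t = 1 ∨ t = 2 := by decide
  have e1 : (1 + 1 : ZMod 3) = 2 := rfl
  have e2 : (2 + 1 : ZMod 3) = 0 := rfl
  have e4 : (-1 : ZMod 3) = 2 := rfl
  have e5 : (1 : ZMod 3) + 2 = 0 := rfl
  have e6 : (2 : ZMod 3) + 2 = 1 := rfl
  rcases key t with rfl | rfl | rfl <;> cases e <;>
    simp [K_succ, sdeg, dir, e1, e2, e4, e5, e6] <;> linarith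

theorem SumOne.ldeg_K (h : SumOne P Q) (e : Bool) (t : ZMod 3) (m r : ℕ) :
    ldeg P Q (K e t (3 * m + r)) = ldeg P Q (K e t r) - 2 * m := by
  induction m with
  | zero => simp
  | succ m ih =>
    rw [show 3 * (m + 1) + r = 3 * m + r + 3 by ring, K_add_three, ldeg_append, h.ldeg_K_three, ih]
    push_cast
    ring

/-- The chain must be closed, so its length is `3m` and its shifted degree `-2m`, while an identity
has shifted degree `-1`. -/
theorem SumOne.rel_one (h : SumOne P Q) {e : Bool} {t : ZMod 3} {n : ℕ}
    (hr : Rel P Q η (K e t n) [one t]) : ∃ m : ℕ, n = 3 * m ∧ η.2 = 2 * m - 1 := by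
  have hp := hr.isPath
  have hn : 3 ∣ n := by
    cases n with
    | zero => exact dvd_zero _
    | succ n =>
      have h1 := (isPath_K.1 hp).2
      have h2 : ((n : ZMod 3) + 1) * dir e = 0 := by
        have h3 : t + ((n : ZMod 3) + 1) * dir e = t + 0 := by rw [add_zero]; exact h1.symm
        exact add_left_cancel h3
      have h3 : ((n + 1 : ℕ) : ZMod 3) = 0 := by
        push_cast
        cases e
        · rw [show dir false = -1 from rfl] at h2
          linear_combination -h2
        · simpa [dir] using h2
      exact (ZMod.natCast_eq_zero_iff _ _).1 h3
  obtain ⟨m, rfl⟩ := hn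
  refine ⟨m, rfl, ?_⟩
  have := hr.2.2
  rw [show 3 * m = 3 * m + 0 by ring, h.ldeg_K] at this
  simp only [ldeg_cons, ldeg_nil, sdeg, K_zero] at this
  linarith

/-- The chain and its first letter have the same endpoints, so after that letter there are `m` full
turns, of shifted degree `-2` each. -/
theorem SumOne.rel_gen (h : SumOne P Q) {e : Bool} {t : ZMod 3} {n : ℕ}
    (hr : Rel P Q η (K e t n) [alt t e 0]) : ∃ m : ℕ, n = 3 * m + 1 ∧ η.2 = 2 * m := by
  have hp := hr.isPath
  have hn : ∃ m, n = 3 * m + 1 := by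
    cases n with
    | zero =>
      have h1 : t = t + dir e := hp
      exact absurd h1 ((by decide : ∀ (t : ZMod 3) (e : Bool), ¬ t = t + dir e) t e)
    | succ n =>
      have h1 : t + dir e = t + ((n : ZMod 3) + 1) * dir e := (isPath_K.1 hp).2
      have h2 : (n : ZMod 3) * dir e = 0 := by
        rw [add_mul, one_mul] at h1
        linear_combination -h1
      have h3 : (n : ZMod 3) = 0 := by
        cases e
        · simpa [dir] using h2
        · simpa [dir] using h2
      obtain ⟨m, rfl⟩ := (ZMod.natCast_eq_zero_iff _ _).1 h3
      exact ⟨m, rfl⟩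
  obtain ⟨m, rfl⟩ := hn
  refine ⟨m, rfl, ?_⟩
  have := hr.2.2
  rw [h.ldeg_K] at this
  simp only [ldeg_cons, ldeg_nil, K_succ, K_zero] at this
  linarith

end Degrees

/-! ### The basic cocycle of length three -/

section Triple

variable {k : Type*} [Field k] {P Q : ZMod 3 → ℚ}

/-- A word without its first letter. -/
def tail (t : ZMod 3) (e : Bool) : ℕ → Alt
  | 0 => one t
  | n + 1 => alt t (!e) n

/-- The values of the basic cocycle of length three on lists which start with a generator. -/
noncomputable def tripleGen (κ : Bool → k) (t : ZMod 3) (e : Bool) : List Alt → V k Alt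
  | [alt t₁ e₁ 0, alt t₂ e₂ n] =>
      if t₁ = t + dir e ∧ e₁ = e ∧ t₂ = t₁ + dir e ∧ e₂ = e then κ e • vec k (tail t e n) else 0
  | _ => 0

/-- The values of the basic cocycle of length three. -/
noncomputable def tripleAux (κ : Bool → k) (r : List Alt) : ZMod 3 → Bool → ℕ → V k Alt
  | t, e, 0 => tripleGen κ t e r
  | t, e, n + 1 => bin (mu k) (vec k (alt t e 0)) (tripleAux κ r (t + dir e) (!e) n)

/-- The cocycle of length three whose values at the cyclic chains of generators are multiples of
identities. -/
noncomputable def triple (κ : Bool → k) : T k Alt →ₗ[k] V k Alt :=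
  ofList fun l => match l with
    | alt t e n :: r => tripleAux κ r t e n
    | _ => 0

theorem triple_gen (κ : Bool → k) (t : ZMod 3) (e : Bool) (r : List Alt) :
    triple κ (tensor k (alt t e 0 :: r)) = tripleGen κ t e r := ofList_tensor _ _

/-- The operator is linear, up to the sign in `mu`, under splitting letters off the left of its
first argument. It is therefore determined by lists that start with a generator. -/
theorem triple_succ (κ : Bool → k) (t : ZMod 3) (e : Bool) (n : ℕ) (r : List Alt) :
    triple κ (tensor k (alt t e (n + 1) :: r)) = bin (mu k) (vec k (alt t e 0))
      (triple κ (tensor k (alt (t + dir e) (!e) n :: r))) := by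
  simp only [triple, ofList_tensor, tripleAux]

theorem tripleGen_eq_zero (κ : Bool → k) (t : ZMod 3) (e : Bool) (a : Alt) (r : List Alt)
    (h : ∀ s, a ≠ alt s e 0) : tripleGen κ t e (a :: r) = 0 := by
  rw [tripleGen.eq_def]
  split
  · rename_i t₁ e₁ t₂ e₂ n heq
    cases heq
    rw [if_neg]
    rintro ⟨rfl, rfl, -, -⟩
    exact h _ rfl
  · rfl

theorem tripleGen_eq (κ : Bool → k) (t : ZMod 3) (e : Bool) (n : ℕ) :
    tripleGen κ t e [alt (t + dir e) e 0, alt (t + dir e + dir e) e n]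
      = κ e • vec k (tail t e n) := if_pos ⟨rfl, rfl, rfl, rfl⟩

theorem triple_K (κ : Bool → k) (e : Bool) (t : ZMod 3) :
    triple κ (tensor k (K e t 3)) = κ e • vec k (one t) :=
  (triple_gen κ t e _).trans (tripleGen_eq κ t e 0)

theorem tripleGen_ne (κ : Bool → k) (t : ZMod 3) (e : Bool) (a b : Alt)
    (h : ∀ s n, b ≠ alt s e n) : tripleGen κ t e [a, b] = 0 := by
  rw [tripleGen.eq_def]
  split
  · rename_i t₁ e₁ t₂ e₂ n heq
    cases heq
    rw [if_neg]
    rintro ⟨-, -, -, rfl⟩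
    exact h _ _ rfl
  · rfl

theorem tripleGen_length (κ : Bool → k) (t : ZMod 3) (e : Bool) (r : List Alt)
    (h : r.length ≠ 2) : tripleGen κ t e r = 0 := by
  rw [tripleGen.eq_def]
  split
  · simp at h
  · rfl

theorem tripleGen_one (κ : Bool → k) (t : ZMod 3) (e : Bool) (r : List Alt) (i : ZMod 3)
    (h : one i ∈ r) : tripleGen κ t e r = 0 := by
  rw [tripleGen.eq_def]
  split
  · simp at h
  · rfl

theorem tripleAux_eq_zero (κ : Bool → k) (r : List Alt) (h : ∀ t e, tripleGen κ t e r = 0)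
    (t : ZMod 3) (e : Bool) (n : ℕ) : tripleAux κ r t e n = 0 := by
  induction n generalizing t e with
  | zero => exact h t e
  | succ n ih => rw [tripleAux, ih, map_zero]

theorem triple_arity (κ : Bool → k) : Arity 3 (triple κ) := by
  intro l hl
  rw [triple, ofList_tensor]
  split
  · exact tripleAux_eq_zero κ _ (fun t e => tripleGen_length κ t e _ (by simpa using hl)) _ _ _
  · rfl

theorem triple_normalized (κ : Bool → k) : Normalized (triple κ) := by
  intro l i hi
  rw [triple, ofList_tensor]
  split
  · exact tripleAux_eq_zero κ _ (fun t e => tripleGen_one κ t e _ i (by simpa using hi)) _ _ _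
  · rfl

theorem tripleGen_mem (h : SumOne P Q) (κ : Bool → k) (t : ZMod 3) (e : Bool) (r : List Alt) :
    tripleGen κ t e r ∈ supp k fun w => Rel P Q (1, 1) (alt t e 0 :: r) [w] := by
  rw [tripleGen.eq_def]
  split
  · rename_i t₁ e₁ t₂ e₂ n
    split_ifs with hc
    · obtain ⟨rfl, rfl, rfl, rfl⟩ := hc
      refine Submodule.smul_mem _ _ (vec_mem ?_)
      have hd := h.ldeg_K_three e₂ t
      have h2 : (1 + 1 : ZMod 2) = 0 := by decide
      cases n with
      | zero =>
        refine ⟨?_, ?_, ?_⟩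
        · rintro j i ⟨rfl, rfl⟩
          refine ⟨rfl, rfl, rfl, ?_⟩
          exact three_mul_dir _ _
        · simp [tail, spar]
        · simp only [K_succ, K_zero] at hd
          rw [hd]
          simp only [tail, ldeg_cons, ldeg_nil, sdeg]
          norm_num
      | succ n =>
        have hm := mul_gen (t + dir e₂ + dir e₂) e₂ n
        rw [three_mul_dir] at hm
        have hp := mul_props hm
        refine ⟨?_, ?_, ?_⟩
        · rintro j i ⟨rfl, rfl⟩
          exact ⟨rfl, rfl, rfl, hp.2.2⟩
        · simp only [tail, lpar_cons, lpar_nil, spar_mul hm]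
          simp only [spar, Nat.cast_zero]
          linear_combination -h2
        · simp only [K_succ, K_zero, ldeg_cons, ldeg_nil] at hd
          simp only [tail, ldeg_cons, ldeg_nil, sdeg_mul P Q hm]
          linear_combination -hd
    · exact Submodule.zero_mem _
  · exact Submodule.zero_mem _

/-- Replacing a full turn by an identity raises the shifted degree from `-2` to `-1`. Letters
carried along on either side do not change this difference. -/
theorem graded_triple (h : SumOne P Q) (κ : Bool → k) : Graded P Q (1, 1) (triple κ) := by
  intro l
  rw [triple, ofList_tensor]
  split
  · rename_i t e n r
    induction n generalizing t e with
    | zero => exact tripleGen_mem h κ t e r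
    | succ n ih =>
      refine map_mem_of_supp (bin (mu k) (vec k (alt t e 0))) _ (fun w hw => ?_) (ih _ _)
      change bin (mu k) (vec k (alt t e 0)) (vec k w) ∈ _
      rw [bin_vec]
      refine supp_mono (fun v hv => Rel.unmul (p := []) (mul_gen t e n) ?_)
        (graded_mu (P := P) (Q := Q) _)
      have := ((Rel.refl (P := P) (Q := Q) [alt t e 0]).append hw).trans hv
      rwa [zero_add] at this
  · exact Submodule.zero_mem _

theorem isCoc_hd_triple (h : SumOne P Q) (κ : Bool → k) :
    IsCoc P Q (1, 1) 3 (hd k 1 (triple κ)) where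
  graded := (graded_triple h κ).hd 1
  arity := (triple_arity κ).hd 1
  closed := hd_hd (graded_triple h κ) (triple_arity κ _ (by simp))

/-- Multiples of words which start with a letter of the given type. -/
theorem mu_alt_eq (t : ZMod 3) (e : Bool) (n : ℕ) (b : Alt) :
    mu k (tensor k [alt t e n, b]) ∈ supp k fun w => ∃ m, w = alt t e m := by
  rw [mu_pair]
  refine Submodule.smul_mem _ _ ?_
  cases b with
  | one i =>
    simp only [mul]
    split_ifs
    · exact vec_mem ⟨n, rfl⟩
    · exact Submodule.zero_mem _
  | alt t' e' n' =>
    simp only [mul]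
    split_ifs
    · exact vec_mem ⟨_, rfl⟩
    · exact Submodule.zero_mem _

theorem triple_append_mu (κ : Bool → k) (p r : List Alt) (t : ZMod 3) (e : Bool) (n : ℕ) (b : Alt)
    (h : ∀ m, triple κ (tensor k (p ++ alt t e m :: r)) = 0) :
    triple κ (appL p (consL (mu k (tensor k [alt t e n, b])) (tensor k r))) = 0 := by
  refine map_eq_zero_of_supp (triple κ ∘ₗ appL p ∘ₗ consL.flip (tensor k r)) ?_ (mu_alt_eq t e n b)
  rintro w ⟨m, rfl⟩
  change triple κ (appL p (consL (vec k (alt t e m)) (tensor k r))) = 0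
  rw [consL_vec_tensor, appL_tensor, h]

theorem triple_append_vec (κ : Bool → k) (p : List Alt) (a : Alt) (v : V k Alt)
    (h : ∀ b, triple κ (tensor k (p ++ [a, b])) = 0) :
    triple κ (appL p (consL (vec k a) (consL v (tensor k [])))) = 0 := by
  have hz : triple κ ∘ₗ appL p ∘ₗ consL (vec k a) ∘ₗ consL.flip (tensor k []) = 0 :=
    V_ext fun w => by simp [h]
  exact LinearMap.congr_fun hz v

theorem ne_gen_not (t : ZMod 3) (e : Bool) (n : ℕ) (s : ZMod 3) (m : ℕ) :
    alt t (!e) n ≠ alt s e m := by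
  intro h
  cases e <;> cases h

theorem ne_gen_succ (t : ZMod 3) (e : Bool) (n : ℕ) (s : ZMod 3) : alt t e (n + 1) ≠ alt s e 0 := by
  intro h
  cases h

/-- Two terms remain: the last letter of the chain merges with the word and is removed again, or the
chain is replaced by an identity which acts on the word. They agree and have opposite signs. -/
theorem hd_triple_append_two (κ : Bool → k) (e : Bool) (t : ZMod 3) (n : ℕ) (r : List Alt) :
    hd k 1 (triple κ) (tensor k (K e t (2 + 1)
      ++ alt (t + (((2 : ℕ) : ZMod 3) + 1) * dir e) (!e) n :: r)) = 0 := by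
  have h0 : triple κ (tensor k []) = 0 := triple_arity κ _ (by simp)
  have hc : Arity 4 (hd k 1 (triple κ)) := (triple_arity κ).hd 1
  cases r with
  | cons b r => exact hc _ (by simp; omega)
  | nil =>
    have e1 : t + (((2 : ℕ) : ZMod 3) + 1) * dir e = t := by
      rw [show ((2 : ℕ) : ZMod 3) + 1 = 0 from rfl, zero_mul, add_zero]
    have e2 : t + ((2 : ℕ) : ZMod 3) * dir e = t + dir e + dir e := by push_cast; ring
    have e3 := mu_gen (k := k) (t + dir e + dir e) e n
    rw [three_mul_dir] at e3
    have e4 : triple κ (tensor k (K e t 2 ++ [alt (t + dir e + dir e) e (n + 1)]))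
        = κ e • vec k (alt t (!e) n) :=
      (triple_gen κ t e _).trans (tripleGen_eq κ t e (n + 1))
    have e5 : triple κ (tensor k (K e (t + dir e) 2 ++ [alt t (!e) n])) = 0 :=
      (triple_gen κ _ _ _).trans (tripleGen_ne κ _ _ _ _ (fun s m => ne_gen_not _ _ _ _ _))
    have e6 : triple κ (tensor k (K e t (2 + 1))) = κ e • vec k (one t) := triple_K κ e t
    rw [hd_K_append _ _ h0, e1, e2, coder_single arity_mu, e3]
    simp only [map_neg, LinearMap.neg_apply, consL_vec_tensor, appL_tensor, map_zero, e4, e5,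
      rightFace, List.getLast?_singleton, Option.elim_some, List.dropLast_singleton,
      List.append_nil, e6, map_smul, LinearMap.smul_apply, bin_vec, paritySign_one]
    rw [mu_one_left (i := t) (w := alt t (!e) n) rfl]
    simp

/-- Every face contains, in its second or third place, a word of the wrong type or a second entry
with more than one letter, and `triple` vanishes on such lists. -/
theorem hd_triple_append_one (κ : Bool → k) (e : Bool) (t : ZMod 3) (n : ℕ) (r : List Alt) :
    hd k 1 (triple κ) (tensor k (K e t (1 + 1)
      ++ alt (t + (((1 : ℕ) : ZMod 3) + 1) * dir e) (!e) n :: r)) = 0 := by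
  have h0 : triple κ (tensor k []) = 0 := triple_arity κ _ (by simp)
  have hc : Arity 4 (hd k 1 (triple κ)) := (triple_arity κ).hd 1
  match r with
  | [] => exact hc _ (by simp)
  | _ :: _ :: _ => exact hc _ (by simp; omega)
  | [b] =>
    have e1 : ∀ m s s', triple κ (tensor k (K e s 2 ++ [alt s' (!e) m])) = 0 := fun m s s' =>
      (triple_gen κ _ _ _).trans (tripleGen_ne κ _ _ _ _ (fun s m => ne_gen_not _ _ _ _ _))
    have e2 : ∀ m s s', triple κ (tensor k (K e s 1 ++ [alt s' (!e) m, b])) = 0 := fun m s s' =>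
      (triple_gen κ _ _ _).trans (tripleGen_eq_zero κ _ _ _ _ (fun s => ne_gen_not _ _ _ _ _))
    have e3 : ∀ s s', triple κ (tensor k (K e s 1 ++ [alt s' e (n + 1), b])) = 0 := fun s s' =>
      (triple_gen κ _ _ _).trans (tripleGen_eq_zero κ _ _ _ _ (fun s => ne_gen_succ _ _ _ _))
    have e4 : t + ((1 : ℕ) : ZMod 3) * dir e + dir e = t + (((1 : ℕ) : ZMod 3) + 1) * dir e := by
      push_cast; ring
    have e5 := mu_gen (k := k) (t + ((1 : ℕ) : ZMod 3) * dir e) e n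
    rw [e4] at e5
    rw [hd_K_append _ _ h0, coder_cons_cons arity_mu, coder_single arity_mu, e5, map_add, map_add,
      triple_append_mu κ _ _ _ _ _ _ (fun m => e1 m _ _)]
    simp only [map_neg, LinearMap.neg_apply, consL_vec_tensor, appL_tensor, map_zero, smul_zero,
      e2, e3, rightFace, List.getLast?_cons_cons, List.getLast?_singleton, Option.elim_some,
      List.dropLast_cons_cons, List.dropLast_singleton, e1, LinearMap.zero_apply]
    simp

/-- The face that merges the first two entries cancels the left outer face; this is the recursion
`triple_succ`. The other faces have a second entry of the wrong type. -/
theorem hd_triple_append_zero (κ : Bool → k) (e : Bool) (t : ZMod 3) (n : ℕ) (r : List Alt) :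
    hd k 1 (triple κ) (tensor k (K e t (0 + 1)
      ++ alt (t + (((0 : ℕ) : ZMod 3) + 1) * dir e) (!e) n :: r)) = 0 := by
  have h0 : triple κ (tensor k []) = 0 := triple_arity κ _ (by simp)
  have hc : Arity 4 (hd k 1 (triple κ)) := (triple_arity κ).hd 1
  match r with
  | [] => exact hc _ (by simp)
  | [_] => exact hc _ (by simp)
  | _ :: _ :: _ :: _ => exact hc _ (by simp; omega)
  | [b, b'] =>
    have e1 : ∀ m s s' b, triple κ (tensor k (K e s (0 + 1) ++ [alt s' (!e) m, b])) = 0 :=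
      fun m s s' b => (triple_gen κ _ _ _).trans
        (tripleGen_eq_zero κ _ _ _ _ (fun s => ne_gen_not _ _ _ _ _))
    have e2 : t + ((0 : ℕ) : ZMod 3) * dir e = t := by simp
    have e3 : t + (((0 : ℕ) : ZMod 3) + 1) * dir e = t + dir e := by simp
    have e4 : triple κ (appL (K e t (0 + 1)) (consL (vec k (alt (t + dir e) (!e) n))
        (coder (sg k) (mu k) (tensor k [b, b'])))) = 0 := by
      rw [coder_cons_cons arity_mu, coder_single arity_mu, map_zero, smul_zero,
        zero_add (consL (mu k (tensor k [b, b'])) (tensor k []))]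
      exact triple_append_vec κ (K e t (0 + 1)) (alt (t + dir e) (!e) n) (mu k (tensor k [b, b'])) fun w => e1 n t (t + dir e) w
    rw [hd_K_append _ _ h0, e2, e3, coder_cons_cons arity_mu, mu_gen, map_add, map_add, map_smul,
      map_smul, e4, triple_append_mu κ (K e t (0 + 1)) [b'] _ _ _ _ (fun m => e1 m t (t + dir e) b')]
    simp only [map_neg, LinearMap.neg_apply, consL_vec_tensor, appL_nil, triple_succ,
      rightFace, List.getLast?_cons_cons, List.getLast?_singleton, Option.elim_some,
      List.dropLast_cons_cons, List.dropLast_singleton, e1, LinearMap.zero_apply, map_zero,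
      paritySign_one, K_zero, List.nil_append, smul_zero]
    simp

/-- The differential of `triple` is a normalized cocycle. By `koszul_step` with zero homotopy it
suffices to check it on full chains and on a chain followed by a word of the other type; then
`eq_zero_of_vanishK_one` applies. -/
theorem hd_triple (h : SumOne P Q) (κ : Bool → k) : hd k 1 (triple κ) = 0 := by
  have hc := isCoc_hd_triple h κ
  have h0 : triple κ (tensor k []) = 0 := triple_arity κ _ (by simp)
  have hn : Normalized (hd k 1 (triple κ)) :=
    Normalized.hd (η := (1, 1)) (triple_normalized κ) (graded_triple h κ) (by norm_num) (triple_arity κ)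
  have step : ∀ j, j + 1 ≤ 3 → VanishK (j + 2) (hd k 1 (triple κ)) →
      (∀ e t n r, hd k 1 (triple κ)
        (tensor k (K e t (j + 1) ++ alt (t + (j + 1) * dir e) (!e) n :: r)) = 0) →
      VanishK (j + 1) (hd k 1 (triple κ)) := by
    intro j hj hv hz
    have := koszul_step (h := 0) hc hj hn hv (fun l => Submodule.zero_mem _) (fun _ _ => rfl)
      (fun _ _ _ => rfl) (fun _ _ _ => rfl) (fun e t n r => by rw [hz]; simp)
    rw [hd_zero_apply] at this
    intro e t r
    simpa using this e t r
  -- On a chain of length four the two outer faces multiply the first letter by an identity from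
  -- either side. They cancel, because `κ` does not depend on the position.
  have h₄ : VanishK 4 (hd k 1 (triple κ)) := by
    intro e t r
    cases r with
    | cons a r => exact hc.arity _ (by simp)
    | nil =>
      rw [List.append_nil, hd_K _ _ h0, triple_K, triple_K]
      have e1 : t + ((3 : ℕ) : ZMod 3) * dir e = t := by
        rw [show ((3 : ℕ) : ZMod 3) = 0 from rfl, zero_mul, add_zero]
      have e2 := mu_one_left (k := k) (i := t) (w := alt t e 0) rfl
      have e3 := mu_one_right (k := k) (i := t + dir e) (w := alt t e 0) rfl
      rw [e1, map_smul, map_smul, LinearMap.smul_apply, bin_vec, bin_vec, e2, e3, sg_gen]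
      simp
  exact eq_zero_of_vanishK_one hc hn (step 0 (by norm_num)
    (step 1 (by norm_num) (step 2 le_rfl h₄ (hd_triple_append_two κ)) (hd_triple_append_one κ))
    (hd_triple_append_zero κ))

end Triple

end Bar

namespace Bar

open Alt

/-! ### Construction of structures and of homotopies -/

section Existence

variable {k : Type*} [Field k] {P Q : ZMod 3 → ℚ}

theorem applyInit_congr {W : Type*} {φ ψ : T k W →ₗ[k] V k W} {l : List W}
    (h : ∀ l' : List W, l'.length ≤ l.length → φ (tensor k l') = ψ (tensor k l')) :
    applyInit φ (tensor k l) = applyInit ψ (tensor k l) := by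
  rw [applyInit_tensor, applyInit_tensor]
  exact splitSum_congr fun x y hxy => by rw [h x (by rw [← hxy]; simp)]

theorem coder_congr {W : Type*} (τ : W → k) {φ ψ : T k W →ₗ[k] V k W} {l : List W}
    (h : ∀ l' : List W, l'.length ≤ l.length → φ (tensor k l') = ψ (tensor k l')) :
    coder τ φ (tensor k l) = coder τ ψ (tensor k l) := by
  induction l with
  | nil => simp
  | cons w l ih =>
    rw [coder_cons, coder_cons, applyInit_congr h,
      ih fun l' hl' => h l' (hl'.trans (by simp))]

theorem cohom_congr {W : Type*} {f g : T k W →ₗ[k] V k W} (l : List W)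
    (h : ∀ l' : List W, l'.length ≤ l.length → f (tensor k l') = g (tensor k l')) :
    cohom f (tensor k l) = cohom g (tensor k l) := by
  induction l using length_induction with
  | _ l ih =>
    cases l with
    | nil => simp
    | cons w l =>
      rw [cohom_cons, cohom_cons]
      refine splitSum_congr fun x y hxy => ?_
      have hlen : x.length + y.length = l.length := by rw [← hxy]; simp
      rw [h (w :: x) (by simp; omega), ih y (by simp; omega)
        (fun l' hl' => h l' (by simp; omega))]

theorem comp_coder_congr {W : Type*} (τ : W → k) {b b' : T k W →ₗ[k] V k W}
    (hb : b (tensor k []) = 0) {l : List W}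
    {f f' : T k W →ₗ[k] V k W}
    (h : ∀ l' : List W, l'.length ≤ l.length → b (tensor k l') = b' (tensor k l'))
    (h' : ∀ l' : List W, l'.length ≤ l.length → f (tensor k l') = f' (tensor k l')) :
    f (coder τ b (tensor k l)) = f' (coder τ b' (tensor k l)) := by
  rw [← coder_congr τ h]
  have hk : Kills 0 b := fun l hl => by
    rw [List.length_eq_zero_iff.1 (Nat.le_zero.1 hl), hb]
  exact map_eq_of_mem _ _ (fun l' hl' => h' l' (by omega)) (hk.coder_mem τ l)

/-- A perturbation of the multiplication. -/
structure IsPert (P Q : ZMod 3 → ℚ) (b : T k Alt →ₗ[k] V k Alt) : Prop where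
  graded : Graded P Q (1, 1) b
  starts : Starts (mu k) b

theorem IsPert.tw {b : T k Alt →ₗ[k] V k Alt} (hb : IsPert P Q b) : Tw (sg k) (-1) b := by
  have := hb.graded.tw
  rwa [paritySign_one] at this

/-- The bar form of an `A_∞`-structure. -/
structure IsAInf (P Q : ZMod 3 → ℚ) (b : T k Alt →ₗ[k] V k Alt) : Prop extends IsPert P Q b where
  ainf : b ∘ₗ coder (sg k) b = 0

theorem starts_mu_add {g : T k Alt →ₗ[k] V k Alt} {b : T k Alt →ₗ[k] V k Alt}
    (hb : Starts (mu k) b) {n : ℕ} (hn : 3 ≤ n) (hg : Arity n g) : Starts (mu k) (b + g) := by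
  refine ⟨fun l hl => ?_, fun l hl => ?_⟩
  · rw [LinearMap.add_apply, hb.1 l hl, hg l (by omega), add_zero]
  · rw [LinearMap.add_apply, hb.2 l hl, hg l (by omega), add_zero]

theorem IsPert.mu : IsPert P Q (mu k) :=
  ⟨graded_mu, arity_mu.kills (by norm_num), fun _ _ => rfl⟩

/-- The obstruction has shifted degree `2`. This is even, so identities do not occur, and a first
letter occurs only for `2m = 2`, that is, on chains of length four; since `n + 1 ≥ 5` this is
excluded. -/
theorem ainf_step (h : SumOne P Q) {n : ℕ} (hn : 4 ≤ n) {b : T k Alt →ₗ[k] V k Alt}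
    (hb : IsPert P Q b) (hk : Kills n (b ∘ₗ coder (sg k) b)) :
    ∃ b', (IsPert P Q b' ∧ Kills (n + 1) (b' ∘ₗ coder (sg k) b')) ∧
      ∀ l : List Alt, l.length < n → b' (tensor k l) = b (tensor k l) := by
  set c := trunc (n + 1) (b ∘ₗ coder (sg k) b) with hcdef
  have hcl := ainf_obstruction sg_mul_self arity_mu hb.starts hb.tw hk
  have hc : IsCoc P Q (1, 1) n c := by
    refine ⟨(hb.graded.comp_coder hb.graded _).trunc _, arity_trunc _ _, ?_⟩
    rw [show ((1, 1) + (1, 1) : ZMod 2 × ℚ).1 = 0 from rfl, hd_zero]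
    exact hcl
  obtain ⟨g, hg₁, hg₂, hg₃⟩ := exists_hd_eq hc (by omega)
    (fun e t => hc.graded.apply_eq_zero fun hr => by
      obtain ⟨m, -, hm⟩ := h.rel_one hr
      have h1 : ((2 * m - 1 : ℤ) : ℚ) = (2 : ℤ) := by push_cast; rw [← hm]; norm_num
      have := Int.cast_injective h1
      omega)
    (fun e t hr => by
      obtain ⟨m, h₁, h₂⟩ := h.rel_gen hr
      have h1 : ((2 * m : ℤ) : ℚ) = (2 : ℤ) := by push_cast; rw [← h₂]; norm_num
      have := Int.cast_injective h1
      omega)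
  have hg' : Arity n (-g) := fun l hl => by rw [LinearMap.neg_apply, hg₂ l hl, neg_zero]
  refine ⟨b + -g, ⟨⟨hb.graded.add hg₁.neg, starts_mu_add hb.starts (by omega) hg'⟩, fun l hl => ?_⟩,
    fun l hl => by rw [LinearMap.add_apply, hg' l (by omega), add_zero]⟩
  rw [LinearMap.comp_apply, ainf_perturb arity_mu hb.starts (by omega) hg' hl, hoch_neg, ← hd_one,
    LinearMap.neg_apply, show hd k 1 g = c from hg₃.symm]
  rcases eq_or_ne l.length (n + 1) with h' | h'
  · rw [hcdef, trunc_of_eq _ h']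
    exact add_neg_cancel _
  · rw [hcdef, trunc_of_ne _ h', neg_zero, add_zero]
    exact hk l (by omega)

/-- The induction starts with `mu + triple κ`. Later corrections have arity at least four and do not
touch the prescribed values on chains of length three. -/
theorem exists_ainf (h : SumOne P Q) (κ : Bool → k) : ∃ b : T k Alt →ₗ[k] V k Alt,
    IsAInf P Q b ∧ ∀ e t, b (tensor k (K e t 3)) = κ e • vec k (one t) := by
  have h₀ : (IsPert P Q (mu k + triple κ) ∧
      Kills 4 ((mu k + triple κ) ∘ₗ coder (sg k) (mu k + triple κ))) ∧
      ∀ e t, (mu k + triple κ) (tensor k (K e t 3)) = κ e • vec k (one t) := by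
    refine ⟨⟨⟨graded_mu.add (graded_triple h κ),
      starts_mu_add (IsPert.mu (P := P) (Q := Q)).starts le_rfl (triple_arity κ)⟩, fun l hl => ?_⟩, fun e t => ?_⟩
    -- Up to length four the equation is linear in `triple κ`; its quadratic term begins in length
    -- five. So associativity and `hd_triple` suffice.
    · rw [LinearMap.comp_apply, ainf_perturb arity_mu (IsPert.mu (P := P) (Q := Q)).starts le_rfl
        (triple_arity κ) hl, ← hd_one, hd_triple h κ]
      have := LinearMap.congr_fun (mu_assoc (k := k)) (tensor k l)
      rw [LinearMap.comp_apply] at this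
      rw [this]
      simp
    · rw [LinearMap.add_apply, arity_mu _ (by rw [length_K]; norm_num), triple_K, zero_add]
  obtain ⟨b, hb⟩ := exists_limit (P := fun n b => (IsPert P Q b ∧ Kills n (b ∘ₗ coder (sg k) b)) ∧
      ∀ e t, b (tensor k (K e t 3)) = κ e • vec k (one t)) h₀ (fun n b hn hb => by
    obtain ⟨b', h₁, h₂⟩ := ainf_step h hn hb.1.1 hb.1.2
    exact ⟨b', ⟨h₁, fun e t => by rw [h₂ _ (by rw [length_K]; omega), hb.2]⟩, h₂⟩)
  have key : ∀ n, ∃ b', (IsPert P Q b' ∧ Kills n (b' ∘ₗ coder (sg k) b')) ∧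
      (∀ e t, b' (tensor k (K e t 3)) = κ e • vec k (one t)) ∧
      ∀ l : List Alt, l.length ≤ n → b (tensor k l) = b' (tensor k l) := by
    intro n
    obtain ⟨b', h₁, h₂⟩ := hb (n + 4) (by omega)
    exact ⟨b', ⟨h₁.1.1, fun l hl => h₁.1.2 l (by omega)⟩, h₁.2, fun l hl => h₂ l (by omega)⟩
  refine ⟨b, ⟨⟨fun l => ?_, fun l hl => ?_, fun l hl => ?_⟩, T_ext fun l => ?_⟩, fun e t => ?_⟩
  · obtain ⟨b', h₁, h₂, h₃⟩ := key l.length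
    rw [h₃ l le_rfl]
    exact h₁.1.graded l
  · obtain ⟨b', h₁, h₂, h₃⟩ := key l.length
    rw [h₃ l le_rfl]
    exact h₁.1.starts.1 l hl
  · obtain ⟨b', h₁, h₂, h₃⟩ := key l.length
    rw [h₃ l le_rfl]
    exact h₁.1.starts.2 l hl
  · obtain ⟨b', h₁, h₂, h₃⟩ := key l.length
    rw [LinearMap.comp_apply, comp_coder_congr (sg k)
      (by rw [h₃ [] (by simp)]; exact h₁.1.starts.1 [] (by simp)) h₃ h₃]
    exact h₁.2 l le_rfl
  · obtain ⟨b', h₁, h₂, h₃⟩ := key 3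
    rw [h₃ _ (by rw [length_K]), h₂]

/-- The bar form of a family of operations of degree `1 - r` whose first one is the identity. -/
structure IsUnipotent (P Q : ZMod 3 → ℚ) (f : T k Alt →ₗ[k] V k Alt) : Prop where
  graded : Graded P Q 0 f
  nil : f (tensor k []) = 0
  single : ∀ w, f (tensor k [w]) = vec k w

theorem IsUnipotent.tw {f : T k Alt →ₗ[k] V k Alt} (hf : IsUnipotent P Q f) :
    Tw (sg k) 1 f := by
  have := hf.graded.tw
  rwa [show (0 : ZMod 2 × ℚ).1 = 0 from rfl, paritySign_zero] at this

theorem IsUnipotent.consL_nil {f : T k Alt →ₗ[k] V k Alt} (hf : IsUnipotent P Q f) (v : V k Alt) :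
    f (consL v (tensor k [])) = v := by
  have : f ∘ₗ consL.flip (tensor k []) = LinearMap.id := V_ext fun w => by simp [hf.single]
  exact LinearMap.congr_fun this v

theorem IsUnipotent.pr : IsUnipotent P Q (pr : T k Alt →ₗ[k] V k Alt) := by
  refine ⟨fun l => ?_, pr_nil, pr_single⟩
  match l with
  | [] => rw [pr_nil]; exact Submodule.zero_mem _
  | [w] => rw [pr_single]; exact vec_mem (Rel.refl _)
  | _ :: _ :: _ => rw [pr_cons_cons]; exact Submodule.zero_mem _

theorem Starts.bin_eq {b : T k Alt →ₗ[k] V k Alt} (hb : Starts (mu k) b) (x y : V k Alt) :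
    b (consL x (consL y (tensor k []))) = bin (mu k) x y := by
  have h₁ : ∀ w w', b (tensor k [w, w']) = bin (mu k) (vec k w) (vec k w') := fun w w' => by
    rw [hb.2 _ rfl, bin_vec]
  have h₂ : ∀ w, b ∘ₗ consL (vec k w) ∘ₗ consL.flip (tensor k []) = bin (mu k) (vec k w) :=
    fun w => V_ext fun w' => by simp [h₁]
  have h₃ : b ∘ₗ consL.flip (consL y (tensor k [])) = (bin (mu k)).flip y :=
    V_ext fun w => LinearMap.congr_fun (h₂ w) y
  exact LinearMap.congr_fun h₃ x

/-- Products of neighbours in the chain vanish, so `f_2` does not enter on the side of `b`. On the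
side of `b'` it enters only in products with a generator, which have no constant term. -/
theorem defect_K_three {b b' f : T k Alt →ₗ[k] V k Alt} (hb : IsPert P Q b) (hb' : IsPert P Q b')
    (hf : IsUnipotent P Q f) (e : Bool) (t : ZMod 3) :
    defect (sg k) b b' f (tensor k (K e t 3)) (one t)
      = b (tensor k (K e t 3)) (one t) - b' (tensor k (K e t 3)) (one t) := by
  have hb0 := hb.starts.1 [] (by simp)
  have hb1 : ∀ w, b (tensor k [w]) = 0 := fun w => hb.starts.1 _ (by simp)
  have hb1' : ∀ v, b' (consL v (tensor k [])) = 0 := fun v => by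
    have : b' ∘ₗ consL.flip (tensor k []) = 0 := V_ext fun w => by
      simp [hb'.starts.1 [w] (by simp)]
    exact LinearMap.congr_fun this v
  have hb2 : ∀ t t' : ZMod 3, b (tensor k [alt t e 0, alt t' e 0]) = 0 := fun t t' => by
    rw [hb.starts.2 _ rfl, mu_gen_gen]
  rw [defect_apply]
  have e1 : coder (sg k) b (tensor k (K e t 3)) = consL (b (tensor k (K e t 3))) (tensor k []) := by
    simp only [K_succ, K_zero, coder_cons, coder_nil, applyInit_tensor, splitSum_cons, splitSum_nil,
      hb0, hb1, hb2]
    simp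
  have e2 : cohom f (tensor k (K e t 3)) = tensor k (K e t 3)
      + consL (f (tensor k [alt t e 0, alt (t + dir e) e 0]))
        (consL (vec k (alt (t + dir e + dir e) e 0)) (tensor k []))
      + consL (vec k (alt t e 0))
        (consL (f (tensor k [alt (t + dir e) e 0, alt (t + dir e + dir e) e 0])) (tensor k []))
      + consL (f (tensor k (K e t 3))) (tensor k []) := by
    simp only [K_succ, K_zero, cohom_cons, cohom_nil, splitSum_cons, splitSum_nil, hf.single]
    simp only [consL_vec_tensor, map_add]
    abel
  rw [e1, e2, hf.consL_nil, map_add, map_add, map_add, hb1', hb'.starts.bin_eq, hb'.starts.bin_eq]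
  simp only [Finsupp.sub_apply, Finsupp.add_apply, bin_apply_gen_one, bin_gen_apply_one, add_zero]

/-- The obstruction has shifted degree `1`. This is odd, so the first letter of a chain does not
occur, and identities occur only for `2m - 1 = 1`, on chains of length three. There the equality of
the constants of `b` and `b'` is needed. -/
theorem functor_step (h : SumOne P Q) {n : ℕ} (hn : 2 ≤ n) {b b' f : T k Alt →ₗ[k] V k Alt}
    (hb : IsAInf P Q b) (hb' : IsAInf P Q b') (hf : IsUnipotent P Q f)
    (hbb : ∀ e, b (tensor k (K e 1 3)) (one 1) = b' (tensor k (K e 1 3)) (one 1))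
    (hk : Kills n (defect (sg k) b b' f)) :
    ∃ f', (IsUnipotent P Q f' ∧ Kills (n + 1) (defect (sg k) b b' f')) ∧
      ∀ l : List Alt, l.length < n → f' (tensor k l) = f (tensor k l) := by
  set c := trunc (n + 1) (defect (sg k) b b' f) with hcdef
  have hcl := functor_obstruction sg_mul_self arity_mu hb.starts hb'.starts hb.tw hb'.tw hb.ainf
    hb'.ainf hf.nil hf.single hf.tw hk
  have hc : IsCoc P Q 0 n c := by
    refine ⟨?_, arity_trunc _ _, ?_⟩
    · rw [zero_add]
      exact (hb.graded.defect hb'.graded hf.graded hf.nil).trunc _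
    · rw [zero_add, hd_one]
      exact hcl
  have hone : ∀ e t, c (tensor k (K e t (n + 1))) (one t) = 0 := by
    intro e
    rcases hn.eq_or_lt with rfl | hn'
    · have h1 : c (tensor k (K e 1 3)) (one 1) = 0 := by
        rw [hcdef, trunc_of_eq _ (length_K _ _ _), defect_K_three hb.toIsPert hb'.toIsPert hf, hbb,
          sub_self]
      -- The hypothesis only concerns the object `X_1`. The cocycle equation on a chain of length
      -- four, at the coefficient of its first letter, says that the constants at neighbouring
      -- objects agree.
      have h2 : ∀ t, c (tensor k (K e t 3)) (one t) = 0 →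
          c (tensor k (K e (t + dir e) 3)) (one (t + dir e)) = 0 := by
        intro t ht
        have h3 := LinearMap.congr_fun hc.closed (tensor k (K e t (3 + 1)))
        rw [hd_K _ _ (hc.arity [] (by simp)), LinearMap.zero_apply, zero_add, paritySign_one,
          neg_neg, one_smul, show ((3 : ℕ) : ZMod 3) = 0 from rfl, zero_mul, add_zero] at h3
        have h4 := DFunLike.congr_fun h3 (alt t e 0)
        rw [Finsupp.add_apply, bin_apply_gen_zero, bin_gen_apply_zero, if_pos ⟨rfl, rfl⟩,
          if_pos ⟨rfl, rfl⟩, ht] at h4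
        simpa using h4
      intro t
      have h3 : t = 1 ∨ t = 1 + dir e ∨ t = 1 + dir e + dir e :=
        (by decide : ∀ (t : ZMod 3) (e : Bool), t = 1 ∨ t = 1 + dir e ∨ t = 1 + dir e + dir e) t e
      rcases h3 with rfl | rfl | rfl
      · exact h1
      · exact h2 _ h1
      · exact h2 _ (h2 _ h1)
    · intro t
      refine hc.graded.apply_eq_zero fun hr => ?_
      obtain ⟨m, h₁, hm⟩ := h.rel_one hr
      have h1 : ((2 * m - 1 : ℤ) : ℚ) = (1 : ℤ) := by push_cast; rw [← hm]; norm_num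
      have := Int.cast_injective h1
      omega
  obtain ⟨g, hg₁, hg₂, hg₃⟩ := exists_hd_eq hc (by omega) hone
    (fun e t hr => by
      obtain ⟨m, h₁, h₂⟩ := h.rel_gen hr
      have h1 : ((2 * m : ℤ) : ℚ) = (1 : ℤ) := by push_cast; rw [← h₂]; norm_num
      have := Int.cast_injective h1
      omega)
  have hg' : Arity n (-g) := fun l hl => by rw [LinearMap.neg_apply, hg₂ l hl, neg_zero]
  refine ⟨f + -g, ⟨⟨hf.graded.add hg₁.neg, ?_, fun w => ?_⟩, fun l hl => ?_⟩,
    fun l hl => by rw [LinearMap.add_apply, hg' l (by omega), add_zero]⟩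
  · rw [LinearMap.add_apply, hg' [] (by simp; omega), hf.nil, add_zero]
  · rw [LinearMap.add_apply, hg' [w] (by simp; omega), hf.single, add_zero]
  rw [functor_perturb arity_mu hb.starts hb'.starts hn hg' hf.nil hf.single hl, hoch_neg, ← hd_zero,
    LinearMap.neg_apply, show hd k 0 g = c from hg₃.symm]
  rcases eq_or_ne l.length (n + 1) with h' | h'
  · rw [hcdef, trunc_of_eq _ h']
    exact add_neg_cancel _
  · rw [hcdef, trunc_of_ne _ h', neg_zero, add_zero]
    exact hk l (by omega)

/-- The induction starts with the identity, which solves the functor equation up to length two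
because both structures start with the same product. -/
theorem exists_functor (h : SumOne P Q) {b b' : T k Alt →ₗ[k] V k Alt}
    (hb : IsAInf P Q b) (hb' : IsAInf P Q b')
    (hbb : ∀ e, b (tensor k (K e 1 3)) (one 1) = b' (tensor k (K e 1 3)) (one 1)) :
    ∃ f, IsUnipotent P Q f ∧ defect (sg k) b b' f = 0 := by
  have h₀ : IsUnipotent P Q (pr (k := k)) ∧ Kills 2 (defect (sg k) b b' pr) := by
    refine ⟨.pr, fun l hl => ?_⟩
    have hD := LinearMap.congr_fun (pr_coder (sg k) b (hb.starts.1 [] (by simp))) (tensor k l)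
    rw [LinearMap.comp_apply] at hD
    rw [defect_apply, hD]
    match l, hl with
    | [], _ => rw [cohom_nil, hb.starts.1 _ (by simp), hb'.starts.1 _ (by simp), sub_zero]
    | [w], _ =>
      rw [cohom_short (f := pr (k := k)) pr_single (by simp), hb.starts.1 _ (by simp), hb'.starts.1 _ (by simp),
        sub_zero]
    | [w, w'], _ =>
      have : cohom (pr (k := k)) (tensor k [w, w']) = tensor k [w, w'] := by simp [cohom_cons]
      rw [this, hb.starts.2 _ rfl, hb'.starts.2 _ rfl, sub_self]
  obtain ⟨f, hf⟩ := exists_limit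
    (P := fun n f => IsUnipotent P Q f ∧ Kills n (defect (sg k) b b' f)) h₀ (fun n f hn hf =>
      functor_step h hn hb hb' hf.1 hbb hf.2)
  have key : ∀ n, ∃ f', (IsUnipotent P Q f' ∧ Kills n (defect (sg k) b b' f')) ∧
      ∀ l : List Alt, l.length ≤ n → f (tensor k l) = f' (tensor k l) := by
    intro n
    obtain ⟨f', h₁, h₂⟩ := hf (n + 2) (by omega)
    exact ⟨f', ⟨h₁.1, fun l hl => h₁.2 l (by omega)⟩, fun l hl => h₂ l (by omega)⟩
  refine ⟨f, ⟨fun l => ?_, ?_, fun w => ?_⟩, T_ext fun l => ?_⟩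
  · obtain ⟨f', h₁, h₂⟩ := key l.length
    rw [h₂ l le_rfl]
    exact h₁.1.graded l
  · obtain ⟨f', h₁, h₂⟩ := key 0
    rw [h₂ [] le_rfl, h₁.1.nil]
  · obtain ⟨f', h₁, h₂⟩ := key 1
    rw [h₂ [w] le_rfl, h₁.1.single]
  · obtain ⟨f', h₁, h₂⟩ := key l.length
    rw [defect_apply, comp_coder_congr (sg k) (hb.starts.1 [] (by simp)) (fun _ _ => rfl) h₂,
      cohom_congr l h₂]
    exact h₁.2 l le_rfl

end Existence

end Bar

/-! ## Words of the category and alternating words -/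

namespace Word

/-- The alternating word of a monomial. -/
def toAlt : Word 3 → Alt
  | one i => .one i
  | x i n => .alt i false (2 * n + 1)
  | y i n => .alt i true (2 * n + 1)
  | xu i n => .alt i false (2 * n)
  | vx i n => .alt (i - 1) true (2 * n)

/-- The monomial of an alternating word. -/
def ofAlt : Alt → Word 3
  | .one i => one i
  | .alt t e n => if n % 2 = 0 then (if e then vx (t + 1) (n / 2) else xu t (n / 2))
      else (if e then y t (n / 2) else x t (n / 2))

@[simp] theorem ofAlt_toAlt (w : Word 3) : ofAlt w.toAlt = w := by
  cases w <;> simp [toAlt, ofAlt, Nat.add_mod] <;> omega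

@[simp] theorem toAlt_ofAlt (w : Alt) : (ofAlt w).toAlt = w := by
  cases w with
  | one i => rfl
  | alt t e n =>
    rcases Nat.mod_two_eq_zero_or_one n with hn | hn <;> cases e <;>
      simp [toAlt, ofAlt, hn] <;> omega

theorem toAlt_injective : Function.Injective toAlt :=
  Function.LeftInverse.injective ofAlt_toAlt

theorem src_toAlt (w : Word 3) : w.toAlt.src = w.src := by
  cases w <;> simp [toAlt, Alt.src, src, Alt.dir, Nat.add_mod, sub_eq_add_neg]

theorem tgt_toAlt (w : Word 3) : w.toAlt.tgt = w.tgt := by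
  cases w <;> simp [toAlt, Alt.tgt, tgt]

theorem spar_toAlt (w : Word 3) : w.toAlt.spar = w.par + 1 := by
  have h2 : (2 : ZMod 2) = 0 := rfl
  have h3 : (1 + 1 : ZMod 2) = 0 := rfl
  cases w <;> simp [toAlt, Alt.spar, par, h2, h3]

theorem sdeg_toAlt (P Q : ZMod 3 → ℚ) (w : Word 3) : w.toAlt.sdeg P Q = w.deg P Q - 1 := by
  cases w with
  | one i => simp [toAlt, Alt.sdeg, deg]
  | x i n =>
    simp only [toAlt, Alt.sdeg, deg]
    rw [show (2 * n + 1 + 2) / 2 = n + 1 by omega, show (2 * n + 1 + 1) / 2 = n + 1 by omega]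
    push_cast
    simp
    ring
  | y i n =>
    simp only [toAlt, Alt.sdeg, deg]
    rw [show (2 * n + 1 + 2) / 2 = n + 1 by omega, show (2 * n + 1 + 1) / 2 = n + 1 by omega]
    push_cast
    simp
    ring
  | xu i n =>
    simp only [toAlt, Alt.sdeg, deg]
    rw [show (2 * n + 2) / 2 = n + 1 by omega, show (2 * n + 1) / 2 = n by omega]
    push_cast
    simp
    ring
  | vx i n =>
    simp only [toAlt, Alt.sdeg, deg]
    rw [show (2 * n + 2) / 2 = n + 1 by omega, show (2 * n + 1) / 2 = n by omega]
    push_cast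
    simp
    ring

/-- The case distinction in `Word.mul` is concatenation of alternating words: the ten nonzero
products are those in which the two words alternate at the junction, or one of them is an identity.
-/
theorem mul_toAlt {w₂ w₁ : Word 3} (h : w₁.tgt = w₂.src) :
    Alt.mul w₂.toAlt w₁.toAlt = (mul w₂ w₁).map toAlt := by
  cases w₂ with
  | one i => rw [toAlt, Alt.mul_one_left (by rw [tgt_toAlt]; exact h)]; rfl
  | _ =>
    cases w₁ with
    | one i =>
      rw [show toAlt (one i) = .one i from rfl, Alt.mul_one_right (by rw [src_toAlt]; exact h.symm)]
      rfl
    | _ =>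
      simp only [tgt, src] at h
      simp [toAlt, Alt.mul, Alt.src, Alt.nxt, mul, Alt.dir, h, Nat.add_mod] <;>
      first
        | omega
        | exact ⟨by ring, by omega⟩

end Word

namespace Bar

open Alt

/-! ### Morphisms and chains as tensors of alternating words -/

section Translation

variable {k : Type*} [Field k]

/-- A morphism as a combination of alternating words. -/
noncomputable def inc {X Y : CatA 3 k} : (X ⟶ Y) →ₗ[k] V k Alt :=
  show (Mon X.idx Y.idx →₀ k) →ₗ[k] V k Alt from
    Finsupp.lmapDomain k k fun w : Mon X.idx Y.idx => w.1.toAlt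

/-- An alternating word as a morphism, zero if the endpoints do not fit. -/
noncomputable def wordHom (X Y : CatA 3 k) (w : Alt) : X ⟶ Y :=
  show Mon X.idx Y.idx →₀ k from
    if h : (Word.ofAlt w).src = X.idx ∧ (Word.ofAlt w).tgt = Y.idx then
      Finsupp.single ⟨Word.ofAlt w, h⟩ 1 else 0

/-- The part of a combination of alternating words which lies in a morphism space. -/
noncomputable def res (X Y : CatA 3 k) : V k Alt →ₗ[k] (X ⟶ Y) :=
  Finsupp.linearCombination k (wordHom X Y)

@[simp] theorem res_vec (X Y : CatA 3 k) (w : Alt) : res X Y (vec k w) = wordHom X Y w := by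
  simp [res, vec]

theorem src_ofAlt (w : Alt) : (Word.ofAlt w).src = w.src := by
  rw [← Word.src_toAlt, Word.toAlt_ofAlt]

theorem tgt_ofAlt (w : Alt) : (Word.ofAlt w).tgt = w.tgt := by
  rw [← Word.tgt_toAlt, Word.toAlt_ofAlt]

theorem wordHom_eq {X Y : CatA 3 k} {w : Alt} (h : w.src = X.idx ∧ w.tgt = Y.idx) :
    wordHom X Y w = (Finsupp.single (⟨Word.ofAlt w, by rwa [src_ofAlt, tgt_ofAlt]⟩ :
      Mon X.idx Y.idx) 1 : Mon X.idx Y.idx →₀ k) :=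
  dif_pos (by rwa [src_ofAlt, tgt_ofAlt])

theorem wordHom_eq_zero {X Y : CatA 3 k} {w : Alt} (h : ¬ (w.src = X.idx ∧ w.tgt = Y.idx)) :
    wordHom X Y w = 0 :=
  dif_neg (by rwa [src_ofAlt, tgt_ofAlt])

theorem inc_wordHom {X Y : CatA 3 k} {w : Alt} (h : w.src = X.idx ∧ w.tgt = Y.idx) :
    inc (wordHom X Y w) = vec k w := by
  rw [wordHom_eq h]
  refine (Finsupp.mapDomain_single).trans ?_
  rw [Word.toAlt_ofAlt, vec]

/-- Linear maps on a morphism space are compared on basis words with the right endpoints; this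
reduces the comparison of the two models to words. -/
theorem hom_ext {X Y : CatA 3 k} {M : Type*} [AddCommGroup M] [Module k M]
    {f g : (X ⟶ Y) →ₗ[k] M}
    (h : ∀ w : Alt, w.src = X.idx → w.tgt = Y.idx → f (wordHom X Y w) = g (wordHom X Y w)) :
    f = g := by
  refine Finsupp.lhom_ext' (M := k) (α := Mon X.idx Y.idx) fun w => LinearMap.ext_ring ?_
  have h1 := h w.1.toAlt (by rw [Word.src_toAlt]; exact w.2.1) (by rw [Word.tgt_toAlt]; exact w.2.2)
  rw [wordHom_eq ⟨by rw [Word.src_toAlt]; exact w.2.1, by rw [Word.tgt_toAlt]; exact w.2.2⟩] at h1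
  simp only [Word.ofAlt_toAlt] at h1
  exact h1

theorem res_inc {X Y : CatA 3 k} (a : X ⟶ Y) : res X Y (inc a) = a := by
  have : res X Y ∘ₗ inc = LinearMap.id := hom_ext fun w h₁ h₂ => by
    rw [LinearMap.comp_apply, inc_wordHom ⟨h₁, h₂⟩, res_vec, LinearMap.id_apply]
  exact LinearMap.congr_fun this a

theorem inc_injective {X Y : CatA 3 k} : Function.Injective (inc : (X ⟶ Y) →ₗ[k] V k Alt) :=
  Function.LeftInverse.injective res_inc

theorem inc_res {X Y : CatA 3 k} {v : V k Alt}
    (hv : v ∈ supp k fun w : Alt => w.src = X.idx ∧ w.tgt = Y.idx) : inc (res X Y v) = v :=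
  map_eq_of_supp (inc ∘ₗ res X Y) LinearMap.id (fun w hw => by
    change inc (res X Y (vec k w)) = vec k w
    rw [res_vec, inc_wordHom hw]) hv

theorem inc_mem {X Y : CatA 3 k} (a : X ⟶ Y) :
    inc a ∈ supp k fun w : Alt => w.src = X.idx ∧ w.tgt = Y.idx := by
  refine map_mem_of_supp (X := Mon X.idx Y.idx) (S := fun _ => True) inc _ (fun w _ => ?_)
    (mem_supp_true _)
  change Finsupp.mapDomain _ (Finsupp.single _ _) ∈ _
  rw [Finsupp.mapDomain_single]
  exact vec_mem ⟨by rw [Word.src_toAlt]; exact w.2.1, by rw [Word.tgt_toAlt]; exact w.2.2⟩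

/-- The degrees of the generators. -/
def frac (D : ℕ) (p : ZMod 3 → ℤ) (i : ZMod 3) : ℚ := (p i : ℚ) / D

variable {D : ℕ} {p q : ZMod 3 → ℤ}

theorem inc_mem_of_part {X Y : CatA 3 k} {e : ZMod 2} {d : ℚ} {a : X ⟶ Y}
    (h : a ∈ (CatA.grading k D p q).part X Y e d) :
    inc a ∈ supp k fun w : Alt => (w.src = X.idx ∧ w.tgt = Y.idx) ∧ w.spar = e + 1 ∧
      w.sdeg (frac D p) (frac D q) = d - 1 := by
  refine map_mem_of_supp (X := Mon X.idx Y.idx)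
    (S := fun w => w.1.par = e ∧ w.1.deg (frac D p) (frac D q) = d) inc _ (fun w hw => ?_) h
  change Finsupp.mapDomain _ (Finsupp.single _ _) ∈ _
  rw [Finsupp.mapDomain_single]
  refine vec_mem ⟨⟨by rw [Word.src_toAlt]; exact w.2.1, by rw [Word.tgt_toAlt]; exact w.2.2⟩, ?_, ?_⟩
  · rw [Word.spar_toAlt, hw.1]
  · rw [Word.sdeg_toAlt, hw.2]

theorem wordHom_mem (X Y : CatA 3 k) (w : Alt) : wordHom X Y w ∈
    (CatA.grading k D p q).part X Y (w.spar + 1) (w.sdeg (frac D p) (frac D q) + 1) := by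
  by_cases h : w.src = X.idx ∧ w.tgt = Y.idx
  · rw [wordHom_eq h]
    refine Finsupp.single_mem_supported k 1 ⟨?_, ?_⟩
    · have := Word.spar_toAlt (Word.ofAlt w)
      rw [Word.toAlt_ofAlt] at this
      rw [this, add_assoc, zmod_two_add_self, add_zero]
    · have := Word.sdeg_toAlt (frac D p) (frac D q) (Word.ofAlt w)
      rw [Word.toAlt_ofAlt] at this
      rw [this, sub_add_cancel]
      rfl
  · rw [wordHom_eq_zero h]
    exact Submodule.zero_mem _

theorem res_mem_part {X Y : CatA 3 k} {e : ZMod 2} {d : ℚ} {v : V k Alt}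
    (h : v ∈ supp k fun w : Alt => w.spar = e + 1 ∧ w.sdeg (frac D p) (frac D q) = d - 1) :
    res X Y v ∈ (CatA.grading k D p q).part X Y e d := by
  refine Submodule.mem_comap.1 ((?_ : supp k _ ≤ Submodule.comap (res X Y)
    ((CatA.grading k D p q).part X Y e d)) h)
  rw [supp, Finsupp.supported_eq_span_single, Submodule.span_le]
  rintro _ ⟨w, hw, rfl⟩
  change res X Y (vec k w) ∈ (CatA.grading k D p q).part X Y e d
  rw [res_vec]
  have := wordHom_mem (D := D) (p := p) (q := q) X Y w
  rwa [hw.1, hw.2, sub_add_cancel, add_assoc, zmod_two_add_self, add_zero] at this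

/-- The shifted sign exponent of a list. -/
def eps : List Alt → ZMod 2
  | [] => 0
  | w :: l => eps l + (w.spar + 1) * l.length

/-- The sign change on tensors which turns the signs of operations into those of the bar
construction. -/
noncomputable def epsT (k : Type*) [Field k] : T k Alt →ₗ[k] T k Alt :=
  ofList fun l => paritySign k (eps l) • tensor k l

@[simp] theorem epsT_tensor (l : List Alt) :
    epsT k (tensor k l) = paritySign k (eps l) • tensor k l := ofList_tensor _ _

/-- Tensor the arrows of a chain from the left. -/
noncomputable def chainT {X : CatA 3 k} : {Y : CatA 3 k} → HomChain X Y → T k Alt →ₗ[k] T k Alt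
  | _, .nil _ => LinearMap.id
  | _, .cons c a => consL (inc a) ∘ₗ chainT c

/-- The tensor product of the arrows of a chain. -/
noncomputable def toT {X Y : CatA 3 k} (c : HomChain X Y) : T k Alt := chainT c (tensor k [])

@[simp] theorem toT_nil (X : CatA 3 k) : toT (Chain.nil X : HomChain X X) = tensor k [] := rfl

theorem toT_cons {X Y Z : CatA 3 k} (c : HomChain X Y) (a : Y ⟶ Z) :
    toT (c.cons a) = consL (inc a) (toT c) := rfl

theorem chainT_append {X Y Z : CatA 3 k} (c : HomChain X Y) (c' : HomChain Y Z) :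
    chainT (c.append c') = chainT c' ∘ₗ chainT c := by
  induction c' with
  | nil => rfl
  | cons c' a ih => rw [Chain.append, chainT, chainT, ih, LinearMap.comp_assoc]

theorem toT_append {X Y Z : CatA 3 k} (c : HomChain X Y) (c' : HomChain Y Z) :
    toT (c.append c') = chainT c' (toT c) := by
  rw [toT, chainT_append]
  rfl

end Translation

end Bar

namespace Chain

/-! ### Lengths, concatenation and signs of chains -/

section

variable {ι : Type u} {H : ι → ι → Type v} {H' : ι → ι → Type w}

theorem length_append {X Y Z : ι} (c : Chain H X Y) (c' : Chain H Y Z) :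
    (c.append c').length = c.length + c'.length := by
  induction c' with
  | nil => rw [append, length, add_zero]
  | cons c' a ih => rw [append, length, length, ih, add_assoc]

theorem length_map (F : ∀ {X Y : ι}, H X Y → H' X Y) {X Y : ι} (c : Chain H X Y) :
    (c.map F).length = c.length := by
  induction c with
  | nil => rw [map, length, length]
  | cons c a ih => rw [map, length, length, ih]

theorem map_append (F : ∀ {X Y : ι}, H X Y → H' X Y) {X Y Z : ι} (c : Chain H X Y)
    (c' : Chain H Y Z) : (c.append c').map F = (c.map F).append (c'.map F) := by
  induction c' with
  | nil => rw [append, map, append]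
  | cons c' a ih => rw [append, map, ih, map, append]

theorem append_eq_of_mem_splits {X Y : ι} (c : Chain H X Y) :
    ∀ r ∈ c.splits, r.2.1.append r.2.2 = c := by
  induction c with
  | nil => intro r hr; rw [splits, List.mem_singleton] at hr; subst hr; rfl
  | cons c a ih =>
    intro r hr
    rw [splits, List.mem_append, List.mem_map, List.mem_singleton] at hr
    rcases hr with ⟨r, hr, rfl⟩ | rfl
    · exact congrArg (·.cons a) (ih r hr)
    · rfl

end

variable {D : ℕ} {K : Type w} [Field K] {C : Type u} [Category.{v} C] [Preadditive C] [Linear K C]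
  {G : FracGrading D K C}

theorem val_append {X Y Z : C} (c : Chain (Homog G) X Y) (c' : Chain (Homog G) Y Z) :
    (c.append c').val = c.val.append c'.val := map_append _ c c'

theorem par_append {X Y Z : C} (c : Chain (Homog G) X Y) (c' : Chain (Homog G) Y Z) :
    (c.append c').par = c.par + c'.par := by
  induction c' with
  | nil => rw [append, par, add_zero]
  | cons c' a ih => rw [append, par, ih, par, add_assoc]

/-- The shifted sign exponent of a chain. -/
def eps {X : C} : {Y : C} → Chain (Homog G) X Y → ZMod 2
  | _, nil _ => 0
  | _, cons c a => eps c + a.par * c.length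

theorem eps_append {X Y Z : C} (c : Chain (Homog G) X Y) (c' : Chain (Homog G) Y Z) :
    (c.append c').eps = c.eps + c'.eps + c'.par * c.length := by
  induction c' with
  | nil => simp [append, eps, par]
  | cons c' a ih =>
    rw [append, eps, ih, eps, par, length_append]
    push_cast
    ring

end Chain

namespace Chain

/-! ### Expansion of multilinear functionals in words -/

variable {k : Type*} [Field k] {D : ℕ} {p q : ZMod 3 → ℤ}

open Bar

/-- A functional on chains which is linear in each arrow. -/
structure IsMultilinear {X Y : CatA 3 k} {M : Type*} [AddCommGroup M] [Module k M]
    (Ψ : HomChain X Y → M) : Prop where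
  add : ∀ {W Z : CatA 3 k} (c : HomChain X W) (a b : W ⟶ Z) (c' : HomChain Z Y),
    Ψ ((c.cons (a + b)).append c') = Ψ ((c.cons a).append c') + Ψ ((c.cons b).append c')
  smul : ∀ {W Z : CatA 3 k} (c : HomChain X W) (r : k) (a : W ⟶ Z) (c' : HomChain Z Y),
    Ψ ((c.cons (r • a)).append c') = r • Ψ ((c.cons a).append c')

/-- An alternating word as a homogeneous morphism. -/
noncomputable def wordHomog (D : ℕ) (p q : ZMod 3 → ℤ) (X Y : CatA 3 k) (w : Alt) :
    Homog (CatA.grading k D p q) X Y :=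
  ⟨_, _, wordHom X Y w, wordHom_mem X Y w⟩

/-- A list of words as a chain of homogeneous morphisms. -/
noncomputable def ofWords (D : ℕ) (p q : ZMod 3 → ℤ) (X : CatA 3 k) :
    List Alt → ∀ Z : CatA 3 k, Chain (Homog (CatA.grading k D p q)) X Z
  -- An empty list need not lead from `X` to `Z`. The zero arrow is a default value; the statements
  -- below use nonempty lists.
  | [], _ => (nil X).cons ⟨0, 0, 0, Submodule.zero_mem _⟩
  | [w], Z => (nil X).cons (wordHomog D p q X Z w)
  | w :: w' :: l, Z => (ofWords D p q X (w' :: l) ⟨w.src⟩).cons (wordHomog D p q ⟨w.src⟩ Z w)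

theorem val_cons {X Y Z : CatA 3 k} (c : Chain (Homog (CatA.grading k D p q)) X Y)
    (a : Homog (CatA.grading k D p q) Y Z) : (c.cons a).val = c.val.cons a.val := by
  rw [val, map, val]

theorem val_nil (X : CatA 3 k) :
    (nil X : Chain (Homog (CatA.grading k D p q)) X X).val = nil X := by
  rw [val, map]

theorem toT_ofWords {X Z : CatA 3 k} {l : List Alt} (hl : l ≠ [])
    (hp : IsPath Z.idx l X.idx) : toT (ofWords D p q X l Z).val = tensor k l := by
  induction l generalizing Z with
  | nil => exact absurd rfl hl
  | cons w l ih =>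
    cases l with
    | nil =>
      rw [ofWords, val_cons, val_nil, toT_cons, wordHomog, inc_wordHom ⟨hp.2, hp.1⟩, toT_nil]
      simp
    | cons w' l =>
      rw [ofWords, val_cons, toT_cons, wordHomog, inc_wordHom (X := ⟨w.src⟩) (Y := Z) (w := w) ⟨rfl, hp.1⟩, ih (Z := ⟨w.src⟩) (by simp) hp.2]
      simp

theorem IsMultilinear.cons {X Y Z : CatA 3 k} {M : Type*} [AddCommGroup M] [Module k M]
    {Ψ : HomChain X Z → M} (h : IsMultilinear Ψ) (a : Y ⟶ Z) :
    IsMultilinear fun c : HomChain X Y => Ψ (c.cons a) :=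
  ⟨fun c b b' c' => h.add c b b' (c'.cons a), fun c r b c' => h.smul c r b (c'.cons a)⟩

/-- The last arrow as the variable. -/
def IsMultilinear.last {X Y Z : CatA 3 k} {M : Type*} [AddCommGroup M] [Module k M]
    {Ψ : HomChain X Z → M} (h : IsMultilinear Ψ) (c : HomChain X Y) : (Y ⟶ Z) →ₗ[k] M where
  toFun a := Ψ (c.cons a)
  map_add' a b := h.add c a b (nil Z)
  map_smul' r a := h.smul c r a (nil Z)

/-- The tensors which occur in nonempty chains. -/
theorem toT_mem {X Y : CatA 3 k} (c : HomChain X Y) (hc : 0 < c.length) :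
    toT c ∈ supp k fun l : List Alt => l ≠ [] := by
  cases c with
  | nil => rw [length] at hc; omega
  | cons c a =>
    rw [toT_cons]
    exact consL_mem (mem_supp_true _) (mem_supp_true _) (fun w l _ _ => by simp)

/-- Expansion of a multilinear functional in a basis. -/
theorem IsMultilinear.expand {X Y : CatA 3 k} {M : Type*} [AddCommGroup M] [Module k M]
    {Ψ : HomChain X Y → M} (h : IsMultilinear Ψ) (c : HomChain X Y) (hc : 0 < c.length) :
    Ψ c = ofList (fun l => Ψ (ofWords D p q X l Y).val) (toT c) := by
  induction c with
  | nil => rw [length] at hc; omega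
  | @cons Y Z c a ih =>
    have key : h.last c = ofList (fun l => Ψ (ofWords D p q X l Z).val) ∘ₗ
        consL.flip (toT c) ∘ₗ inc := by
      refine hom_ext fun w h₁ h₂ => ?_
      obtain ⟨j⟩ := Y
      obtain rfl : w.src = j := h₁
      rw [LinearMap.comp_apply, LinearMap.comp_apply, inc_wordHom (X := ⟨w.src⟩) (Y := Z) (w := w) ⟨rfl, h₂⟩, LinearMap.flip_apply]
      cases c with
      | nil =>
        rw [toT_nil, consL_vec_tensor, ofList_tensor, ofWords, val_cons, val_nil]
        rfl
      | @cons Y' _ c b =>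
        have hpos : 0 < (c.cons b).length := by rw [length]; omega
        refine (ih (h.cons (wordHom _ Z w)) hpos).trans ?_
        refine map_eq_of_supp (S := fun l : List Alt => l ≠ []) (ofList _)
          (ofList (fun l => Ψ (ofWords D p q X l Z).val) ∘ₗ consL (vec k w)) (fun l hl => ?_)
          (toT_mem _ hpos)
        change ofList _ (tensor k l) = ofList _ (consL (vec k w) (tensor k l))
        rw [consL_vec_tensor, ofList_tensor, ofList_tensor]
        cases l with
        | nil => exact absurd rfl hl
        | cons w' l => rw [ofWords, val_cons]; rfl
    exact LinearMap.congr_fun key a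

end Chain

namespace Bar

/-! ### Operations as operators on tensors -/

section Represents

variable {k : Type*} [Field k] {D : ℕ} {p q : ZMod 3 → ℤ}

theorem IsPath.tgt_unique {j j' i i' : ZMod 3} {l : List Alt} (h : IsPath j l i)
    (h' : IsPath j' l i') (hl : l ≠ []) : j = j' := by
  cases l with
  | nil => exact absurd rfl hl
  | cons w l => exact h.1.symm.trans h'.1

/-- Consecutive arrows of a chain share an object, so only paths occur in the expansion. Operators
may therefore be changed freely on other lists. -/
theorem toT_path_mem {X Y : CatA 3 k} (c : HomChain X Y) :
    toT c ∈ supp k fun l => IsPath Y.idx l X.idx := by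
  induction c with
  | nil => exact tensor_mem rfl
  | cons c a ih =>
    rw [toT_cons]
    refine consL_mem (inc_mem a) ih fun w l hw hl => ⟨hw.2, ?_⟩
    rw [hw.1]
    exact hl

/-- The tensors which occur in a chain of homogeneous morphisms. -/
theorem toT_val_mem {X Y : CatA 3 k} (c : Chain (Homog (CatA.grading k D p q)) X Y) :
    toT c.val ∈ supp k fun l => IsPath Y.idx l X.idx ∧ l.length = c.length ∧
      lpar l = c.par + c.length ∧ ldeg (frac D p) (frac D q) l = c.deg - c.length ∧
      eps l = c.eps := by
  induction c with
  | nil =>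
    rw [Chain.val_nil, toT_nil]
    refine tensor_mem ⟨rfl, ?_, ?_, ?_, rfl⟩
    · rw [Chain.length]; rfl
    · rw [Chain.length, Chain.par]; rfl
    · rw [Chain.length, Chain.deg]; simp
  | cons c a ih =>
    rw [Chain.val_cons, toT_cons]
    refine consL_mem (inc_mem_of_part a.mem) ih fun w l hw hl => ⟨⟨hw.1.2, ?_⟩, ?_, ?_, ?_, ?_⟩
    · rw [hw.1.1]
      exact hl.1
    · rw [Chain.length, List.length_cons, hl.2.1]
    · rw [Chain.length, Chain.par, lpar_cons, hw.2.1, hl.2.2.1]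
      push_cast
      ring
    · rw [Chain.length, Chain.deg, ldeg_cons, hw.2.2, hl.2.2.2.1]
      push_cast
      ring
    · rw [eps, Chain.eps, hw.2.1, hl.2.1, hl.2.2.2.2, add_assoc a.par, zmod_two_add_self, add_zero]

theorem epsT_val {X Y : CatA 3 k} (c : Chain (Homog (CatA.grading k D p q)) X Y) :
    epsT k (toT c.val) = paritySign k c.eps • toT c.val := by
  have key : ∀ (M : T k Alt →ₗ[k] T k Alt), M = paritySign k c.eps • LinearMap.id →
      epsT k (toT c.val) = M (toT c.val) := fun M hM =>
    map_eq_of_supp (epsT k) M (fun l hl => by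
      change epsT k (tensor k l) = M (tensor k l)
      rw [epsT_tensor, hM, hl.2.2.2.2]
      rfl) (toT_val_mem c)
  rw [key _ rfl]
  rfl

variable {δ : ℕ → ℤ}

/-- The operations are given by an operator on tensors. -/
def Rep (m : Operations (CatA.grading k D p q) δ) (b : T k Alt →ₗ[k] V k Alt) : Prop :=
  ∀ {X Y : CatA 3 k} (c : HomChain X Y), inc (m.op c) = b (epsT k (toT c))

theorem Rep.val {m : Operations (CatA.grading k D p q) δ} {b : T k Alt →ₗ[k] V k Alt}
    (h : Rep m b) {X Y : CatA 3 k} (c : Chain (Homog (CatA.grading k D p q)) X Y) :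
    inc (m.op c.val) = paritySign k c.eps • b (toT c.val) := by
  rw [h, epsT_val, map_smul]

theorem Rep.nil {m : Operations (CatA.grading k D p q) δ} {b : T k Alt →ₗ[k] V k Alt}
    (h : Rep m b) : b (tensor k []) = 0 := by
  have := h (Chain.nil (CatA.obj 3 k 0))
  rw [m.op_nil, map_zero, toT_nil, epsT_tensor] at this
  simpa [eps, paritySign_zero] using this.symm

theorem isMultilinear_op (m : Operations (CatA.grading k D p q) δ) (X Y : CatA 3 k) :
    Chain.IsMultilinear fun c : HomChain X Y => inc (m.op c) :=
  ⟨fun c a b c' => by rw [m.op_add, map_add], fun c r a c' => by rw [m.op_smul, map_smul]⟩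

/-- The tensor form of operations. -/
noncomputable def barOp (m : Operations (CatA.grading k D p q) δ) : T k Alt →ₗ[k] V k Alt :=
  open scoped Classical in
  ofList fun l => if h : l ≠ [] ∧ ∃ x : ZMod 3 × ZMod 3, IsPath x.1 l x.2 then
    paritySign k (eps l) • inc (m.op (Chain.ofWords D p q ⟨h.2.choose.2⟩ l ⟨h.2.choose.1⟩).val)
  else 0

/-- A nonempty path determines its endpoints, so the chosen ones are the given ones. -/
theorem barOp_of_path (m : Operations (CatA.grading k D p q) δ) {l : List Alt} (hl : l ≠ [])
    {X Y : CatA 3 k} (h : IsPath Y.idx l X.idx) :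
    barOp m (tensor k l) = paritySign k (eps l) • inc (m.op (Chain.ofWords D p q X l Y).val) := by
  have h' : l ≠ [] ∧ ∃ x : ZMod 3 × ZMod 3, IsPath x.1 l x.2 := ⟨hl, (Y.idx, X.idx), h⟩
  rw [barOp, ofList_tensor, dif_pos h']
  have h₁ : (⟨h'.2.choose.1⟩ : CatA 3 k) = Y :=
    congrArg CatA.mk (h'.2.choose_spec.tgt_unique h hl)
  have h₂ : (⟨h'.2.choose.2⟩ : CatA 3 k) = X := by
    have := h'.2.choose_spec
    rw [this.tgt_unique h hl] at this
    exact congrArg CatA.mk (this.src_unique h hl)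
  rw [h₁, h₂]

/-- Operations are multilinear, hence determined by chains of words; the sign of `epsT` cancels the
one in `barOp`. -/
theorem rep_barOp (m : Operations (CatA.grading k D p q) δ) : Rep m (barOp m) := by
  intro X Y c
  rcases Nat.eq_zero_or_pos c.length with hc | hc
  · cases c with
    | nil =>
      rw [m.op_nil, map_zero, toT_nil, epsT_tensor, map_smul, barOp, ofList_tensor,
        dif_neg (by simp), smul_zero]
    | cons c a => rw [Chain.length] at hc; omega
  · rw [(isMultilinear_op m X Y).expand (D := D) (p := p) (q := q) c hc]
    have hs := toT_path_mem c
    have hs' := Chain.toT_mem c hc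
    have h2 : toT c ∈ supp k fun l => IsPath Y.idx l X.idx ∧ l ≠ [] := by
      have : toT c ∈ supp k (fun l => IsPath Y.idx l X.idx) ⊓ supp k (fun l : List Alt => l ≠ []) :=
        ⟨hs, hs'⟩
      rwa [supp, supp, ← Finsupp.supported_inter] at this
    refine map_eq_of_supp (ofList _) (barOp m ∘ₗ epsT k) (fun l hl => ?_) h2
    change ofList _ (tensor k l) = barOp m (epsT k (tensor k l))
    rw [ofList_tensor, epsT_tensor, map_smul, barOp_of_path m hl.2 hl.1, smul_smul,
      paritySign_mul_self, one_smul]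

theorem ofWords_props {X Z : CatA 3 k} {l : List Alt} (hl : l ≠ []) :
    (Chain.ofWords D p q X l Z).length = l.length ∧
    (Chain.ofWords D p q X l Z).par = lpar l + l.length ∧
    (Chain.ofWords D p q X l Z).deg = ldeg (frac D p) (frac D q) l + l.length := by
  induction l generalizing Z with
  | nil => exact absurd rfl hl
  | cons w l ih =>
    cases l with
    | nil =>
      rw [Chain.ofWords, Chain.length, Chain.length, Chain.par, Chain.par, Chain.deg, Chain.deg]
      simp [Chain.wordHomog]
    | cons w' l =>
      obtain ⟨h₁, h₂, h₃⟩ := ih (Z := ⟨w.src⟩) (by simp)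
      rw [Chain.ofWords, Chain.length, Chain.par, Chain.deg, h₁, h₂, h₃]
      refine ⟨rfl, ?_, ?_⟩
      · simp only [Chain.wordHomog, lpar_cons, List.length_cons]
        push_cast
        ring
      · simp only [Chain.wordHomog, ldeg_cons, List.length_cons]
        push_cast
        ring

/-- The shift by one of each argument and of the value turns the degree `c₀ - n`, which depends on
the arity, into the uniform degree `c₀ - 1`. It is `1` for `A_∞`-structures and `0` for homotopies.
-/
theorem graded_barOp {c₀ : ℤ} (m : Operations (CatA.grading k D p q) fun n => c₀ - n) :
    Graded (frac D p) (frac D q) ((c₀ : ZMod 2) + 1, c₀ - 1) (barOp m) := by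
  intro l
  by_cases hl : l ≠ [] ∧ ∃ x : ZMod 3 × ZMod 3, IsPath x.1 l x.2
  swap
  · rw [barOp, ofList_tensor, dif_neg hl]
    exact Submodule.zero_mem _
  obtain ⟨hl, ⟨j, i⟩, hp⟩ := hl
  rw [barOp_of_path m hl (X := ⟨i⟩) (Y := ⟨j⟩) hp]
  obtain ⟨h₁, h₂, h₃⟩ := ofWords_props (D := D) (p := p) (q := q) (X := (⟨i⟩ : CatA 3 k))
    (Z := ⟨j⟩) hl
  refine Submodule.smul_mem _ _ (supp_mono (fun w hw => ?_) (inc_mem_of_part (m.op_mem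
    (Chain.ofWords D p q ⟨i⟩ l ⟨j⟩) (by rw [h₁]; exact List.length_pos_iff.2 hl))))
  obtain ⟨⟨hs, ht⟩, hw₁, hw₂⟩ := hw
  rw [h₁, h₂] at hw₁
  rw [h₁, h₃] at hw₂
  refine ⟨?_, ?_, ?_⟩
  · rintro a b ⟨rfl, rfl⟩
    rw [hs, ht]
    exact hp
  · rw [lpar_cons, lpar_nil, hw₁]
    push_cast
    ring
  · rw [ldeg_cons, ldeg_nil, hw₂]
    push_cast
    ring

theorem epsT_mem {S : List Alt → Prop} {t : T k Alt} (ht : t ∈ supp k S) : epsT k t ∈ supp k S :=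
  map_mem_of_supp (epsT k) _ (fun l hl => by
    change epsT k (tensor k l) ∈ _
    rw [epsT_tensor]
    exact Submodule.smul_mem _ _ (tensor_mem hl)) ht

theorem Graded.apply_toT_mem {η : ZMod 2 × ℚ} {b : T k Alt →ₗ[k] V k Alt}
    (hb : Graded (frac D p) (frac D q) η b) (hb0 : b (tensor k []) = 0) {X Y : CatA 3 k}
    (c : HomChain X Y) :
    b (epsT k (toT c)) ∈ supp k fun w : Alt => w.src = X.idx ∧ w.tgt = Y.idx := by
  refine map_mem_of_supp b _ (fun l hl => ?_) (epsT_mem (toT_path_mem c))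
  change b (tensor k l) ∈ _
  by_cases hl0 : l = []
  · rw [hl0, hb0]
    exact Submodule.zero_mem _
  · refine supp_mono (fun w hw => ?_) (hb l)
    have h₁ := hw.isPath
    have h₂ := h₁.tgt_unique hl hl0
    rw [h₂] at h₁
    exact ⟨h₁.src_unique hl hl0, h₂⟩

/-- The operator is applied to the tensor of a chain and read in the morphism space of its
endpoints. Nothing is lost in this, because a graded operator preserves endpoints. -/
theorem exists_operations {c₀ : ℤ} {b : T k Alt →ₗ[k] V k Alt}
    (hb : Graded (frac D p) (frac D q) ((c₀ : ZMod 2) + 1, c₀ - 1) b) (hb0 : b (tensor k []) = 0) :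
    ∃ m : Operations (CatA.grading k D p q) (fun n => c₀ - n), Rep m b := by
  refine ⟨⟨fun {X Y} c => res X Y (b (epsT k (toT c))), fun X => ?_, fun c a a' c' => ?_,
    fun c r a c' => ?_, fun {X Y} c hc => ?_⟩, fun c => inc_res (hb.apply_toT_mem hb0 c)⟩
  · rw [toT_nil, epsT_tensor, map_smul, hb0, smul_zero, map_zero]
  · simp only [toT_append, toT_cons, map_add, LinearMap.add_apply]
  · simp only [toT_append, toT_cons, map_smul, LinearMap.smul_apply]
  · refine res_mem_part ?_
    rw [epsT_val, map_smul]
    refine Submodule.smul_mem _ _ (map_mem_of_supp b _ (fun l hl => ?_) (toT_val_mem c))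
    change b (tensor k l) ∈ _
    refine supp_mono (fun w hw => ?_) (hb l)
    have h₁ := hw.2.1
    have h₂ := hw.2.2
    simp only [lpar_cons, lpar_nil, ldeg_cons, ldeg_nil, add_zero, hl.2.2.1, hl.2.2.2.1] at h₁ h₂
    rw [h₁, h₂]
    have h3 : (c.length : ZMod 2) = - c.length := (ZMod.neg_eq_self_mod_two _).symm
    constructor
    · push_cast
      linear_combination h3
    · push_cast
      ring

end Represents

end Bar

namespace Chain

/-! ### Sums over the cuts of a chain -/

section

variable {ι : Type u} {H : ι → ι → Type v} {M : Type*} [AddCommMonoid M]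

/-- Sum over the ways to cut a chain into an initial and a final part. -/
def splitSum {X Z : ι} (c : Chain H X Z) (F : ∀ Y : ι, Chain H X Y → Chain H Y Z → M) : M :=
  (c.splits.map fun r => F r.1 r.2.1 r.2.2).sum

theorem splitSum_nil (X : ι) (F : ∀ Y : ι, Chain H X Y → Chain H Y X → M) :
    (nil X).splitSum F = F X (nil X) (nil X) := by
  rw [splitSum, splits]
  simp

theorem splitSum_cons {X Y Z : ι} (c : Chain H X Y) (a : H Y Z)
    (F : ∀ Y : ι, Chain H X Y → Chain H Y Z → M) :
    (c.cons a).splitSum F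
      = (c.splitSum fun Y z x => F Y z (x.cons a)) + F Z (c.cons a) (nil Z) := by
  rw [splitSum, splits]
  simp [splitSum, List.map_map, Function.comp_def]

theorem splitSum_add {X Z : ι} (c : Chain H X Z) (F F' : ∀ Y : ι, Chain H X Y → Chain H Y Z → M) :
    (c.splitSum fun Y z x => F Y z x + F' Y z x) = c.splitSum F + c.splitSum F' := by
  rw [splitSum, List.sum_map_add]
  rfl

theorem splitSum_congr {X Z : ι} {c : Chain H X Z}
    {F F' : ∀ Y : ι, Chain H X Y → Chain H Y Z → M}
    (h : ∀ Y z x, z.append x = c → F Y z x = F' Y z x) : c.splitSum F = c.splitSum F' :=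
  congrArg List.sum (List.map_congr_left fun r hr => h _ _ _ (append_eq_of_mem_splits c r hr))

theorem map_splitSum {N : Type*} [AddCommMonoid N] (f : M →+ N) {X Z : ι} (c : Chain H X Z)
    (F : ∀ Y : ι, Chain H X Y → Chain H Y Z → M) :
    f (c.splitSum F) = c.splitSum fun Y z x => f (F Y z x) := by
  rw [splitSum, map_list_sum, List.map_map]
  rfl

end

end Chain

namespace Bar

/-! ### The insertion sum as a coderivation -/

section Represents

variable {k : Type*} [Field k] {D : ℕ} {p q : ZMod 3 → ℤ}

theorem conv_toT {M : Type*} [AddCommGroup M] [Module k M]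
    (β : T k Alt →ₗ[k] T k Alt →ₗ[k] M) {X Y : CatA 3 k}
    (c : Chain (Homog (CatA.grading k D p q)) X Y) :
    conv β (toT c.val) = c.splitSum fun _ z x => β (toT x.val) (toT z.val) := by
  induction c generalizing β with
  | nil => rw [Chain.splitSum_nil, Chain.val_nil, toT_nil, conv_tensor, splitSum_nil]
  | cons c a ih =>
    rw [Chain.splitSum_cons, Chain.val_cons, toT_cons, conv_consL, ih, add_comm]
    simp only [Chain.val_nil, toT_nil, Chain.val_cons, toT_cons, LinearMap.comp_apply]

theorem twV_inc {X Y : CatA 3 k} (a : Homog (CatA.grading k D p q) X Y) :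
    twV (sg k) (inc a.val) = paritySign k (a.par + 1) • inc a.val := by
  have key : ∀ (M : V k Alt →ₗ[k] V k Alt), M = paritySign k (a.par + 1) • LinearMap.id →
      twV (sg k) (inc a.val) = M (inc a.val) := fun M hM =>
    map_eq_of_supp (twV (sg k)) M (fun w hw => by
      change twV (sg k) (vec k w) = M (vec k w)
      rw [twV_vec, hM, sg, hw.2.1]
      rfl) (inc_mem_of_part a.mem)
  rw [key _ rfl]
  rfl

/-- Unfolded, a coderivation is the sum over the cuts of a chain into three parts, with the operator
applied to the middle one and the sign of the shifted parities of the part that is passed, the last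
arrows of the chain. -/
theorem coder_toT {φ : T k Alt →ₗ[k] V k Alt} (hφ : φ (tensor k []) = 0) {X Y : CatA 3 k}
    (c : Chain (Homog (CatA.grading k D p q)) X Y) :
    coder (sg k) φ (toT c.val) = c.splitSum fun _ z yx => yx.splitSum fun _ y x =>
      paritySign k (x.par + x.length) • chainT x.val (consL (φ (toT y.val)) (toT z.val)) := by
  induction c with
  | nil =>
    rw [Chain.splitSum_nil, Chain.splitSum_nil, Chain.val_nil, toT_nil, coder_nil, hφ]
    simp
  | cons c a ih =>
    have hA : applyInit φ (toT (c.cons a).val)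
        = c.splitSum fun _ z x => consL (φ (toT (x.cons a).val)) (toT z.val) := by
      rw [applyInit, conv_toT, Chain.splitSum_cons, Chain.val_nil, toT_nil]
      simp [hφ]
    rw [Chain.val_cons] at hA ⊢
    rw [toT_cons] at hA ⊢
    rw [coder_consL, hA, twV_inc, ih, Chain.splitSum_cons, Chain.splitSum_nil, Chain.val_nil,
      toT_nil, hφ]
    simp only [Chain.splitSum_cons, Chain.splitSum_add, map_zero, LinearMap.zero_apply, smul_zero,
      add_zero]
    congr 1
    · have := Chain.map_splitSum (consL (paritySign k (a.par + 1) • inc a.val)).toAddMonoidHom c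
      refine (this _).trans (Chain.splitSum_congr fun Y z yx _ => ?_)
      refine (Chain.map_splitSum (consL (paritySign k (a.par + 1) • inc a.val)).toAddMonoidHom
        yx _).trans (Chain.splitSum_congr fun Y' y x _ => ?_)
      change consL (paritySign k (a.par + 1) • inc a.val) _ = _
      rw [map_smul, map_smul, LinearMap.smul_apply, smul_smul, ← paritySign_add, Chain.val_cons,
        chainT, Chain.par, Chain.length]
      congr 2
      push_cast
      ring
    · refine Chain.splitSum_congr fun Y z x _ => ?_
      rw [Chain.par, Chain.length, Chain.val_nil, Nat.cast_zero, add_zero, paritySign_zero,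
        one_smul]
      rfl

variable {δ : ℕ → ℤ}

theorem op_zero_arrow (g : Operations (CatA.grading k D p q) δ) {W X Y Z : CatA 3 k}
    (c : HomChain W X) (c' : HomChain Y Z) : g.op ((c.cons (0 : X ⟶ Y)).append c') = 0 := by
  have := g.op_smul c 0 (0 : X ⟶ Y) c'
  rwa [zero_smul, zero_smul] at this

/-- The sign exponents of `g`, of `m` and of the whole chain combine with the sign `s + l t` and the
Koszul sign to the shifted parity of the arrows that are passed, which is the sign of the
coderivation. -/
theorem inc_insertionSum {g : Operations (CatA.grading k D p q) δ}
    {m : Operations (CatA.grading k D p q) fun n => 2 - n} {g' m' : T k Alt →ₗ[k] V k Alt}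
    (hg : Rep g g') (hm : Rep m m') {X Y : CatA 3 k}
    (c : Chain (Homog (CatA.grading k D p q)) X Y) :
    inc (insertionSum g m c) = paritySign k c.eps • g' (coder (sg k) m' (toT c.val)) := by
  have h1 : insertionSum g m c = c.splitSum fun _ z yx => yx.splitSum fun _ y x =>
    paritySign k ((x.length : ZMod 2) + (y.length : ZMod 2) * (z.length : ZMod 2)
        + (y.length : ZMod 2) * x.par) • g.op ((z.val.cons (m.op y.val)).append x.val) := rfl
  rw [h1, coder_toT hm.nil]
  refine (Chain.map_splitSum inc.toAddMonoidHom c _).trans (Eq.trans ?_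
    (Chain.map_splitSum (paritySign k c.eps • g').toAddMonoidHom c _).symm)
  refine Chain.splitSum_congr fun _ z yx h => ?_
  refine (Chain.map_splitSum inc.toAddMonoidHom yx _).trans (Eq.trans ?_
    (Chain.map_splitSum (paritySign k c.eps • g').toAddMonoidHom yx _).symm)
  refine Chain.splitSum_congr fun _ y x h' => ?_
  change inc (paritySign k _ • _) = paritySign k c.eps • g' (paritySign k _ • _)
  -- An empty middle part contributes zero on both sides. It has to be treated apart, since
  -- operations carry a degree only on nonempty chains.
  rcases Nat.eq_zero_or_pos y.length with hy | hy
  · cases y with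
    | cons y a => rw [Chain.length] at hy; omega
    | nil =>
      rw [Chain.val_nil, m.op_nil, op_zero_arrow, smul_zero, map_zero, toT_nil, hm.nil]
      simp
  · have := hg.val ((z.cons ⟨_, _, m.op y.val, m.op_mem y hy⟩).append x)
    rw [Chain.val_append, Chain.val_cons] at this
    rw [map_smul, this, toT_append, toT_cons, hm.val, map_smul, map_smul, LinearMap.smul_apply,
      map_smul, map_smul, smul_smul, smul_smul, smul_smul, ← paritySign_add, ← paritySign_add,
      ← paritySign_add]
    congr 2
    rw [← h, ← h', Chain.eps_append, Chain.eps_append, Chain.eps_append, Chain.par_append,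
      Chain.eps, Chain.length]
    have h2 : (2 : ZMod 2) = 0 := rfl
    push_cast
    linear_combination (z.length : ZMod 2) * h2
end Represents

end Bar

namespace Chain

/-! ### Cuts of a chain into nonempty blocks -/

section

variable {ι : Type u} {H : ι → ι → Type v} {M : Type*} [AddCommMonoid M]

/-- Sum over the ways to cut a chain into nonempty blocks. -/
def blockSum {X Z : ι} (c : Chain H X Z) (F : Chain (Chain H) X Z → M) : M :=
  (c.blocks.map F).sum

theorem blockSum_nil (X : ι) (F : Chain (Chain H) X X → M) :
    (nil X : Chain H X X).blockSum F = F (nil X) := by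
  rw [blockSum, blocks]
  simp

theorem blockSum_add {X Z : ι} (c : Chain H X Z) (F F' : Chain (Chain H) X Z → M) :
    (c.blockSum fun P => F P + F' P) = c.blockSum F + c.blockSum F' :=
  List.sum_map_add

theorem blockSum_cons_aux {X Y Z : ι} (c : Chain H X Y) (a : H Y Z)
    (F : Chain (Chain H) X Z → M) :
    (c.cons a).blockSum F = (c.blockSum fun P => F (P.cons ((nil Y).cons a)))
      + c.blockSum fun P => ((extendLast P a).map F).sum := by
  rw [← blockSum_add, blockSum, blocks, blockSum, List.map_flatMap, List.flatMap, List.sum_flatten,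
    List.map_map]
  congr 1

/-- The enumeration `blocks` lets the last block grow arrow by arrow. Summing over the last block as
a whole gives the recursion that matches the one of coalgebra maps. -/
theorem blockSum_cons {X Y Z : ι} (c : Chain H X Y) (a : H Y Z) (F : Chain (Chain H) X Z → M) :
    (c.cons a).blockSum F
      = c.splitSum fun _ z x => z.blockSum fun P => F (P.cons (x.cons a)) := by
  induction c generalizing Z with
  | nil =>
    rw [blockSum_cons_aux, splitSum_nil, blockSum_nil, blockSum_nil, extendLast]
    simp
  | cons c b ih =>
    rw [blockSum_cons_aux, splitSum_cons, add_comm, ih b]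
    congr 1
    refine splitSum_congr fun Y z x _ => ?_
    congr 1
    funext P
    rw [extendLast]
    simp

/-- The concatenation of a chain of blocks. -/
def flatten {X : ι} : {Y : ι} → Chain (Chain H) X Y → Chain H X Y
  | _, nil _ => nil _
  | _, cons P B => (flatten P).append B

theorem flatten_of_mem_blocks {X Y : ι} (c : Chain H X Y) : ∀ P ∈ c.blocks, flatten P = c := by
  induction c with
  | nil =>
    intro P hP
    rw [blocks, List.mem_singleton] at hP
    rw [hP, flatten]
  | cons c a ih =>
    intro P hP
    rw [blocks, List.mem_flatMap] at hP
    obtain ⟨P', hP', hP⟩ := hP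
    rcases List.mem_cons.1 hP with rfl | hP
    · rw [flatten, ih P' hP']
      rfl
    · cases P' with
      | nil => rw [extendLast] at hP; simp at hP
      | cons P' B =>
        rw [extendLast, List.mem_singleton] at hP
        rw [hP, ← ih _ hP']
        rfl

theorem blockSum_congr {X Z : ι} {c : Chain H X Z} {F F' : Chain (Chain H) X Z → M}
    (h : ∀ P, flatten P = c → F P = F' P) : c.blockSum F = c.blockSum F' :=
  congrArg List.sum (List.map_congr_left fun P hP => h P (flatten_of_mem_blocks c P hP))

theorem map_blockSum {N : Type*} [AddCommMonoid N] (f : M →+ N) {X Z : ι} (c : Chain H X Z)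
    (F : Chain (Chain H) X Z → M) : f (c.blockSum F) = c.blockSum fun P => f (F P) := by
  rw [blockSum, map_list_sum, List.map_map]
  rfl

theorem map_map {H' : ι → ι → Type*} {H'' : ι → ι → Type*} (F : ∀ {X Y : ι}, H X Y → H' X Y)
    (F' : ∀ {X Y : ι}, H' X Y → H'' X Y) {X Y : ι} (c : Chain H X Y) :
    (c.map F).map F' = c.map fun a => F' (F a) := by
  induction c with
  | nil => rw [map, map, map]
  | cons c a ih => rw [map, map, map, ih]

end

section

variable {D : ℕ} {K : Type w} [Field K] {C : Type u} [Category.{v} C] [Preadditive C] [Linear K C]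
  {G : FracGrading D K C}

/-- The sum of the sign exponents of the blocks. -/
def sumEps {X : C} : {Y : C} → Chain (Chain (Homog G)) X Y → ZMod 2
  | _, nil _ => 0
  | _, cons P B => sumEps P + B.eps

theorem length_flatten {X Y : C} (P : Chain (Chain (Homog G)) X Y) :
    ((flatten P).length : ZMod 2) = excess P + P.length := by
  induction P with
  | nil => rw [flatten, excess, length, length]; simp
  | cons P B ih =>
    rw [flatten, excess, length, length_append]
    push_cast
    rw [ih]
    ring

variable {δ : ℕ → ℤ}

theorem op_mem_all (f : Operations G δ) {X Y : C} (c : Chain (Homog G) X Y) :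
    f.op c.val ∈ G.part X Y (c.par + (δ c.length : ZMod 2)) (c.deg + δ c.length) := by
  cases c with
  | nil =>
    rw [val, map, f.op_nil]
    exact Submodule.zero_mem _
  | cons c a => exact f.op_mem _ (by rw [length]; omega)

/-- Apply operations to each block. -/
def mapBlocks (f : Operations G δ) {X Y : C} (P : Chain (Chain (Homog G)) X Y) :
    Chain (Homog G) X Y :=
  P.map fun B => ⟨_, _, f.op B.val, op_mem_all f B⟩

theorem mapBlocks_val (f : Operations G δ) {X Y : C} (P : Chain (Chain (Homog G)) X Y) :
    (mapBlocks f P).val = P.map fun B => f.op B.val := map_map _ _ P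

/-- The sign of the functor equation is the difference between the shift sign of the whole chain and
the shift signs of the blocks and of the chain of their values. So no signs are left for coalgebra
maps. -/
theorem functorSign_eq (f : Operations G fun n => 1 - n) {X Y : C}
    (P : Chain (Chain (Homog G)) X Y) :
    functorSign P + (mapBlocks f P).eps + sumEps P = (flatten P).eps := by
  induction P with
  | nil => rw [functorSign, mapBlocks, map, sumEps, flatten, eps]; simp
  | cons P B ih =>
    rw [mapBlocks] at ih
    rw [functorSign, mapBlocks, map, sumEps, flatten, eps, eps_append, ← ih, length_flatten,
      length_map]
    push_cast
    ring

end

end Chain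

namespace Bar

/-! ### The left side of the functor equation as a coalgebra map -/

section Represents

variable {k : Type*} [Field k] {D : ℕ} {p q : ZMod 3 → ℤ}

/-- The tensor product of the values of an operator on the blocks. -/
noncomputable def blocksT (f : T k Alt →ₗ[k] V k Alt) {X : CatA 3 k} :
    {Y : CatA 3 k} → Chain (Chain (Homog (CatA.grading k D p q))) X Y → T k Alt
  | _, .nil _ => tensor k []
  | _, .cons P B => consL (f (toT B.val)) (blocksT f P)

theorem cohom_consL (f : T k Alt →ₗ[k] V k Alt) (a : V k Alt) (t : T k Alt) :
    cohom f (consL a t) = conv ((consL ∘ₗ f ∘ₗ consL a).compl₂ (cohom f)) t := by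
  refine LinearMap.congr_fun (f := cohom f ∘ₗ consL a) (T_ext fun l => ?_) t
  rw [LinearMap.comp_apply, conv_tensor]
  simp only [LinearMap.compl₂_apply, LinearMap.comp_apply]
  induction a using Finsupp.induction_linear with
  | zero => simp [splitSum_zero]
  | add a b ha hb => simp only [map_add, LinearMap.add_apply, splitSum_add, ha, hb]
  | single w r =>
    have : (Finsupp.single w r : V k Alt) = r • vec k w := by simp [vec]
    simp only [this, map_smul, LinearMap.smul_apply, consL_vec_tensor, cohom_cons, smul_splitSum]

/-- Both sides satisfy the same recursion, which chooses the block that contains the last arrow; see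
`cohom_consL` and `Chain.blockSum_cons`. -/
theorem cohom_toT {f : T k Alt →ₗ[k] V k Alt} {X Y : CatA 3 k}
    (c : Chain (Homog (CatA.grading k D p q)) X Y) :
    cohom f (toT c.val) = c.blockSum (blocksT f) := by
  induction h : c.length using Nat.strong_induction_on generalizing Y with
  | _ n ih =>
  cases c with
  | nil => rw [Chain.blockSum_nil, Chain.val_nil, toT_nil, cohom_nil, blocksT]
  | cons c a =>
    rw [Chain.val_cons, toT_cons, cohom_consL, conv_toT, Chain.blockSum_cons]
    refine Chain.splitSum_congr fun Y z x hzx => ?_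
    rw [LinearMap.compl₂_apply, ih z.length ?_ z rfl]
    · refine (Chain.map_blockSum
        (consL (f (consL (inc a.val) (toT x.val)))).toAddMonoidHom z _).trans ?_
      congr 1
      funext P
      rw [blocksT, Chain.val_cons, toT_cons]
      rfl
    · rw [← h, ← hzx, Chain.length, Chain.length_append]
      omega

variable {δ : ℕ → ℤ}

theorem toT_mapBlocks {f : Operations (CatA.grading k D p q) δ} {f' : T k Alt →ₗ[k] V k Alt}
    (hf : Rep f f') {X Y : CatA 3 k} (P : Chain (Chain (Homog (CatA.grading k D p q))) X Y) :
    toT (Chain.mapBlocks f P).val = paritySign k P.sumEps • blocksT f' P := by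
  induction P with
  | nil =>
    rw [Chain.mapBlocks, Chain.map, Chain.val_nil, Chain.sumEps, paritySign_zero, one_smul]
    rfl
  | cons P B ih =>
    rw [Chain.mapBlocks] at ih
    rw [Chain.mapBlocks, Chain.map, Chain.val_cons, toT_cons, ih, Chain.sumEps, blocksT, hf.val,
      paritySign_add, map_smul, map_smul, LinearMap.smul_apply, smul_smul]

theorem inc_blockSum {m : Operations (CatA.grading k D p q) δ}
    {f : Operations (CatA.grading k D p q) fun n => 1 - n} {m' f' : T k Alt →ₗ[k] V k Alt}
    (hm : Rep m m') (hf : Rep f f') {X Y : CatA 3 k}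
    (c : Chain (Homog (CatA.grading k D p q)) X Y) :
    inc (c.blocks.map fun P =>
      paritySign k P.functorSign • m.op (P.map fun B => f.op B.val)).sum
      = paritySign k c.eps • m' (cohom f' (toT c.val)) := by
  rw [cohom_toT]
  refine (Chain.map_blockSum inc.toAddMonoidHom c _).trans (Eq.trans ?_
    (Chain.map_blockSum (paritySign k c.eps • m').toAddMonoidHom c _).symm)
  refine Chain.blockSum_congr fun P hP => ?_
  change inc (paritySign k _ • _) = paritySign k c.eps • m' _
  rw [map_smul, ← Chain.mapBlocks_val, hm.val, toT_mapBlocks hf, map_smul, smul_smul, smul_smul,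
    ← paritySign_add, ← paritySign_add, Chain.functorSign_eq, hP]

end Represents

end Bar

namespace Bar

open Alt

/-! ### Comparison of structures, homotopies and constants -/

section Translation

variable {k : Type*} [Field k] {D : ℕ} {p q : ZMod 3 → ℤ}

theorem toT_length_mem {X Y : CatA 3 k} (c : HomChain X Y) :
    toT c ∈ supp k fun l => l.length = c.length := by
  induction c with
  | nil => rw [Chain.length]; exact tensor_mem rfl
  | cons c a ih =>
    rw [toT_cons, Chain.length]
    exact consL_mem (mem_supp_true _) ih fun w l _ hl => by rw [List.length_cons, hl]

theorem inc_comp_wordHom {X Y Z : CatA 3 k} {w₁ w₂ : Alt} (h₂ : w₂.src = X.idx ∧ w₂.tgt = Y.idx)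
    (h₁ : w₁.src = Y.idx ∧ w₁.tgt = Z.idx) :
    inc (wordHom X Y w₂ ≫ wordHom Y Z w₁) = ovec k (Alt.mul w₁ w₂) := by
  have hc : (Word.ofAlt w₂).tgt = (Word.ofAlt w₁).src := by
    rw [tgt_ofAlt, src_ofAlt, h₂.2, h₁.1]
  have e : wordHom X Y w₂ ≫ wordHom Y Z w₁
      = CatA.mono k X.idx Z.idx (Word.mul (Word.ofAlt w₁) (Word.ofAlt w₂)) := by
    rw [wordHom_eq h₂, wordHom_eq h₁]
    refine (CatA.compL_single _ _ _ _).trans ?_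
    rw [mul_one, one_smul]
  rw [e, ← Word.toAlt_ofAlt w₁, ← Word.toAlt_ofAlt w₂, Word.mul_toAlt hc, Word.toAlt_ofAlt,
    Word.toAlt_ofAlt]
  cases hw : Word.mul (Word.ofAlt w₁) (Word.ofAlt w₂) with
  | none => exact map_zero _
  | some w =>
    have hs := Word.src_mul hc hw
    have ht := Word.tgt_mul hc hw
    rw [src_ofAlt, h₂.1] at hs
    rw [tgt_ofAlt, h₁.2] at ht
    rw [CatA.mono, dif_pos ⟨hs, ht⟩]
    exact Finsupp.mapDomain_single

/-- On two words the sign of `epsT` is the unshifted parity of the left one, which is also the sign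
in `mu`. -/
theorem mu_toT {X Y Z : CatA 3 k} (a : X ⟶ Y) (b : Y ⟶ Z) :
    mu k (epsT k (toT (((Chain.nil X).cons a).cons b))) = inc (a ≫ b) := by
  refine LinearMap.congr_fun (f := mu k ∘ₗ epsT k ∘ₗ
    consL.flip (consL (inc a) (tensor k [])) ∘ₗ inc) (g := inc ∘ₗ Linear.leftComp k Z a)
    (hom_ext fun w₁ hs₁ ht₁ => ?_) b
  refine LinearMap.congr_fun (f := mu k ∘ₗ epsT k ∘ₗ consL (inc (wordHom Y Z w₁)) ∘ₗ
    consL.flip (tensor k []) ∘ₗ inc) (g := inc ∘ₗ Linear.rightComp k X (wordHom Y Z w₁))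
    (hom_ext fun w₂ hs₂ ht₂ => ?_) a
  change mu k (epsT k (consL (inc (wordHom Y Z w₁)) (consL (inc (wordHom X Y w₂)) (tensor k []))))
    = inc (wordHom X Y w₂ ≫ wordHom Y Z w₁)
  rw [inc_comp_wordHom ⟨hs₂, ht₂⟩ ⟨hs₁, ht₁⟩, inc_wordHom ⟨hs₁, ht₁⟩, inc_wordHom ⟨hs₂, ht₂⟩,
    consL_vec_tensor, consL_vec_tensor, epsT_tensor, map_smul, mu_pair, smul_smul]
  have : paritySign k (eps [w₁, w₂]) = - sg k w₁ := by
    simp [eps, paritySign_add, paritySign_one, sg]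
  rw [this, neg_mul_neg, sg_mul_self, one_smul]

/-- Each path is the tensor of a chain of homogeneous morphisms, and on all other nonempty lists a
graded operator vanishes anyway. -/
theorem eq_zero_of_toT (D : ℕ) (p q : ZMod 3 → ℤ) {P Q : ZMod 3 → ℚ} {η : ZMod 2 × ℚ}
    {Ψ : T k Alt →ₗ[k] V k Alt} (hΨ : Graded P Q η Ψ) (h0 : Ψ (tensor k []) = 0)
    (h : ∀ {X Y : CatA 3 k} (c : Chain (Homog (CatA.grading k D p q)) X Y), Ψ (toT c.val) = 0) :
    Ψ = 0 :=
  T_ext fun l => by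
    by_cases hl : l ≠ [] ∧ ∃ x : ZMod 3 × ZMod 3, IsPath x.1 l x.2
    · obtain ⟨hl, ⟨j, i⟩, hp⟩ := hl
      have := h (Chain.ofWords D p q (⟨i⟩ : CatA 3 k) l ⟨j⟩)
      rw [Chain.toT_ofWords hl hp] at this
      exact this
    · rw [not_and_or, not_not] at hl
      rcases hl with rfl | hl
      · exact h0
      · exact hΨ.eq_zero fun j i hp => hl ⟨(j, i), hp⟩

theorem smul_paritySign_injective {M : Type*} [AddCommGroup M] [Module k M] {a : ZMod 2}
    {x y : M} (h : paritySign k a • x = paritySign k a • y) : x = y := by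
  rw [← paritySign_sq_smul (k := k) a x, h, paritySign_sq_smul]

theorem starts_barOp (m : AInfStructure (CatA.grading k D p q)) :
    Starts (mu k) (barOp m.toOperations) := by
  have hg := graded_barOp (c₀ := 2) m.toOperations
  have hr : Rep m.toOperations (barOp m.toOperations) := rep_barOp _
  refine ⟨fun l hl => ?_, fun l hl => ?_⟩
  · match l, hl with
    | [], _ => exact hr.nil
    | [w], _ =>
      have := hr ((Chain.nil (⟨w.src⟩ : CatA 3 k)).cons (wordHom _ ⟨w.tgt⟩ w))
      rw [m.op_one, map_zero, toT_cons, inc_wordHom (X := ⟨w.src⟩) (Y := ⟨w.tgt⟩) (w := w) ⟨rfl, rfl⟩, toT_nil, consL_vec_tensor,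
        epsT_tensor, map_smul] at this
      simpa [eps, paritySign_zero] using this.symm
  · match l, hl with
    | [w₁, w₂], _ =>
      by_cases h : w₂.tgt = w₁.src
      · have h1 := hr (((Chain.nil (⟨w₂.src⟩ : CatA 3 k)).cons (wordHom _ ⟨w₂.tgt⟩ w₂)).cons
          (wordHom _ ⟨w₁.tgt⟩ w₁))
        rw [m.op_two, ← mu_toT, toT_cons, toT_cons,
          inc_wordHom (X := ⟨w₂.src⟩) (Y := ⟨w₂.tgt⟩) (w := w₂) ⟨rfl, rfl⟩,
          inc_wordHom (X := ⟨w₂.tgt⟩) (Y := ⟨w₁.tgt⟩) (w := w₁) ⟨h.symm, rfl⟩, toT_nil, consL_vec_tensor, consL_vec_tensor, epsT_tensor,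
          map_smul, map_smul] at h1
        exact (smul_paritySign_injective h1).symm
      · have hp : ∀ j i, ¬ IsPath j [w₁, w₂] i := fun j i hp => h hp.2.1
        rw [hg.eq_zero hp, (graded_mu (k := k) (P := fun _ => 0) (Q := fun _ => 0)).eq_zero hp]

theorem isAInf_barOp (m : AInfStructure (CatA.grading k D p q)) :
    IsAInf (frac D p) (frac D q) (barOp m.toOperations) := by
  have hη : ((((2 : ℤ) : ZMod 2) + 1, ((2 : ℤ) : ℚ) - 1) : ZMod 2 × ℚ) = (1, 1) :=
    Prod.ext (by decide) (by norm_num)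
  have hg : Graded (frac D p) (frac D q) (1, 1) (barOp m.toOperations) :=
    hη ▸ graded_barOp (c₀ := 2) m.toOperations
  refine ⟨⟨hg, starts_barOp m⟩, ?_⟩
  refine eq_zero_of_toT D p q (hg.comp_coder hg _) (by simp) fun c => ?_
  have := inc_insertionSum (rep_barOp m.toOperations) (rep_barOp m.toOperations) c
  rw [m.ainf, map_zero] at this
  refine smul_paritySign_injective (k := k) (a := c.eps) ?_
  rw [smul_zero]
  exact this.symm

theorem exists_aInfStructure {b : T k Alt →ₗ[k] V k Alt}
    (hb : IsAInf (frac D p) (frac D q) b) :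
    ∃ m : AInfStructure (CatA.grading k D p q), Rep m.toOperations b := by
  have hη : ((((2 : ℤ) : ZMod 2) + 1, ((2 : ℤ) : ℚ) - 1) : ZMod 2 × ℚ) = (1, 1) :=
    Prod.ext (by decide) (by norm_num)
  obtain ⟨m, hm⟩ := exists_operations (c₀ := 2) (hη.symm ▸ hb.graded) hb.starts.1.nil
  refine ⟨⟨m, fun a => inc_injective ?_, fun a a' => inc_injective ?_, fun c => inc_injective ?_⟩,
    hm⟩
  · rw [hm, (inc (k := k)).map_zero]
    refine map_eq_zero_of_supp b (fun l hl => hb.starts.1 l ?_) (epsT_mem (toT_length_mem _))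
    rw [hl, Chain.length, Chain.length]
  · rw [hm, ← mu_toT]
    refine map_eq_of_supp b (mu k) (fun l hl => hb.starts.2 l ?_) (epsT_mem (toT_length_mem _))
    rw [hl, Chain.length, Chain.length, Chain.length]
  · rw [inc_insertionSum hm hm, map_zero]
    have := LinearMap.congr_fun hb.ainf (toT c.val)
    rw [LinearMap.comp_apply, LinearMap.zero_apply] at this
    rw [this, smul_zero]

/-- The functor equation on a chain of homogeneous morphisms is the vanishing of the defect on its
tensor, up to one common sign; both sides are translated by `inc_insertionSum` and `inc_blockSum`.
-/
theorem strictlyHomotopic_iff {m m' : AInfStructure (CatA.grading k D p q)}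
    {b b' : T k Alt →ₗ[k] V k Alt} (hb : IsAInf (frac D p) (frac D q) b)
    (hb' : IsAInf (frac D p) (frac D q) b') (hm : Rep m.toOperations b)
    (hm' : Rep m'.toOperations b') : StrictlyHomotopic m m' ↔
      ∃ f, IsUnipotent (frac D p) (frac D q) f ∧ defect (sg k) b b' f = 0 := by
  have hη : ((((1 : ℤ) : ZMod 2) + 1, ((1 : ℤ) : ℚ) - 1) : ZMod 2 × ℚ) = 0 :=
    Prod.ext (by decide) (by norm_num)
  constructor
  · rintro ⟨h⟩
    have hr : Rep h.toOperations (barOp h.toOperations) := rep_barOp _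
    have hg : Graded (frac D p) (frac D q) 0 (barOp h.toOperations) :=
      hη ▸ graded_barOp (c₀ := 1) h.toOperations
    refine ⟨barOp h.toOperations, ⟨hg, hr.nil, fun w => ?_⟩, ?_⟩
    · have := hr ((Chain.nil (⟨w.src⟩ : CatA 3 k)).cons (wordHom _ ⟨w.tgt⟩ w))
      rw [h.op_one, toT_cons, inc_wordHom (X := ⟨w.src⟩) (Y := ⟨w.tgt⟩) (w := w) ⟨rfl, rfl⟩, toT_nil, consL_vec_tensor, epsT_tensor,
        map_smul] at this
      simpa [eps, paritySign_zero] using this.symm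
    · refine eq_zero_of_toT D p q (hb.graded.defect hb'.graded hg hr.nil) ?_ fun c => ?_
      · rw [defect_apply, coder_nil, cohom_nil, hb'.starts.1.nil, map_zero, sub_zero]
      · have := congrArg inc (h.functor_eq c)
        rw [inc_insertionSum hr hm, inc_blockSum hm' hr] at this
        rw [defect_apply, smul_paritySign_injective this, sub_self]
  · rintro ⟨f, hf, h0⟩
    obtain ⟨g, hg⟩ := exists_operations (c₀ := 1) (hη.symm ▸ hf.graded) hf.nil
    refine ⟨⟨g, fun a => inc_injective ?_, fun c => inc_injective ?_⟩⟩
    · rw [hg]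
      have key : epsT k (consL (inc a) (tensor k [])) = consL (inc a) (tensor k []) :=
        LinearMap.congr_fun (f := epsT k ∘ₗ consL.flip (tensor k [])) (g := consL.flip (tensor k []))
          (V_ext fun w => by simp [eps, paritySign_zero]) (inc a)
      rw [toT_cons, toT_nil, key, hf.consL_nil]
    · rw [inc_insertionSum hg hm, inc_blockSum hm' hg]
      have := LinearMap.congr_fun h0 (toT c.val)
      rw [defect_apply, LinearMap.zero_apply, sub_eq_zero] at this
      rw [this]

theorem constCoeff_eq {X : CatA 3 k} (f : X ⟶ X) : CatA.constCoeff f = inc f (one X.idx) :=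
  (Finsupp.mapDomain_apply (f := fun w : Mon X.idx X.idx => w.1.toAlt)
    (fun _ _ h => Subtype.ext (Word.toAlt_injective h)) f ⟨.one X.idx, rfl, rfl⟩).symm

theorem inc_u (i j : ZMod 3) (h : j = i + 1) : inc (CatA.u k i j h) = vec k (alt j false 0) :=
  Finsupp.mapDomain_single

theorem inc_v (i j : ZMod 3) (h : i = j + 1) : inc (CatA.v k i j h) = vec k (alt j true 0) := by
  refine Finsupp.mapDomain_single.trans ?_
  simp [Word.toAlt, vec, h]

/-- The sign is the shift sign of three odd arrows, with exponent `0 + 1 + 2`. -/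
theorem coeffA_eq {m : AInfStructure (CatA.grading k D p q)} {b : T k Alt →ₗ[k] V k Alt}
    (hm : Rep m.toOperations b) : CatA.coeffA m = - b (tensor k (K false 1 3)) (one 1) := by
  rw [CatA.coeffA, constCoeff_eq, hm]
  simp only [toT_cons, inc_u, toT_nil, consL_vec_tensor, epsT_tensor]
  have h1 : ∀ l : List Alt, l = K false 1 3 → (b (paritySign k (eps l) • tensor k l)) (one 1)
      = - b (tensor k (K false 1 3)) (one 1) := by
    rintro _ rfl
    rw [map_smul, show eps (K false 1 3) = 1 by decide, paritySign_one]
    simp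
  exact h1 _ (by decide)

theorem coeffB_eq {m : AInfStructure (CatA.grading k D p q)} {b : T k Alt →ₗ[k] V k Alt}
    (hm : Rep m.toOperations b) : CatA.coeffB m = - b (tensor k (K true 1 3)) (one 1) := by
  rw [CatA.coeffB, constCoeff_eq, hm]
  simp only [toT_cons, inc_v, toT_nil, consL_vec_tensor, epsT_tensor]
  have h1 : ∀ l : List Alt, l = K true 1 3 → (b (paritySign k (eps l) • tensor k l)) (one 1)
      = - b (tensor k (K true 1 3)) (one 1) := by
    rintro _ rfl
    rw [map_smul, show eps (K true 1 3) = 1 by decide, paritySign_one]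
    simp
  exact h1 _ (by decide)

end Translation

end Bar

namespace Bar

open Alt

/-! ### The classification -/

variable {k : Type*} [Field k] {D : ℕ} {p q : ZMod 3 → ℤ}

theorem sumOne_frac (hD : 0 < D) (hp : p 1 + p 2 + p 3 = D) (hq : q 1 + q 2 + q 3 = D) :
    SumOne (frac D p) (frac D q) := by
  have hD' : (D : ℚ) ≠ 0 := by exact_mod_cast hD.ne'
  have hp' : (p 1 + p 2 + p 3 : ℚ) = D := by exact_mod_cast hp
  have hq' : (q 1 + q 2 + q 3 : ℚ) = D := by exact_mod_cast hq
  exact ⟨by rw [frac, frac, frac, ← add_div, ← add_div, hp', div_self hD'],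
    by rw [frac, frac, frac, ← add_div, ← add_div, hq', div_self hD']⟩

/-- A homotopy has zero defect, so `defect_K_three` equates the constants. Conversely, equal
constants remove the only possible obstruction, by `exists_functor`. -/
theorem strictlyHomotopic_iff_coeff (h : SumOne (frac D p) (frac D q))
    (m m' : AInfStructure (CatA.grading k D p q)) :
    StrictlyHomotopic m m' ↔
      CatA.coeffA m = CatA.coeffA m' ∧ CatA.coeffB m = CatA.coeffB m' := by
  have hm : Rep m.toOperations (barOp m.toOperations) := rep_barOp _
  have hm' : Rep m'.toOperations (barOp m'.toOperations) := rep_barOp _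
  have hb := isAInf_barOp m
  have hb' := isAInf_barOp m'
  rw [strictlyHomotopic_iff hb hb' hm hm', coeffA_eq hm, coeffA_eq hm', coeffB_eq hm,
    coeffB_eq hm', neg_inj, neg_inj]
  constructor
  · rintro ⟨f, hf, h0⟩
    have key : ∀ e, barOp m.toOperations (tensor k (K e 1 3)) (one 1)
        = barOp m'.toOperations (tensor k (K e 1 3)) (one 1) := fun e => by
      have := defect_K_three hb.toIsPert hb'.toIsPert hf e 1
      rw [h0, LinearMap.zero_apply, Finsupp.zero_apply] at this
      exact sub_eq_zero.1 this.symm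
    exact ⟨key false, key true⟩
  · rintro ⟨h₁, h₂⟩
    exact exists_functor h hb hb' fun e => by cases e <;> assumption

theorem exists_aInfStructure_coeff (h : SumOne (frac D p) (frac D q)) (a b : k) :
    ∃ m : AInfStructure (CatA.grading k D p q), CatA.coeffA m = a ∧ CatA.coeffB m = b := by
  -- The minus signs compensate the shift sign in `coeffA_eq` and `coeffB_eq`.
  obtain ⟨c, hc, hK⟩ := exists_ainf h (fun e => if e then -b else -a)
  obtain ⟨m, hm⟩ := exists_aInfStructure hc
  refine ⟨m, ?_, ?_⟩
  · rw [coeffA_eq hm, hK]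
    simp [vec]
  · rw [coeffB_eq hm, hK]
    simp [vec]

end Bar

theorem mainTheorem10 {k : Type*} [Field k] (D : ℕ) (hD : 0 < D) (p q : ZMod 3 → ℤ)
    (hp_parity : ∀ i, p i ≡ D [ZMOD 2]) (hq_parity : ∀ i, q i ≡ D [ZMOD 2])
    (hp_sum : p 1 + p 2 + p 3 = D) (hq_sum : q 1 + q 2 + q 3 = D) :
    ∃ h : _root_.Equivalence
        (StrictlyHomotopic : AInfStructure (CatA.grading k D p q) →
          AInfStructure (CatA.grading k D p q) → Prop),
      ∃ Φ : Quotient (Setoid.mk StrictlyHomotopic h) → k × k,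
        (∀ m : AInfStructure (CatA.grading k D p q),
          Φ (Quotient.mk (Setoid.mk StrictlyHomotopic h) m) = (CatA.coeffA m, CatA.coeffB m)) ∧
        Function.Bijective Φ := by
  have h := Bar.sumOne_frac hD hp_sum hq_sum
  have key := Bar.strictlyHomotopic_iff_coeff (k := k) h
  -- Homotopy is the kernel relation of the map to `(a, b)`, so it is an equivalence relation and
  -- the induced map is injective.
  refine ⟨⟨fun m => (key m m).2 ⟨rfl, rfl⟩,
    fun {m m'} hm => (key m' m).2 ⟨((key m m').1 hm).1.symm, ((key m m').1 hm).2.symm⟩,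
    fun {m m' m''} h₁ h₂ => (key m m'').2 ⟨((key m m').1 h₁).1.trans ((key m' m'').1 h₂).1,
      ((key m m').1 h₁).2.trans ((key m' m'').1 h₂).2⟩⟩,
    Quotient.lift (fun m => (CatA.coeffA m, CatA.coeffB m))
      (fun m m' hm => Prod.ext_iff.2 ((key m m').1 hm)), fun m => rfl, ?_, ?_⟩
  · rintro ⟨m⟩ ⟨m'⟩ hmm
    exact Quotient.sound ((key m m').2 (Prod.ext_iff.1 hmm))
  · rintro ⟨a, b⟩
    obtain ⟨m, ha, hb⟩ := Bar.exists_aInfStructure_coeff (p := p) (q := q) h a b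
    exact ⟨Quotient.mk _ m, Prod.ext ha hb⟩
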